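/- Let $K$ be a separably closed field of characteristic $p>0$ with algebraic closure $\overline K$, let $C$ be a geometrically integral curve over $K$ (a separated, geometrically integral $K$-scheme of finite type and of dimension $1$), and let $P\in C$ be a closed point at which $C$ is regular. Let $F\colon C\to C^{(p)}$ be the relative Frobenius morphism of $C$ over $K$, let $C_1$ be the normalization of the integral curve $C^{(p)}$, and let $P_1\in C_1$ be the point lying over $F(P)$. For a point $Q$ of a geometrically integral curve $D$ over $K$ (here $(D,Q)=(C,P)$ or $(C_1,P_1)$), let $\overline K\mathcal O_{D,Q}=\overline K\otimes_K\mathcal O_{D,Q}$ and let $\widetilde{\overline K\mathcal O_{D,Q}}$ be its integral closure in its field of fractions. The differential degree of $Q$ on $D$ is \[ d(D,Q)=1+\dim_{\overline K}\operatorname{Coker}\Bigl(\widetilde{\overline K\mathcal O_{D,Q}}\otimes_{\overline K\mathcal O_{D,Q}}\Omega_{\overline K\mathcal O_{D,Q}/\overline K}\to\Omega_{\widetilde{\overline K\mathcal O_{D,Q}}/\overline K}\Bigr). \] Suppose that $d(C_1,P_1)=1$. Then $\widetilde{\overline K\mathcal O_{C,P}}$ is a discrete valuation ring, the above cokernel for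 $(C,P)$ is finite-dimensional and, if $\nu$ denotes the normalized discrete valuation of $\widetilde{\overline K\mathcal O_{C,P}}$, \[ \{\nu(x)\;:\;0\ne x\in\overline K\mathcal O_{C,P}\}=d(C,P)\,\mathbb Z_{\ge 0}+p\,\mathbb Z_{\ge 0}, \] and consequently the $\delta$-invariant is finite and \[ \dim_{\overline K}\bigl(\widetilde{\overline K\mathcal O_{C,P}}/\overline K\mathcal O_{C,P}\bigr)=\frac{(d(C,P)-1)(p-1)}{2}. \] -/

import Mathlib

open CategoryTheory CategoryTheory.Limits AlgebraicGeometry TopologicalSpace Opposite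
open scoped TensorProduct

universe u

namespace FrobCurve

noncomputable section

/-! ### Frobenius morphisms -/

/-- The map `x ↦ x ^ p` on a commutative ring in which the prime `p` is zero (the zero ring is
allowed, which is why Mathlib's `frobenius` is not used here). -/
def powRingHom (p : ℕ) [hp : Fact p.Prime] (R : Type u) [CommRing R] (h : (p : R) = 0) :
    R →+* R where
  toFun x := x ^ p
  map_one' := one_pow p
  map_mul' x y := mul_pow x y p
  map_zero' := zero_pow hp.out.ne_zero
  map_add' x y := by
    obtain ⟨r, hr⟩ := exists_add_pow_prime_eq hp.out x y
    rw [hr, h]; ring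

theorem natCast_section_eq_zero {X : Scheme.{u}} {p : ℕ} (h : (p : Γ(X, ⊤)) = 0) (U : X.Opens) :
    (p : Γ(X, U)) = 0 := by
  have := congrArg (X.presheaf.map (homOfLE (le_top : U ≤ ⊤)).op).hom h
  simpa using this

/-- The absolute Frobenius of a scheme of characteristic `p`: the identity on points and
`s ↦ s ^ p` on sections. -/
def absoluteFrobenius (X : Scheme.{u}) (p : ℕ) [hp : Fact p.Prime] (h : (p : Γ(X, ⊤)) = 0) :
    X ⟶ X where
  base := 𝟙 _
  c :=
    { app := fun U =>
        CommRingCat.ofHom (powRingHom p Γ(X, U.unop) (natCast_section_eq_zero h U.unop))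
      naturality := fun U V i => by
        ext x
        exact (map_pow (X.presheaf.map i).hom x p).symm }
  prop x := by
    constructor
    intro a ha
    obtain ⟨U, hxU, s, rfl⟩ := X.presheaf.exists_germ_eq a
    erw [PresheafedSpace.stalkMap_germ_apply] at ha
    have h2 : IsUnit ((X.presheaf.germ U x hxU).hom (s ^ p)) := ha
    rw [map_pow] at h2
    exact (isUnit_pow_iff hp.out.ne_zero).1 h2

section OverField

variable {K : Type u} [Field K] (p : ℕ) [hp : Fact p.Prime] [CharP K p]
variable {X : Scheme.{u}} (f : X ⟶ Spec (.of K))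

/-- The structure map from `K` to the global functions of a `K`-scheme. -/
def toGlobalSections : K →+* Γ(X, ⊤) :=
  ((Scheme.ΓSpecIso (.of K)).inv ≫ f.appTop).hom

theorem natCast_globalSections_eq_zero {K : Type u} [Field K] (p : ℕ) [CharP K p]
    {X : Scheme.{u}} (f : X ⟶ Spec (.of K)) : (p : Γ(X, ⊤)) = 0 := by
  rw [← map_natCast (toGlobalSections f), CharP.cast_eq_zero, map_zero]

/-- The Frobenius `Spec K ⟶ Spec K` of the ground field. -/
def specFrobenius (K : Type u) [Field K] [CharP K p] : Spec (.of K) ⟶ Spec (.of K) :=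
  Spec.map (CommRingCat.ofHom (frobenius K p))

/-- The Frobenius twist `X^(p)`, i.e. the base change of `X` along the Frobenius of `K`. -/
def frobeniusTwist : Scheme.{u} := pullback f (specFrobenius p K)

/-- The structure morphism of `X^(p)`. -/
def frobeniusTwistStr : frobeniusTwist p f ⟶ Spec (.of K) := pullback.snd f (specFrobenius p K)

theorem isPullback_frobeniusTwist :
    IsPullback (pullback.fst f (specFrobenius p K) : frobeniusTwist p f ⟶ X)
      (frobeniusTwistStr p f) f (specFrobenius p K) :=
  IsPullback.of_hasPullback f (specFrobenius p K)

theorem absoluteFrobenius_comp :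
    absoluteFrobenius X p (natCast_globalSections_eq_zero p f) ≫ f = f ≫ specFrobenius p K := by
  apply ext_of_isAffine
  rw [Scheme.Hom.comp_appTop, Scheme.Hom.comp_appTop]
  have h : (specFrobenius p K).appTop = (Scheme.ΓSpecIso (.of K)).hom ≫
      CommRingCat.ofHom (frobenius K p) ≫ (Scheme.ΓSpecIso (.of K)).inv := by
    rw [← Category.assoc, Iso.eq_comp_inv]
    exact Scheme.ΓSpecIso_naturality _
  rw [h]
  ext x
  have h1 : (Scheme.ΓSpecIso (.of K)).inv.hom (((Scheme.ΓSpecIso (.of K)).hom.hom x) ^ p) =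
      x ^ p := by
    rw [map_pow]
    congr 1
    exact (Scheme.ΓSpecIso (.of K)).hom_inv_id_apply x
  exact ((map_pow f.appTop.hom x p).symm.trans (congrArg f.appTop.hom h1.symm))

/-- The relative Frobenius morphism `X ⟶ X^(p)` over `K`. -/
def relativeFrobenius : X ⟶ frobeniusTwist p f :=
  pullback.lift (absoluteFrobenius X p (natCast_globalSections_eq_zero p f)) f
    (absoluteFrobenius_comp p f)

end OverField

/-! ### Normalization -/

/-- The normalization of an integral scheme: its relative normalization in the spectrum of its
function field. -/
def normalization (X : Scheme.{u}) [IsIntegral X] [QuasiSeparatedSpace X] : Scheme.{u} :=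
  (X.fromSpecStalk (genericPoint X)).normalization

/-- The normalization morphism. -/
def normalizationMap (X : Scheme.{u}) [IsIntegral X] [QuasiSeparatedSpace X] :
    normalization X ⟶ X :=
  (X.fromSpecStalk (genericPoint X)).fromNormalization

section NormalizedFrobenius

variable {K : Type u} [Field K] (p : ℕ) [hp : Fact p.Prime] [CharP K p]
variable {X : Scheme.{u}} (f : X ⟶ Spec (.of K))

instance geometricallyIntegral_frobeniusTwistStr [GeometricallyIntegral f] :
    GeometricallyIntegral (frobeniusTwistStr p f) :=
  MorphismProperty.of_isPullback (P := @GeometricallyIntegral)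
    (isPullback_frobeniusTwist p f) inferInstance

instance isSeparated_frobeniusTwistStr [IsSeparated f] :
    IsSeparated (frobeniusTwistStr p f) :=
  MorphismProperty.of_isPullback (P := @IsSeparated) (isPullback_frobeniusTwist p f) inferInstance

instance isIntegral_frobeniusTwist [GeometricallyIntegral f] :
    IsIntegral (frobeniusTwist p f) :=
  GeometricallyIntegral.isIntegral_of_subsingleton (frobeniusTwistStr p f)

instance quasiSeparatedSpace_frobeniusTwist [IsSeparated f] :
    QuasiSeparatedSpace (frobeniusTwist p f) :=
  quasiSeparatedSpace_of_quasiSeparated (frobeniusTwistStr p f)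

variable [GeometricallyIntegral f] [IsSeparated f]

/-- The curve `X₁`: the normalization of `X^(p)`. -/
def normalizedFrobenius : Scheme.{u} := normalization (frobeniusTwist p f)

/-- The normalization morphism `X₁ ⟶ X^(p)`. -/
def normalizedFrobeniusMap : normalizedFrobenius p f ⟶ frobeniusTwist p f :=
  normalizationMap (frobeniusTwist p f)

/-- The structure morphism of `X₁` over `K`. -/
def normalizedFrobeniusStr : normalizedFrobenius p f ⟶ Spec (.of K) :=
  normalizedFrobeniusMap p f ≫ frobeniusTwistStr p f

end NormalizedFrobenius

/-! ### Local rings as `K`-algebras -/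

section LocalRing

variable {K : Type u} [Field K] {X : Scheme.{u}} (f : X ⟶ Spec (.of K)) (x : X)

/-- The local ring of the `K`-scheme `X` at `x`. -/
def LocalRing (_f : X ⟶ Spec (.of K)) (x : X) : Type u := X.presheaf.stalk x

instance : CommRing (LocalRing f x) := inferInstanceAs (CommRing (X.presheaf.stalk x))

instance : Algebra K (LocalRing f x) :=
  ((X.presheaf.germ ⊤ x trivial).hom.comp (toGlobalSections f)).toAlgebra

end LocalRing

/-! ### Invariants of a local ring after extension of scalars to an algebraic closure

Below `L` is an algebraic closure of `K` and `O` is the local ring of a geometrically integral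
curve over `K`. -/

section Invariants

variable (K : Type u) [Field K] (L : Type u) [Field L] [Algebra K L]
variable (O : Type u) [CommRing O] [Algebra K O]

/-- The ring `L O = L ⊗ O`. -/
def Geom : Type u := L ⊗[K] O

instance : CommRing (Geom K L O) := inferInstanceAs (CommRing (L ⊗[K] O))

instance : Algebra L (Geom K L O) := inferInstanceAs (Algebra L (L ⊗[K] O))

/-- The normalization of `L O`: its integral closure in its field of fractions. -/
def GeomNorm : Type u := integralClosure (Geom K L O) (FractionRing (Geom K L O))

instance : CommRing (GeomNorm K L O) :=
  inferInstanceAs (CommRing (integralClosure (Geom K L O) (FractionRing (Geom K L O))))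

instance : Algebra (Geom K L O) (GeomNorm K L O) :=
  inferInstanceAs
    (Algebra (Geom K L O) (integralClosure (Geom K L O) (FractionRing (Geom K L O))))

instance : Algebra L (GeomNorm K L O) :=
  ((algebraMap (Geom K L O) (GeomNorm K L O)).comp (algebraMap L (Geom K L O))).toAlgebra

instance : IsScalarTower L (Geom K L O) (GeomNorm K L O) := .of_algebraMap_eq' rfl

/-- The cokernel of the natural map `α : Õ ⊗ Ω(LO / L) → Ω(Õ / L)`, where `Õ` is the
normalization of `LO`. -/
abbrev DiffCoker : Type u :=
  Ω[GeomNorm K L O⁄L] ⧸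
    LinearMap.range (KaehlerDifferential.mapBaseChange L (Geom K L O) (GeomNorm K L O))

/-- The differential degree `1 + dim (coker α)`. -/
def differentialDegree : ℕ := 1 + Module.finrank L (DiffCoker K L O)

/-- The `L`-vector space `Õ / LO`. -/
abbrev DeltaQuotient : Type u :=
  GeomNorm K L O ⧸
    LinearMap.range (IsScalarTower.toAlgHom L (Geom K L O) (GeomNorm K L O)).toLinearMap

/-- The `δ`-invariant (singularity degree) `dim (Õ / LO)`. -/
def deltaInvariant : ℕ := Module.finrank L (DeltaQuotient K L O)

/-- The semigroup of `LO`: all integers that are values of elements of `LO` under the normalized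
discrete valuation with valuation ring `Õ` (the value of `0` is `∞`, hence not an integer). -/
def semigroup [IsDomain (GeomNorm K L O)] [IsDiscreteValuationRing (GeomNorm K L O)] : Set ℤ :=
  {l | ∃ (x : Geom K L O) (n : ℕ),
    IsDiscreteValuationRing.addVal (GeomNorm K L O)
      (algebraMap (Geom K L O) (GeomNorm K L O) x) = n ∧ l = n}

end Invariants

end

end FrobCurve

/-! Let `O` be the local ring of `C` at `P`, `B = L ⊗ O`, `R` the normalization of `B` and `v` its
valuation. Since `K` is separably closed, `L / K` is purely inseparable, so every element of `B` has
a `p ^ n`-th power in the discrete valuation ring `O`. This makes `R` a valuation ring; finiteness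
of normalization over the perfect field `L` makes it discrete, with residue field `L`, and provides
a nonzero `s` with `s R ⊆ B`. A function field over `L` has degree `p` over its `p`-th powers, so `R
= ∑ Rᵖ tⁱ` with `i < p` for every uniformizer `t` (`IsGeometricModel.hasFrobeniusExpansion`), and
the differentials of `R` are free on `dt`.

The local ring `O₁` of `C₁` at `P₁` embeds in `O` as a saturated subring that contains all `p`-th
powers and consists of fractions of elements of `K[Oᵖ]` (`exists_isFrobeniusSubring`). Hence the
normalization of `L ⊗ O₁` is `Rᵖ`, a copy of `R`. Differential degree one yields an element of `L ⊗
O₁` with unit derivative; minus a constant it is a uniformizer, and its powers take all values, so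
`L ⊗ O₁` is already normal (`algebraMap_surjective_of_finrank_kaehlerCoker_eq_zero`). Thus `L ⊗ O₁ =
Rᵖ` inside `R`.

Consequently any `p + 1` elements of `O` are dependent over `O₁`, and one element `z` generates `O`
(`exists_generator`). Either all values of `O₁` are divisible by `p` and a uniformizer of `O`
generates, or `O₁` contains a uniformizer of `O` and a lift of a new residue class generates. If
there were no new residue class either, elements of `B` would be `p`-th powers of `R` up to
arbitrarily high order, and all values of `B` would be divisible by `p`; this contradicts `s, s t ∈
B`. It follows that `B = Rᵖ[z]`.

Subtracting a `p`-th power from `z` makes `m = v(z)` prime to `p`. The terms of `∑ aᵢᵖ zⁱ` then have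
distinct values modulo `p`, so the semigroup is generated by `m` and `p`. The differential kills
`Rᵖ`, so the image of the differentials of `B` is generated by `dz`, which has order `m - 1`; the
differential degree is therefore `m`. Finally `dim R / B` counts the values missing from `B`, and
the symmetry of the semigroup gives `(m - 1)(p - 1) / 2` of them. -/

namespace FrobCurve

set_option linter.unusedSectionVars false

/-! ### Valuations of sums, and codimension as the number of missing values -/

section Valuation

open IsDiscreteValuationRing

variable {R : Type*} [CommRing R] [IsDomain R] [IsDiscreteValuationRing R]

/-- By induction a partial sum has the value of one of its terms. The next term either has a
different value, where the ultrametric inequality is an equality, or the common value is `⊤` and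
both vanish. -/
theorem addVal_sum_eq_inf {ι : Type*} (s : Finset ι) (f : ι → R)
    (h : ∀ i ∈ s, ∀ j ∈ s, i ≠ j → addVal R (f i) = addVal R (f j) → addVal R (f i) = ⊤) :
    addVal R (∑ i ∈ s, f i) = s.inf fun i => addVal R (f i) := by
  classical
  induction s using Finset.induction_on with
  | empty => simp
  | insert a s ha ih =>
    have ih' := ih fun i hi j hj =>
      h i (Finset.mem_insert_of_mem hi) j (Finset.mem_insert_of_mem hj)
    rw [Finset.sum_insert ha, Finset.inf_insert, ← ih']
    by_cases hne : addVal R (f a) = addVal R (∑ i ∈ s, f i)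
    · have htop : addVal R (f a) = ⊤ := by
        rcases s.eq_empty_or_nonempty with rfl | hs
        · simpa using hne
        · obtain ⟨j, hj, hj'⟩ := Finset.exists_mem_eq_inf s hs fun i => addVal R (f i)
          refine h a (Finset.mem_insert_self a s) j (Finset.mem_insert_of_mem hj) ?_ ?_
          · rintro rfl; exact ha hj
          · rw [hne, ih', hj']
      rw [← hne, addVal_eq_top_iff.1 htop, addVal_eq_top_iff.1 (hne.symm.trans htop)]
      simp
    · exact AddValuation.map_add_of_distinct_val _ hne

theorem natCast_lt_addVal_iff {n : ℕ} {x : R} :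
    (n : ℕ∞) < addVal R x ↔ ((n + 1 : ℕ) : ℕ∞) ≤ addVal R x := by
  rw [Nat.cast_succ]
  exact (ENat.add_one_le_iff (ENat.natCast_ne_top n)).symm

theorem one_le_addVal_iff {x : R} : 1 ≤ addVal R x ↔ x ∈ IsLocalRing.maximalIdeal R := by
  rw [Order.one_le_iff_ne_zero, Ne, addVal_eq_zero_iff, IsLocalRing.mem_maximalIdeal,
    mem_nonunits_iff]

variable {L : Type*} [Field L] [Algebra L R]

theorem addVal_algebraMap_of_ne_zero {c : L} (hc : c ≠ 0) :
    addVal R (algebraMap L R c) = 0 :=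
  addVal_eq_zero_iff.2 ((IsUnit.mk0 c hc).map _)

/-- The constant is the residue of the quotient `x / w`. -/
theorem exists_lt_addVal_sub_smul
    (hres : ∀ x : R, ∃ c : L, x - algebraMap L R c ∈ IsLocalRing.maximalIdeal R)
    {x w : R} {n : ℕ} (hx : (n : ℕ∞) ≤ addVal R x) (hw : addVal R w = n) :
    ∃ c : L, ((n + 1 : ℕ) : ℕ∞) ≤ addVal R (x - c • w) := by
  obtain ⟨u, rfl⟩ := addVal_le_iff_dvd.1 (hw.trans_le hx)
  obtain ⟨c, hc⟩ := hres u
  refine ⟨c, ?_⟩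
  rw [Algebra.smul_def, mul_comm w, ← sub_mul, addVal_mul, hw, Nat.cast_succ, add_comm]
  gcongr
  exact one_le_addVal_iff.2 hc

/-- The powers `t ^ g`, for `g` a missing value, form a basis of the quotient. A nontrivial
combination of them has a missing value, so it is not in `W`; conversely the value of any element
can be raised step by step, by subtracting a multiple of such a power or of an element of `W`, until
it reaches `N`. -/
theorem finite_quotient_and_finrank_eq_card
    (hres : ∀ x : R, ∃ c : L, x - algebraMap L R c ∈ IsLocalRing.maximalIdeal R)
    (W : Submodule L R) (N : ℕ) (hN : ∀ x : R, (N : ℕ∞) ≤ addVal R x → x ∈ W)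
    (G : Finset ℕ) (hG : ∀ n, n ∈ G ↔ ∀ w ∈ W, addVal R w ≠ n) :
    Module.Finite L (R ⧸ W) ∧ Module.finrank L (R ⧸ W) = G.card := by
  obtain ⟨t, ht⟩ := exists_irreducible R
  let Φ : (G → L) →ₗ[L] R ⧸ W :=
    W.mkQ ∘ₗ Fintype.linearCombination L fun g : G => t ^ (g : ℕ)
  have hΦ (c : G → L) : Φ c = W.mkQ (∑ g : G, c g • t ^ (g : ℕ)) := rfl
  have hval (c : L) (hc : c ≠ 0) (g : ℕ) : addVal R (c • t ^ g) = g := by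
    rw [Algebra.smul_def, addVal_mul, addVal_algebraMap_of_ne_zero hc, ht.addVal_pow, zero_add]
  have hinj : Function.Injective Φ := by
    rw [← LinearMap.ker_eq_bot, LinearMap.ker_eq_bot']
    intro c hc
    by_contra hne
    have hmem : ∑ g : G, c g • t ^ (g : ℕ) ∈ W := by
      exact (Submodule.Quotient.mk_eq_zero W).1 hc
    have hinf := addVal_sum_eq_inf Finset.univ (fun g : G => c g • t ^ (g : ℕ)) <| by
      intro i _ j _ hij he
      by_cases hi : c i = 0
      · simp [hi]
      by_cases hj : c j = 0
      · rw [he]; simp [hj]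
      rw [hval _ hi, hval _ hj] at he
      exact absurd (Subtype.ext (by exact_mod_cast he)) hij
    obtain ⟨g₀, hg₀⟩ : ∃ g, c g ≠ 0 := by
      by_contra! h
      exact hne (funext h)
    obtain ⟨j, -, hj⟩ := Finset.exists_mem_eq_inf (Finset.univ : Finset G) ⟨g₀, Finset.mem_univ _⟩
      (fun g : G => addVal R (c g • t ^ (g : ℕ)))
    have hcj : c j ≠ 0 := by
      intro h0
      have h1 : (Finset.univ : Finset G).inf (fun g : G => addVal R (c g • t ^ (g : ℕ))) ≤
        addVal R (c g₀ • t ^ (g₀ : ℕ)) := Finset.inf_le (Finset.mem_univ g₀)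
      rw [hj, hval _ hg₀] at h1
      simp [h0] at h1
    refine (hG j).1 j.2 _ hmem ?_
    rw [hinf, hj, hval _ hcj]
  have hsurj : Function.Surjective Φ := by
    -- Here `k` bounds the number of steps left before the value reaches `N`.
    have key : ∀ k n : ℕ, N ≤ n + k → ∀ x : R, (n : ℕ∞) ≤ addVal R x →
        W.mkQ x ∈ LinearMap.range Φ := by
      intro k
      induction k with
      | zero =>
        intro n hn x hx
        have : x ∈ W := hN x (le_trans (by exact_mod_cast hn) hx)
        rw [Submodule.mkQ_apply, (Submodule.Quotient.mk_eq_zero W).2 this]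
        exact zero_mem _
      | succ k ih =>
        intro n hn x hx
        have step (w : R) (hw : addVal R w = n) (hr : W.mkQ w ∈ LinearMap.range Φ) :
            W.mkQ x ∈ LinearMap.range Φ := by
          obtain ⟨c, hc⟩ := exists_lt_addVal_sub_smul hres hx hw
          have := add_mem (ih (n + 1) (by omega) _ hc) (Submodule.smul_mem _ c hr)
          rwa [← map_smul, ← map_add, sub_add_cancel] at this
        by_cases hnG : n ∈ G
        · refine step (t ^ n) (ht.addVal_pow n) ⟨Pi.single ⟨n, hnG⟩ 1, ?_⟩
          classical
          rw [hΦ]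
          congr 1
          rw [Finset.sum_eq_single ⟨n, hnG⟩] <;> simp +contextual
        · rw [hG] at hnG
          push Not at hnG
          obtain ⟨w, hw, hwn⟩ := hnG
          refine step w hwn ?_
          rw [Submodule.mkQ_apply, (Submodule.Quotient.mk_eq_zero W).2 hw]
          exact zero_mem _
    intro y
    obtain ⟨x, rfl⟩ := W.mkQ_surjective y
    exact key N 0 (by omega) x (by simp)
  let e := LinearEquiv.ofBijective Φ ⟨hinj, hsurj⟩
  exact ⟨Module.Finite.equiv e, by rw [← e.finrank_eq]; simp⟩

end Valuation

/-! ### Polynomials evaluated with `p`-th powers as coefficients -/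

section FrobEval

open Polynomial

variable {R : Type*} [CommRing R] (p : ℕ) [hp : Fact p.Prime] [CharP R p]

/-- The ring homomorphism `∑ aᵢ Xⁱ ↦ ∑ aᵢᵖ tⁱ`. -/
noncomputable def frobEval (t : R) : R[X] →+* R := eval₂RingHom (frobenius R p) t

theorem frobEval_C (t a : R) : frobEval p t (C a) = a ^ p := by
  simp [frobEval, frobenius_def]

theorem frobEval_X (t : R) : frobEval p t X = t := by
  simp [frobEval]

theorem frobEval_of_natDegree_lt (t : R) {f : R[X]} (hf : f.natDegree < p) :
    frobEval p t f = ∑ i ∈ Finset.range p, f.coeff i ^ p * t ^ i := by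
  simp [frobEval, eval₂_eq_sum_range' _ hf, frobenius_def]

/-- The coefficients enter as `p`-th powers and have zero differential, so only the variable
contributes to the chain rule. -/
theorem kaehlerD_frobEval (L : Type*) [Field L] [Algebra L R] (t : R) (f : R[X]) :
    KaehlerDifferential.D L R (frobEval p t f) =
      frobEval p t (derivative f) • KaehlerDifferential.D L R t := by
  have hC (a : R) : KaehlerDifferential.D L R (frobEval p t (C a)) = 0 := by
    rw [frobEval_C, Derivation.leibniz_pow, ← Nat.cast_smul_eq_nsmul R, CharP.cast_eq_zero,
      zero_smul]
  induction f using Polynomial.induction_on with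
  | C a => rw [hC, derivative_C, map_zero, zero_smul]
  | add f g hf hg => simp only [map_add, add_smul, hf, hg]
  | monomial n a _ =>
    rw [map_mul, map_pow, frobEval_X, Derivation.leibniz, hC, smul_zero, add_zero,
      Derivation.leibniz_pow, derivative_C_mul_X_pow, map_mul, map_pow, frobEval_X,
      ← Nat.cast_smul_eq_nsmul R, smul_smul, smul_smul, C_mul, map_mul]
    simp only [map_natCast]

/-- The monic polynomial `X ^ p - C z` evaluates to `z ^ p - z ^ p = 0`, so `f` may be replaced by
its remainder, of degree less than `p`. -/
theorem mem_frobEval_range_iff {z x : R} : x ∈ (frobEval p z).range ↔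
    ∃ a : ℕ → R, x = ∑ i ∈ Finset.range p, a i ^ p * z ^ i := by
  constructor
  · rintro ⟨f, rfl⟩
    nontriviality R
    have hmon : (X ^ p - C z).Monic := monic_X_pow_sub_C z hp.out.ne_zero
    have hdeg : (f %ₘ (X ^ p - C z)).natDegree < p := by
      have := natDegree_modByMonic_lt f hmon (by
        intro h1
        have := congrArg natDegree h1
        rw [natDegree_X_pow_sub_C, natDegree_one] at this
        exact hp.out.ne_zero this)
      rwa [natDegree_X_pow_sub_C] at this
    refine ⟨(f %ₘ (X ^ p - C z)).coeff, ?_⟩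
    rw [← frobEval_of_natDegree_lt p z hdeg]
    conv_lhs => rw [← modByMonic_add_div f (X ^ p - C z)]
    simp [frobEval_C, frobEval_X]
  · rintro ⟨a, rfl⟩
    exact ⟨∑ i ∈ Finset.range p, C (a i) * X ^ i, by simp [frobEval_C, frobEval_X]⟩

/-- Substituting `X + C c` for `X` passes from one ring to the other; the reverse inclusion uses
`-c`. -/
theorem frobEval_range_sub_pow (z c : R) :
    (frobEval p (z - c ^ p)).range = (frobEval p z).range := by
  have key (z c : R) : (frobEval p z).range ≤ (frobEval p (z - c ^ p)).range := by
    rintro _ ⟨f, rfl⟩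
    refine ⟨f.comp (X + C c), ?_⟩
    have : (frobEval p (z - c ^ p)).comp (compRingHom (X + C c)) = frobEval p z := by
      ext <;> simp [frobEval_C, frobEval_X]
    exact congrArg (fun g : R[X] →+* R => g f) this
  refine le_antisymm ?_ (key z c)
  have := key (z - c ^ p) (-c)
  rwa [← frobenius_def p (-c), map_neg, frobenius_def, sub_neg_eq_add, sub_add_cancel] at this

/-- Every element of `R` is an `R ^ p`-linear combination of `1, t, …, t ^ (p - 1)`. -/
def HasFrobeniusExpansion (t : R) : Prop :=
  ∀ x : R, ∃ a : ℕ → R, x = ∑ i ∈ Finset.range p, a i ^ p * t ^ i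

variable {p} in
theorem HasFrobeniusExpansion.frobEval_surjective {t : R} (h : HasFrobeniusExpansion p t) :
    Function.Surjective (frobEval p t) := by
  intro x
  obtain ⟨a, rfl⟩ := h x
  exact ⟨∑ i ∈ Finset.range p, C (a i) * X ^ i, by simp [frobEval_C, frobEval_X]⟩

end FrobEval

/-! ### Expansions in a uniformizer over the `p`-th powers, and differentials -/

section FrobeniusExpansion

open IsDiscreteValuationRing Polynomial

variable {R : Type*} [CommRing R] [IsDomain R] [IsDiscreteValuationRing R]
variable (p : ℕ) [hp : Fact p.Prime]

/-- The `i`-th term has value congruent to `i m` modulo `p`, if finite. As `m` is prime to `p` these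
classes are distinct for `i < p`, so no cancellation occurs. -/
theorem addVal_sum_pow_mul_pow {z : R} {m : ℕ} (hz : addVal R z = m) (hm : ¬ p ∣ m)
    (a : ℕ → R) {s : Finset ℕ} (hs : s ⊆ Finset.range p) :
    addVal R (∑ i ∈ s, a i ^ p * z ^ i) =
      s.inf fun i => p * addVal R (a i) + (i * m : ℕ) := by
  have hval (i : ℕ) : addVal R (a i ^ p * z ^ i) = p * addVal R (a i) + (i * m : ℕ) := by
    rw [addVal_mul, addVal_pow, addVal_pow, hz, nsmul_eq_mul, nsmul_eq_mul, Nat.cast_mul]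
  simp only [← hval]
  refine addVal_sum_eq_inf s _ fun i hi j hj hij he => ?_
  by_contra htop
  have hai : a i ≠ 0 := by
    intro h0; apply htop; simp [h0, hp.out.ne_zero]
  have haj : a j ≠ 0 := by
    intro h0; apply htop; rw [he]; simp [h0, hp.out.ne_zero]
  obtain ⟨k, hk⟩ := ENat.ne_top_iff_exists.1 (addVal_eq_top_iff.not.2 hai)
  obtain ⟨l, hl⟩ := ENat.ne_top_iff_exists.1 (addVal_eq_top_iff.not.2 haj)
  rw [hval, hval, ← hk, ← hl] at he
  have he' : p * k + i * m = p * l + j * m := by exact_mod_cast he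
  have hmod : i * m ≡ j * m [MOD p] := by
    have h1 : p * k + i * m ≡ i * m [MOD p] := by simp [Nat.ModEq]
    have h2 : p * l + j * m ≡ j * m [MOD p] := by simp [Nat.ModEq]
    exact h1.symm.trans ((congrArg (· % p) he').trans h2)
  have hcop : Nat.gcd p m = 1 := (Nat.Prime.coprime_iff_not_dvd hp.out).2 hm
  have hij' : i ≡ j [MOD p] := Nat.ModEq.cancel_right_of_coprime hcop hmod
  exact hij (Nat.ModEq.eq_of_lt_of_lt hij' (Finset.mem_range.1 (hs hi))
    (Finset.mem_range.1 (hs hj)))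

theorem eq_zero_of_sum_pow_mul_pow_eq_zero {z : R} {m : ℕ} (hz : addVal R z = m) (hm : ¬ p ∣ m)
    {a : ℕ → R} (h : ∑ i ∈ Finset.range p, a i ^ p * z ^ i = 0) :
    ∀ i < p, a i = 0 := by
  intro i hi
  have h1 := addVal_sum_pow_mul_pow p hz hm a (Finset.Subset.refl (Finset.range p))
  rw [h, addVal_zero] at h1
  have h2 := top_le_iff.1
    (h1.le.trans (Finset.inf_le (f := fun i => p * addVal R (a i) + (i * m : ℕ))
      (Finset.mem_range.2 hi)))
  by_contra hne
  obtain ⟨k, hk⟩ := ENat.ne_top_iff_exists.1 (addVal_eq_top_iff.not.2 hne)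
  rw [← hk] at h2
  exact ENat.natCast_ne_top (p * k + i * m) (by exact_mod_cast h2)

/-- Dropping the term `i = 0` from the expansion in `t` leaves terms of value `p k + i` with `0 < i
< p`; the smallest of these is the value of the difference. -/
theorem exists_addVal_sub_pow_eq {t : R} (ht : Irreducible t) (hexp : HasFrobeniusExpansion p t)
    {z : R} (hz : ¬ ∃ c, z = c ^ p) :
    ∃ (c : R) (m : ℕ), addVal R (z - c ^ p) = m ∧ ¬ p ∣ m := by
  obtain ⟨a, ha⟩ := hexp z
  have hsub : z - a 0 ^ p = ∑ i ∈ (Finset.range p).erase 0, a i ^ p * t ^ i := by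
    rw [ha, ← Finset.add_sum_erase _ _ (Finset.mem_range.2 hp.out.pos)]
    simp
  have hne : z - a 0 ^ p ≠ 0 := fun h => hz ⟨a 0, sub_eq_zero.1 h⟩
  have hval := addVal_sum_pow_mul_pow p (z := t) (m := 1) (by simpa using addVal_uniformizer ht)
    (by simpa using hp.out.ne_one) a (Finset.erase_subset 0 (Finset.range p))
  rw [← hsub] at hval
  obtain ⟨i, hi, hi'⟩ := Finset.exists_mem_eq_inf ((Finset.range p).erase 0)
    ⟨1, by simp [hp.out.one_lt]⟩ (fun i => p * addVal R (a i) + (i * 1 : ℕ))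
  rw [hi'] at hval
  have hai : addVal R (a i) ≠ ⊤ := by
    intro htop
    rw [htop, ENat.mul_top (by exact_mod_cast hp.out.ne_zero), top_add] at hval
    exact hne (addVal_eq_top_iff.1 hval)
  obtain ⟨k, hk⟩ := ENat.ne_top_iff_exists.1 hai
  rw [← hk] at hval
  refine ⟨a 0, p * k + i, by rw [hval]; push_cast; ring, fun hdvd => ?_⟩
  rw [Nat.dvd_add_right (dvd_mul_right p k)] at hdvd
  rw [Finset.mem_erase, Finset.mem_range] at hi
  exact absurd (Nat.le_of_dvd (Nat.pos_of_ne_zero hi.1) hdvd) (not_le.2 hi.2)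

variable [CharP R p]

variable {p}

/-- By uniqueness of expansions the kernel is generated by `X ^ p - C t`, whose derivative is zero.
This makes `d / dt` independent of the polynomial chosen to represent an element. -/
theorem frobEval_derivative_eq_zero {t : R} (ht : Irreducible t) {f : R[X]}
    (hf : frobEval p t f = 0) : frobEval p t (derivative f) = 0 := by
  have hmon : (X ^ p - C t).Monic := monic_X_pow_sub_C t hp.out.ne_zero
  have hg : frobEval p t (X ^ p - C t) = 0 := by simp [frobEval_C, frobEval_X]
  have hdiv := modByMonic_add_div f (X ^ p - C t)
  have hr : f %ₘ (X ^ p - C t) = 0 := by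
    have hdeg : (f %ₘ (X ^ p - C t)).natDegree < p := by
      have := natDegree_modByMonic_lt f hmon (by
        intro h1
        have := congrArg natDegree h1
        rw [natDegree_X_pow_sub_C, natDegree_one] at this
        exact hp.out.ne_zero this)
      rwa [natDegree_X_pow_sub_C] at this
    have h0 : frobEval p t (f %ₘ (X ^ p - C t)) = 0 := by
      rw [← hdiv, map_add, map_mul, hg, zero_mul, add_zero] at hf
      exact hf
    rw [frobEval_of_natDegree_lt p t hdeg] at h0
    have hc := eq_zero_of_sum_pow_mul_pow_eq_zero p (m := 1)
      (by simpa using addVal_uniformizer ht) (by simpa using hp.out.ne_one) h0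
    ext i
    by_cases hi : i < p
    · exact hc i hi
    · exact coeff_eq_zero_of_natDegree_lt (by omega)
  rw [← hdiv, hr, zero_add, derivative_mul]
  have : derivative (X ^ p - C t) = 0 := by
    rw [derivative_sub, derivative_C, derivative_X_pow, CharP.cast_eq_zero]; simp
  rw [this, zero_mul, zero_add, map_mul, hg, zero_mul]

variable (L : Type*) [Field L] [CharP L p] [PerfectRing L p] [Algebra L R]

/-- The derivation `d / dt` on a discrete valuation ring with uniformizer `t` whose elements
are `R ^ p`-linear combinations of powers of `t`. -/
noncomputable def uniformizerDerivation {t : R} (ht : Irreducible t)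
    (h : HasFrobeniusExpansion p t) : Derivation L R R :=
  let s := Function.surjInv h.frobEval_surjective
  have hs (x : R) : frobEval p t (s x) = x := Function.surjInv_eq h.frobEval_surjective x
  have key (f : R[X]) {x : R} (hx : frobEval p t f = x) :
      frobEval p t (derivative (s x)) = frobEval p t (derivative f) := by
    rw [← sub_eq_zero, ← map_sub, ← derivative_sub]
    exact frobEval_derivative_eq_zero ht (by rw [map_sub, hs, hx, sub_self])
  Derivation.mk'
    { toFun := fun x => frobEval p t (derivative (s x))
      map_add' := fun x y => by
        rw [key (s x + s y) (by simp [hs]), derivative_add, map_add]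
      map_smul' := fun c x => by
        -- A scalar is a `p`-th power because `L` is perfect, so it is represented by a constant
        -- polynomial; this gives `L`-linearity.
        obtain ⟨c', rfl⟩ : ∃ c', c' ^ p = c := (bijective_frobenius L p).2 c
        rw [key (C (algebraMap L R c') * s x) (by
          simp [hs, frobEval_C, Algebra.smul_def])]
        simp [frobEval_C, Algebra.smul_def] }
    fun x y => by
      change frobEval p t (derivative (s (x * y))) = x • frobEval p t (derivative (s y)) +
        y • frobEval p t (derivative (s x))
      rw [key (s x * s y) (by simp [hs]), derivative_mul, map_add, map_mul, map_mul, hs, hs]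
      simp only [smul_eq_mul]
      ring

theorem uniformizerDerivation_self {t : R} (ht : Irreducible t)
    (h : HasFrobeniusExpansion p t) : uniformizerDerivation L ht h t = 1 := by
  change frobEval p t (derivative (Function.surjInv h.frobEval_surjective t)) = 1
  have := frobEval_derivative_eq_zero (p := p) ht
    (f := Function.surjInv h.frobEval_surjective t - X)
    (by rw [map_sub, Function.surjInv_eq h.frobEval_surjective, frobEval_X, sub_self])
  rw [derivative_sub, map_sub, sub_eq_zero] at this
  simpa using this

/-- The chain rule makes `dx` a multiple of `dt`; applying `d / dt` to that relation identifies the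
coefficient. -/
theorem kaehlerD_eq_uniformizerDerivation_smul {t : R} (ht : Irreducible t)
    (h : HasFrobeniusExpansion p t) (x : R) :
    KaehlerDifferential.D L R x =
      uniformizerDerivation L ht h x • KaehlerDifferential.D L R t := by
  obtain ⟨f, rfl⟩ := h.frobEval_surjective x
  rw [kaehlerD_frobEval]
  have := congrArg (uniformizerDerivation L ht h).liftKaehlerDifferential
    (kaehlerD_frobEval p L t f)
  rw [map_smul, Derivation.liftKaehlerDifferential_comp_D,
    Derivation.liftKaehlerDifferential_comp_D, uniformizerDerivation_self, smul_eq_mul,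
    mul_one] at this
  rw [this]

/-- The module of differentials is free with basis `dt`. -/
noncomputable def kaehlerEquiv {t : R} (ht : Irreducible t) (h : HasFrobeniusExpansion p t) :
    Ω[R⁄L] ≃ₗ[R] R :=
  LinearEquiv.ofLinearMap (uniformizerDerivation L ht h).liftKaehlerDifferential
    (LinearMap.toSpanSingleton R _ (KaehlerDifferential.D L R t))
    (by ext; simp [uniformizerDerivation_self])
    (by
      ext x
      simp [← kaehlerD_eq_uniformizerDerivation_smul])

theorem kaehlerEquiv_D {t : R} (ht : Irreducible t) (h : HasFrobeniusExpansion p t) (x : R) :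
    kaehlerEquiv L ht h (KaehlerDifferential.D L R x) = uniformizerDerivation L ht h x :=
  Derivation.liftKaehlerDifferential_comp_D _ _

end FrobeniusExpansion

/-! ### The gaps of a numerical semigroup with two generators -/

section Gaps

/-- Every integer is `m a + p b` with `0 ≤ a < p`, and it lies in the semigroup exactly when `b ≥
0`. With `N = (m - 1)(p - 1)`, the reflection `n ↦ N - 1 - n` sends `(a, b)` to `(p - 1 - a, -1 -
b)` and so exchanges gaps and elements below `N`; everything from `N` on is in the semigroup. -/
theorem exists_gaps_of_coprime {m p : ℕ} (hm : 0 < m) (hp : 0 < p) (h : m.Coprime p) :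
    ∃ G : Finset ℕ, (∀ n, n ∈ G ↔ ¬ ∃ a b : ℕ, n = m * a + p * b) ∧
      2 * G.card = (m - 1) * (p - 1) := by
  classical
  have hrep (n : ℤ) : ∃ a b : ℤ, 0 ≤ a ∧ a < p ∧ n = m * a + p * b := by
    obtain ⟨u, w, huw⟩ : IsCoprime (m : ℤ) (p : ℤ) := Nat.isCoprime_iff_coprime.2 h
    refine ⟨(n * u) % p, n * w + m * ((n * u) / p), Int.emod_nonneg _ (by omega),
      Int.emod_lt_of_pos _ (by omega), ?_⟩
    have := Int.emod_add_mul_ediv (n * u) p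
    linear_combination (-n) * huw - m * this
  have hiff (a b : ℤ) (ha : 0 ≤ a) (hap : a < p) (n : ℕ) (hn : (n : ℤ) = m * a + p * b) :
      (∃ c d : ℕ, n = m * c + p * d) ↔ 0 ≤ b := by
    constructor
    · rintro ⟨c, d, rfl⟩
      push_cast at hn
      by_contra! hb
      have hdvd : (p : ℤ) ∣ a - c := by
        refine (Nat.isCoprime_iff_coprime.2 h.symm).dvd_of_dvd_mul_left (y := (m : ℤ)) ?_
        exact ⟨d - b, by linear_combination (-1 : ℤ) * hn⟩
      have hlt : (c : ℤ) < a := by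
        have : (0 : ℤ) < m * (a - c) := by
          have h1 : (m : ℤ) * (a - c) = p * (d - b) := by linear_combination (-1 : ℤ) * hn
          rw [h1]
          exact mul_pos (by omega) (by omega)
        have := pos_of_mul_pos_right this (by omega)
        omega
      have := Int.le_of_dvd (by omega) hdvd
      omega
    · intro hb
      lift a to ℕ using ha
      lift b to ℕ using hb
      exact ⟨a, b, by exact_mod_cast hn⟩
  obtain ⟨N, hN⟩ : ∃ N : ℕ, N = (m - 1) * (p - 1) := ⟨_, rfl⟩
  have hNZ : (N : ℤ) = (m - 1) * (p - 1) := by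
    rw [hN]; push_cast [Nat.cast_sub (show 1 ≤ m from hm), Nat.cast_sub (show 1 ≤ p from hp)]; ring
  have hsymm (n k : ℕ) (hnk : n + k + 1 = N) :
      (∃ c d : ℕ, n = m * c + p * d) ↔ ¬ ∃ c d : ℕ, k = m * c + p * d := by
    obtain ⟨a, b, ha, hap, hab⟩ := hrep n
    rw [hiff a b ha hap n hab, hiff (p - 1 - a) (-1 - b) (by omega) (by omega) k]
    · omega
    · have : (k : ℤ) = N - 1 - n := by omega
      rw [this, hNZ, hab]; ring
  have hlarge (n : ℕ) (hn : N ≤ n) : ∃ c d : ℕ, n = m * c + p * d := by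
    obtain ⟨a, b, ha, hap, hab⟩ := hrep n
    rw [hiff a b ha hap n hab]
    by_contra! hb
    have h1 : (m : ℤ) * a ≤ m * (p - 1) := by gcongr; omega
    have h2 : (p : ℤ) * b ≤ p * (-1) := by gcongr; omega
    have h3 : ((m : ℤ) - 1) * (p - 1) ≤ n := by rw [← hNZ]; exact_mod_cast hn
    nlinarith
  refine ⟨(Finset.range N).filter fun n => ¬ ∃ a b : ℕ, n = m * a + p * b, fun n => ?_, ?_⟩
  · rw [Finset.mem_filter, Finset.mem_range, and_iff_right_iff_imp]
    intro hn
    by_contra! hle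
    exact hn (hlarge n hle)
  · rw [← hN]
    have h1 := Finset.card_filter_add_card_filter_not (s := Finset.range N)
      (fun n => ∃ a b : ℕ, n = m * a + p * b)
    rw [Finset.card_range] at h1
    have h2 : ((Finset.range N).filter fun n => ∃ a b : ℕ, n = m * a + p * b).card =
        ((Finset.range N).filter fun n => ¬ ∃ a b : ℕ, n = m * a + p * b).card := by
      refine Finset.card_nbij' (fun n => N - 1 - n) (fun n => N - 1 - n) ?_ ?_ ?_ ?_
      · intro n hn
        simp only [Finset.coe_filter, Finset.mem_range, Set.mem_ofPred_eq] at hn ⊢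
        exact ⟨by omega, (hsymm n (N - 1 - n) (by omega)).1 hn.2⟩
      · intro n hn
        simp only [Finset.coe_filter, Finset.mem_range, Set.mem_ofPred_eq] at hn ⊢
        exact ⟨by omega, (hsymm (N - 1 - n) n (by omega)).2 hn.2⟩
      · intro n hn
        simp only [Finset.coe_filter, Finset.mem_range, Set.mem_ofPred_eq] at hn ⊢
        omega
      · intro n hn
        simp only [Finset.coe_filter, Finset.mem_range, Set.mem_ofPred_eq] at hn ⊢
        omega
    omega

end Gaps

/-! ### The cokernel on differentials and the invariants of `Rᵖ[z]` -/

section Cokernel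

open IsDiscreteValuationRing

theorem range_mapBaseChange_eq_span (L B R : Type*) [CommRing L] [CommRing B] [CommRing R]
    [Algebra L B] [Algebra L R] [Algebra B R] [IsScalarTower L B R] :
    LinearMap.range (KaehlerDifferential.mapBaseChange L B R) =
      Submodule.span R (Set.range fun b : B => KaehlerDifferential.D L R (algebraMap B R b)) := by
  apply le_antisymm
  · rintro _ ⟨x, rfl⟩
    induction x with
    | zero => simp
    | add x y hx hy => rw [map_add]; exact add_mem hx hy
    | tmul r ω =>
      rw [KaehlerDifferential.mapBaseChange_tmul]
      refine Submodule.smul_mem _ _ ?_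
      have hω : ω ∈ Submodule.span B (Set.range (KaehlerDifferential.D L B)) := by
        rw [KaehlerDifferential.span_range_derivation]; trivial
      induction hω using Submodule.span_induction with
      | mem _ h =>
        obtain ⟨b, rfl⟩ := h
        rw [KaehlerDifferential.map_D]
        exact Submodule.subset_span ⟨b, rfl⟩
      | zero => simp
      | add _ _ _ _ h1 h2 => rw [map_add]; exact add_mem h1 h2
      | smul b _ _ h =>
        rw [map_smul, ← algebraMap_smul R b]
        exact Submodule.smul_mem _ _ h
  · rw [Submodule.span_le]
    rintro _ ⟨b, rfl⟩
    exact ⟨1 ⊗ₜ KaehlerDifferential.D L B b, by simp⟩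

variable {R : Type*} [CommRing R] [IsDomain R] [IsDiscreteValuationRing R]
variable {p : ℕ} [hp : Fact p.Prime] [CharP R p]
variable {L : Type*} [Field L] [CharP L p] [PerfectRing L p] [Algebra L R]
variable {B : Type*} [CommRing B] [Algebra L B] [Algebra B R] [IsScalarTower L B R]

/-- The values missing from the ideal are `0, …, n - 1`. -/
theorem finite_quotient_ideal_and_finrank_eq
    (hres : ∀ x : R, ∃ c : L, x - algebraMap L R c ∈ IsLocalRing.maximalIdeal R)
    {x : R} {n : ℕ} (hx : addVal R x = n) :
    Module.Finite L (R ⧸ Ideal.span {x}) ∧ Module.finrank L (R ⧸ Ideal.span {x}) = n := by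
  have hmem (y : R) : y ∈ Ideal.span {x} ↔ (n : ℕ∞) ≤ addVal R y := by
    rw [Ideal.mem_span_singleton, ← addVal_le_iff_dvd, hx]
  obtain ⟨t, ht⟩ := exists_irreducible R
  have := finite_quotient_and_finrank_eq_card hres ((Ideal.span {x}).restrictScalars L) n
    (fun y hy => (hmem y).2 hy) (Finset.range n) (fun k => by
      rw [Finset.mem_range]
      constructor
      · intro hk w hw hwk
        have := (hmem w).1 hw
        rw [hwk] at this
        exact absurd (by exact_mod_cast this) (not_le.2 hk)
      · intro h
        by_contra! hle
        refine h (t ^ k) ((hmem _).2 ?_) (ht.addVal_pow k)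
        rw [ht.addVal_pow]
        exact_mod_cast hle)
  rw [Finset.card_range] at this
  exact this

/-- In the basis `dt` the cokernel becomes the quotient of `R` by the ideal generated by the
derivatives of elements of `B`. -/
theorem finite_kaehlerCoker_and_finrank_eq
    (hres : ∀ x : R, ∃ c : L, x - algebraMap L R c ∈ IsLocalRing.maximalIdeal R)
    {t : R} (ht : Irreducible t) (hexp : HasFrobeniusExpansion p t) {x : R} {n : ℕ}
    (hx : addVal R x = n)
    (hspan : Ideal.span (Set.range fun b : B =>
      uniformizerDerivation L ht hexp (algebraMap B R b)) = Ideal.span {x}) :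
    Module.Finite L (Ω[R⁄L] ⧸ LinearMap.range (KaehlerDifferential.mapBaseChange L B R)) ∧
      Module.finrank L
        (Ω[R⁄L] ⧸ LinearMap.range (KaehlerDifferential.mapBaseChange L B R)) = n := by
  have hmap : (LinearMap.range (KaehlerDifferential.mapBaseChange L B R)).map
      (kaehlerEquiv L ht hexp : Ω[R⁄L] →ₗ[R] R) = Ideal.span {x} := by
    rw [range_mapBaseChange_eq_span, Submodule.map_span, ← Set.range_comp, ← hspan, Ideal.span]
    congr 2
    ext b
    exact kaehlerEquiv_D L ht hexp _
  let e := (Submodule.Quotient.equiv _ _ (kaehlerEquiv L ht hexp) hmap).restrictScalars L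
  obtain ⟨h1, h2⟩ := finite_quotient_ideal_and_finrank_eq hres hx
  exact ⟨Module.Finite.equiv e.symm, by rw [e.finrank_eq, h2]⟩

theorem addVal_le_of_conductor {s : R} {W : Submodule L R} (hs : ∀ x : R, s * x ∈ W) {N : ℕ}
    (hN : addVal R s = N) (x : R) (hx : (N : ℕ∞) ≤ addVal R x) : x ∈ W := by
  obtain ⟨y, rfl⟩ := addVal_le_iff_dvd.1 (hN.trans_le hx)
  exact hs y

/-- If the cokernel of the map on differentials vanishes, then there is no singularity. -/
theorem algebraMap_surjective_of_finrank_kaehlerCoker_eq_zero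
    (hres : ∀ x : R, ∃ c : L, x - algebraMap L R c ∈ IsLocalRing.maximalIdeal R)
    {t : R} (ht : Irreducible t) (hexp : HasFrobeniusExpansion p t)
    {s : R} (hs0 : s ≠ 0) (hs : ∀ x : R, s * x ∈ (algebraMap B R).range)
    (hd : Module.finrank L
      (Ω[R⁄L] ⧸ LinearMap.range (KaehlerDifferential.mapBaseChange L B R)) = 0) :
    Function.Surjective (algebraMap B R) := by
  set δ := uniformizerDerivation L ht hexp
  set I := Ideal.span (Set.range fun b : B => δ (algebraMap B R b)) with hI
  obtain ⟨x, hx⟩ : ∃ x, I = Ideal.span {x} := (IsPrincipalIdealRing.principal I).principal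
  -- If the derivation vanished on `B`, it would kill `s` and `s t`; but then its value at `s t` is
  -- `s`, which is nonzero.
  have hx0 : x ≠ 0 := by
    rintro rfl
    have hzero (b : B) : δ (algebraMap B R b) = 0 := by
      have : δ (algebraMap B R b) ∈ I := Ideal.subset_span ⟨b, rfl⟩
      simpa [hx] using this
    obtain ⟨b₁, hb₁⟩ := hs 1
    obtain ⟨b₂, hb₂⟩ := hs t
    have h1 := hzero b₁
    have h2 := hzero b₂
    rw [hb₁, mul_one] at h1
    rw [hb₂, Derivation.leibniz, h1, uniformizerDerivation_self] at h2
    simp [hs0] at h2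
  obtain ⟨n, hn⟩ := ENat.ne_top_iff_exists.1 (addVal_eq_top_iff.not.2 hx0)
  -- The cokernel is finite-dimensional here, so the vanishing of `finrank` is genuine and forces
  -- `x` to have value `0`.
  have hcok := (finite_kaehlerCoker_and_finrank_eq hres ht hexp hn.symm (hI.symm.trans hx)).2
  rw [hd] at hcok
  have hxu : IsUnit x := addVal_eq_zero_iff.1 (by rw [← hn, ← hcok]; rfl)
  obtain ⟨b, hb⟩ : ∃ b : B, IsUnit (δ (algebraMap B R b)) := by
    by_contra! hno
    have hle : I ≤ IsLocalRing.maximalIdeal R := by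
      rw [hI, Ideal.span_le]
      rintro _ ⟨b, rfl⟩
      exact hno b
    rw [hx, Ideal.span_singleton_eq_top.2 hxu, top_le_iff] at hle
    exact (IsLocalRing.maximalIdeal.isMaximal R).ne_top hle
  obtain ⟨c, hc⟩ := hres (algebraMap B R b)
  -- Writing `b - c = t u`, the derivative `t u' + u` is a unit, hence so is `u`.
  have hval : addVal R (algebraMap B R b - algebraMap L R c) = 1 := by
    obtain ⟨u, hu⟩ : t ∣ algebraMap B R b - algebraMap L R c := by
      rw [← addVal_le_iff_dvd, addVal_uniformizer ht]
      exact one_le_addVal_iff.2 hc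
    have hδ : δ (algebraMap B R b) = t * δ u + u := by
      have := congrArg δ hu
      rw [map_sub, Derivation.map_algebraMap, sub_zero, Derivation.leibniz,
        uniformizerDerivation_self] at this
      simpa using this
    have huu : IsUnit u := by
      by_contra hnu
      have : t * δ u + u ∈ IsLocalRing.maximalIdeal R :=
        add_mem (Ideal.mul_mem_right _ _ ht.not_isUnit) hnu
      rw [← hδ] at this
      exact this hb
    rw [hu, addVal_mul, addVal_uniformizer ht, addVal_eq_zero_iff.2 huu, add_zero]
  obtain ⟨N, hN⟩ := ENat.ne_top_iff_exists.1 (addVal_eq_top_iff.not.2 hs0)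
  let W := LinearMap.range (IsScalarTower.toAlgHom L B R).toLinearMap
  -- The powers of `b - c` take every value, so the set of missing values is empty.
  obtain ⟨hf, hrk⟩ := finite_quotient_and_finrank_eq_card hres W N
    (addVal_le_of_conductor (fun x => hs x) hN.symm) ∅ (fun k => by
      simp only [Finset.notMem_empty, false_iff, not_forall, not_not]
      refine ⟨(algebraMap B R b - algebraMap L R c) ^ k,
        ⟨(b - algebraMap L B c) ^ k, ?_⟩, ?_⟩
      · simp [← IsScalarTower.algebraMap_apply]
      · rw [addVal_pow, hval]; simp)
  rw [Finset.card_empty, Module.finrank_zero_iff, Submodule.Quotient.subsingleton_iff] at hrk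
  intro r
  have : r ∈ W := hrk ▸ Submodule.mem_top
  exact this

/-- The semigroup, the cokernel on differentials and the singularity degree of a subring of the
form `∑ Rᵖ zⁱ`. -/
theorem invariants_of_range_eq_sum_pow_mul_pow
    (hres : ∀ x : R, ∃ c : L, x - algebraMap L R c ∈ IsLocalRing.maximalIdeal R)
    {t : R} (ht : Irreducible t) (hexp : HasFrobeniusExpansion p t)
    {s : R} (hs0 : s ≠ 0) (hs : ∀ x : R, s * x ∈ (algebraMap B R).range)
    {z : R} {m : ℕ} (hz : addVal R z = m) (hm : ¬ p ∣ m)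
    (hB : ∀ x : R, x ∈ (algebraMap B R).range ↔
      ∃ a : ℕ → R, x = ∑ i ∈ Finset.range p, a i ^ p * z ^ i) :
    (Module.Finite L (Ω[R⁄L] ⧸ LinearMap.range (KaehlerDifferential.mapBaseChange L B R)) ∧
      1 + Module.finrank L
        (Ω[R⁄L] ⧸ LinearMap.range (KaehlerDifferential.mapBaseChange L B R)) = m) ∧
    (∀ n : ℕ, (∃ b : B, addVal R (algebraMap B R b) = n) ↔ ∃ a b : ℕ, n = m * a + p * b) ∧
    (Module.Finite L (R ⧸ LinearMap.range (IsScalarTower.toAlgHom L B R).toLinearMap) ∧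
      2 * Module.finrank L (R ⧸ LinearMap.range (IsScalarTower.toAlgHom L B R).toLinearMap) =
        (m - 1) * (p - 1)) := by
  have hm0 : 0 < m := Nat.pos_of_ne_zero (by rintro rfl; simp at hm)
  have hcop : m.Coprime p := ((Nat.Prime.coprime_iff_not_dvd hp.out).2 hm).symm
  have hzB : z ∈ (algebraMap B R).range := by
    refine (hB z).2 ⟨fun i => if i = 1 then 1 else 0, ?_⟩
    rw [Finset.sum_eq_single 1]
    · simp
    · intro i _ hi; simp [hi, hp.out.ne_zero]
    · intro h; exact absurd (Finset.mem_range.2 hp.out.one_lt) h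
  have hpowB (a : R) : a ^ p ∈ (algebraMap B R).range := by
    refine (hB _).2 ⟨fun i => if i = 0 then a else 0, ?_⟩
    rw [Finset.sum_eq_single 0]
    · simp
    · intro i _ hi; simp [hi, hp.out.ne_zero]
    · intro h; exact absurd (Finset.mem_range.2 hp.out.pos) h
  have hsemi (n : ℕ) : (∃ b : B, addVal R (algebraMap B R b) = n) ↔
      ∃ a b : ℕ, n = m * a + p * b := by
    constructor
    · rintro ⟨b, hb⟩
      obtain ⟨a, ha⟩ := (hB _).1 ⟨b, rfl⟩
      rw [ha, addVal_sum_pow_mul_pow p hz hm a (Finset.Subset.refl _)] at hb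
      obtain ⟨i, -, hi⟩ := Finset.exists_mem_eq_inf (Finset.range p)
        ⟨0, Finset.mem_range.2 hp.out.pos⟩ (fun i => p * addVal R (a i) + (i * m : ℕ))
      rw [hi] at hb
      have hai : addVal R (a i) ≠ ⊤ := by
        intro htop
        rw [htop, ENat.mul_top (by exact_mod_cast hp.out.ne_zero), top_add] at hb
        exact ENat.natCast_ne_top n hb.symm
      obtain ⟨k, hk⟩ := ENat.ne_top_iff_exists.1 hai
      rw [← hk] at hb
      have hb' : p * k + i * m = n := by exact_mod_cast hb
      exact ⟨i, k, by rw [← hb']; ring⟩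
    · rintro ⟨a, b, rfl⟩
      obtain ⟨c, hc⟩ := mul_mem (pow_mem hzB a) (hpowB (t ^ b))
      refine ⟨c, ?_⟩
      rw [hc, addVal_mul, addVal_pow, addVal_pow, ht.addVal_pow, hz]
      simp only [nsmul_eq_mul]
      push_cast
      ring
  set δ := uniformizerDerivation L ht hexp
  have hδpow (a : R) : δ (a ^ p) = 0 := by
    rw [Derivation.leibniz_pow, ← Nat.cast_smul_eq_nsmul R, CharP.cast_eq_zero, zero_smul]
  -- With `z = t ^ m u`, the derivative is `t ^ (m - 1) (m u + t u')`, and `m` is invertible because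
  -- `p` does not divide it.
  have hδz : addVal R (δ z) = (m - 1 : ℕ) := by
    obtain ⟨u, hu⟩ : ∃ u, z = t ^ m * u := addVal_le_iff_dvd.1 (by rw [ht.addVal_pow, hz])
    have huu : IsUnit u := by
      rw [hu, addVal_mul, ht.addVal_pow] at hz
      refine addVal_eq_zero_iff.1 ?_
      have : (m : ℕ∞) + addVal R u = m + 0 := by rw [hz, add_zero]
      exact ENat.add_right_injective_of_ne_top (ENat.natCast_ne_top m) this
    obtain ⟨k, rfl⟩ : ∃ k, m = k + 1 := ⟨m - 1, by omega⟩
    have hδ : δ z = t ^ k * (((k + 1 : ℕ) : R) * u + t * δ u) := by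
      rw [hu, Derivation.leibniz, Derivation.leibniz_pow, uniformizerDerivation_self]
      simp only [smul_eq_mul, nsmul_eq_mul, add_tsub_cancel_right]
      ring
    have hun : IsUnit (((k + 1 : ℕ) : R) * u + t * δ u) := by
      have hcast : IsUnit ((k + 1 : ℕ) : R) := by
        have : ((k + 1 : ℕ) : L) ≠ 0 := by rwa [Ne, CharP.cast_eq_zero_iff L p]
        have := (IsUnit.mk0 _ this).map (algebraMap L R)
        rwa [map_natCast] at this
      by_contra hnu
      have := sub_mem (show _ ∈ IsLocalRing.maximalIdeal R from hnu)
        (Ideal.mul_mem_right (δ u) _ (show t ∈ IsLocalRing.maximalIdeal R from ht.not_isUnit))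
      rw [add_sub_cancel_right] at this
      exact this (hcast.mul huu)
    rw [hδ, addVal_mul, ht.addVal_pow, addVal_eq_zero_iff.2 hun, add_zero, Nat.add_sub_cancel]
  -- The derivation kills the coefficients `aᵢ ^ p`, so every derivative of an element of `B` is a
  -- multiple of that of `z`.
  have hspan : Ideal.span (Set.range fun b : B => δ (algebraMap B R b)) = Ideal.span {δ z} := by
    apply le_antisymm
    · rw [Ideal.span_le]
      rintro _ ⟨b, rfl⟩
      obtain ⟨a, ha⟩ := (hB _).1 ⟨b, rfl⟩
      simp only [ha, map_sum]
      refine sum_mem fun i _ => ?_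
      rw [Derivation.leibniz, hδpow, smul_zero, add_zero, Derivation.leibniz_pow]
      exact Submodule.smul_mem _ _
        (nsmul_mem (Submodule.smul_mem _ _ (Ideal.mem_span_singleton_self _)) i)
    · rw [Ideal.span_singleton_le_iff_mem]
      obtain ⟨b, hb⟩ := hzB
      exact Ideal.subset_span ⟨b, congrArg δ hb⟩
  obtain ⟨hf, hrk⟩ := finite_kaehlerCoker_and_finrank_eq hres ht hexp hδz hspan
  obtain ⟨N, hN⟩ := ENat.ne_top_iff_exists.1 (addVal_eq_top_iff.not.2 hs0)
  obtain ⟨G, hG, hcard⟩ := exists_gaps_of_coprime hm0 hp.out.pos hcop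
  obtain ⟨hf', hrk'⟩ := finite_quotient_and_finrank_eq_card hres
    (LinearMap.range (IsScalarTower.toAlgHom L B R).toLinearMap) N
    (addVal_le_of_conductor (fun x => hs x) hN.symm) G (fun n => by
      rw [hG, ← hsemi]
      constructor
      · rintro h _ ⟨b, rfl⟩ hb
        exact h ⟨b, hb⟩
      · rintro h ⟨b, hb⟩
        exact h _ ⟨b, rfl⟩ hb)
  exact ⟨⟨hf, by rw [hrk]; omega⟩, hsemi, hf', by rw [hrk', hcard]⟩

/-- The semigroup, the cokernel on differentials and the singularity degree of a subring of
finite colength of the form `Rᵖ[z]`. -/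
theorem exists_invariants_of_range_eq_frobEval_range
    (hres : ∀ x : R, ∃ c : L, x - algebraMap L R c ∈ IsLocalRing.maximalIdeal R)
    {t : R} (ht : Irreducible t) (hexp : HasFrobeniusExpansion p t)
    {s : R} (hs0 : s ≠ 0) (hs : ∀ x : R, s * x ∈ (algebraMap B R).range)
    {z : R} (hB : (algebraMap B R).range = (frobEval p z).range) :
    ∃ m : ℕ, 0 < m ∧
    (Module.Finite L (Ω[R⁄L] ⧸ LinearMap.range (KaehlerDifferential.mapBaseChange L B R)) ∧
      1 + Module.finrank L
        (Ω[R⁄L] ⧸ LinearMap.range (KaehlerDifferential.mapBaseChange L B R)) = m) ∧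
    (∀ n : ℕ, (∃ b : B, addVal R (algebraMap B R b) = n) ↔ ∃ a b : ℕ, n = m * a + p * b) ∧
    (Module.Finite L (R ⧸ LinearMap.range (IsScalarTower.toAlgHom L B R).toLinearMap) ∧
      2 * Module.finrank L (R ⧸ LinearMap.range (IsScalarTower.toAlgHom L B R).toLinearMap) =
        (m - 1) * (p - 1)) := by
  -- Otherwise `B` would consist of `p`-th powers, with values divisible by `p`, although it
  -- contains `s` and `s t`, whose values are consecutive.
  have hz : ¬ ∃ c, z = c ^ p := by
    rintro ⟨c, rfl⟩
    have hpow (x : R) (hx : x ∈ (algebraMap B R).range) : ∃ y, x = y ^ p := by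
      rw [hB] at hx
      obtain ⟨f, rfl⟩ := hx
      exact ⟨f.eval c, by
        rw [frobEval, Polynomial.coe_eval₂RingHom, ← frobenius_def, ← frobenius_def,
          Polynomial.eval₂_at_apply]⟩
    obtain ⟨x, hx⟩ := hpow _ (hs 1)
    obtain ⟨y, hy⟩ := hpow _ (hs t)
    rw [mul_one] at hx
    have h1 := congrArg (addVal R) hy
    rw [hx, addVal_mul, addVal_pow, addVal_pow, addVal_uniformizer ht] at h1
    have hx0 : x ≠ 0 := by rintro rfl; simp [hp.out.ne_zero] at hx; exact hs0 hx
    have hy0 : y ≠ 0 := by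
      rintro rfl
      rw [zero_pow hp.out.ne_zero] at hy
      exact mul_ne_zero hs0 ht.ne_zero hy
    obtain ⟨k, hk⟩ := ENat.ne_top_iff_exists.1 (addVal_eq_top_iff.not.2 hx0)
    obtain ⟨l, hl⟩ := ENat.ne_top_iff_exists.1 (addVal_eq_top_iff.not.2 hy0)
    rw [← hk, ← hl, nsmul_eq_mul, nsmul_eq_mul] at h1
    have h2 : p * k + 1 = p * l := by exact_mod_cast h1
    have h3 : p ∣ 1 := (Nat.dvd_add_right (dvd_mul_right p k)).1 ⟨l, h2⟩
    exact hp.out.one_lt.ne' (Nat.dvd_one.1 h3)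
  obtain ⟨c, m, hm, hpm⟩ := exists_addVal_sub_pow_eq p ht hexp hz
  refine ⟨m, Nat.pos_of_ne_zero (by rintro rfl; simp at hpm),
    invariants_of_range_eq_sum_pow_mul_pow hres ht hexp hs0 hs hm hpm fun x => ?_⟩
  rw [hB, ← frobEval_range_sub_pow p z c, mem_frobEval_range_iff]

end Cokernel

/-! ### Function fields in one variable over a perfect field -/

section FunctionField

open Polynomial

/-- `φ` realizes `U` as a `P`-submodule of the Noetherian module `T`. -/
theorem finite_of_comp_finite {P U T : Type*} [CommRing P] [CommRing U] [CommRing T]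
    [IsNoetherianRing P] (g : P →+* U) (φ : U →+* T) (hφ : Function.Injective φ)
    (h : (φ.comp g).Finite) : g.Finite := by
  algebraize [g, φ.comp g]
  have hlin : IsNoetherian P T := isNoetherian_of_isNoetherianRing_of_finite P T
  let ψ : U →ₗ[P] T :=
    { toFun := φ
      map_add' := map_add φ
      map_smul' := fun r x => by
        simp only [Algebra.smul_def, map_mul, RingHom.id_apply]
        rfl }
  exact Module.Finite.of_injective ψ hφ

variable (p : ℕ) [hp : Fact p.Prime] {L : Type*} [Field L] [CharP L p] [PerfectRing L p]

/-- Constants are `p`-th powers, so `X` alone generates `L[X]` over the image of Frobenius, and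
every element is integral over that image. -/
theorem finite_frobenius_polynomial : (frobenius L[X] p).Finite := by
  refine RingHom.IsIntegral.to_finite ?_ ?_
  · intro x
    refine ⟨X ^ p - C x, monic_X_pow_sub_C x hp.out.ne_zero, ?_⟩
    simp [frobenius_def]
  · let _ : Algebra L[X] L[X] := (frobenius L[X] p).toAlgebra
    refine ⟨⟨{X}, ?_⟩⟩
    rw [eq_top_iff]
    rintro f -
    induction f using Polynomial.induction_on' with
    | add f g hf hg => exact add_mem hf hg
    | monomial n a =>
      obtain ⟨c, rfl⟩ : ∃ c, c ^ p = a := (bijective_frobenius L p).2 a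
      rw [← C_mul_X_pow_eq_monomial]
      refine mul_mem ?_ (pow_mem (Algebra.subset_adjoin (by simp)) n)
      have : C (c ^ p) = frobenius L[X] p (C c) := by rw [frobenius_def, C_pow]
      rw [this]
      exact Subalgebra.algebraMap_mem _ (C c)

theorem finite_iterateFrobenius_polynomial (n : ℕ) : (iterateFrobenius L[X] p n).Finite := by
  induction n with
  | zero => rw [iterateFrobenius_zero]; exact RingHom.Finite.id _
  | succ n ih =>
    have : iterateFrobenius L[X] p (n + 1) =
        (frobenius L[X] p).comp (iterateFrobenius L[X] p n) := by
      refine RingHom.ext fun f => ?_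
      rw [RingHom.comp_apply, iterateFrobenius_def, iterateFrobenius_def, frobenius_def, pow_succ,
        pow_mul]
    rw [this]
    exact (finite_frobenius_polynomial p).comp ih

/-- The normalization of a curve over a perfect field is finite. -/
theorem finite_integralClosure_polynomial (p : ℕ) [hp : Fact p.Prime] {L : Type*} [Field L]
    [CharP L p] [PerfectRing L p] {E : Type*} [Field E] [Algebra L[X] E]
    [Algebra (FractionRing L[X]) E] [IsScalarTower L[X] (FractionRing L[X]) E]
    [FiniteDimensional (FractionRing L[X]) E] :
    Module.Finite L[X] (integralClosure L[X] E) := by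
  let M := FractionRing L[X]
  have : CharP M p := charP_of_injective_algebraMap (IsFractionRing.injective L[X] M) p
  have : CharP E p := charP_of_injective_algebraMap (algebraMap M E).injective p
  let S := separableClosure M E
  -- `E` is purely inseparable of bounded exponent over the separable closure `S`, and finiteness is
  -- known for the separable extension `S`.
  obtain ⟨n, hn⟩ : ∃ n, ∀ x : E, x ^ p ^ n ∈ (algebraMap S E).range :=
    ⟨_, IsPurelyInseparable.exponent_def' S p⟩
  have : IsScalarTower L[X] S E := .of_algebraMap_eq fun f => by
    rw [IsScalarTower.algebraMap_apply L[X] M E, IsScalarTower.algebraMap_apply L[X] M S,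
      ← IsScalarTower.algebraMap_apply M S E]
  have hfin : Module.Finite L[X] (integralClosure L[X] S) :=
    IsIntegralClosure.finite L[X] M S _
  have hfin' : (algebraMap L[X] (integralClosure L[X] S)).Finite := RingHom.finite_algebraMap.2 hfin
  have hroot (x : E) (hx : IsIntegral L[X] x) :
      ∃ s : integralClosure L[X] S, ((s : S) : E) = x ^ p ^ n := by
    obtain ⟨s, hs⟩ := hn x
    refine ⟨⟨s, ?_⟩, hs⟩
    have : IsIntegral L[X] (algebraMap S E s) := hs ▸ hx.pow _
    exact (isIntegral_algebraMap_iff (algebraMap S E).injective).1 this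
  choose r hr using fun x : integralClosure L[X] E => hroot x x.2
  have hinj : Function.Injective fun s : integralClosure L[X] S => ((s : S) : E) :=
    fun a b h => Subtype.ext (Subtype.ext h)
  -- This is `x ↦ x ^ p ^ n`. On `L[X]` it is an iterated Frobenius followed by the inclusion, hence
  -- finite, and finiteness descends along the injection `φ`.
  let φ : integralClosure L[X] E →+* integralClosure L[X] S :=
    { toFun := r
      map_one' := hinj (by simp [hr])
      map_zero' := hinj (by simp [hr, hp.out.ne_zero])
      map_mul' := fun x y => hinj (by simp [hr, mul_pow])
      map_add' := fun x y => hinj (by simp [hr, add_pow_char_pow]) }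
  refine RingHom.finite_algebraMap.1 (finite_of_comp_finite _ φ ?_ ?_)
  · intro x y hxy
    have h1 : (x : E) ^ p ^ n = (y : E) ^ p ^ n := by
      rw [← hr, ← hr]; exact congrArg (fun s : integralClosure L[X] S => ((s : S) : E)) hxy
    exact Subtype.ext (iterateFrobenius_inj E p n (by simpa [iterateFrobenius_def] using h1))
  · have : φ.comp (algebraMap L[X] (integralClosure L[X] E)) =
        (algebraMap L[X] (integralClosure L[X] S)).comp (iterateFrobenius L[X] p n) := by
      refine RingHom.ext fun f => hinj ?_
      change ((r (algebraMap L[X] (integralClosure L[X] E) f) : S) : E) = _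
      rw [hr, RingHom.comp_apply, iterateFrobenius_def]
      change (algebraMap L[X] E f) ^ p ^ n = _
      rw [← map_pow]
      rfl
    rw [this]
    exact hfin'.comp (finite_iterateFrobenius_polynomial p n)

theorem exists_eq_sum_frobenius_fractionRing (x : FractionRing L[X]) :
    ∃ a : Fin p → FractionRing L[X],
      x = ∑ i, a i ^ p * algebraMap L[X] (FractionRing L[X]) X ^ (i : ℕ) := by
  have : CharP (FractionRing L[X]) p :=
    charP_of_injective_algebraMap (IsFractionRing.injective L[X] _) p
  have hpoly (f : L[X]) : ∃ a : Fin p → L[X], f = ∑ i, a i ^ p * X ^ (i : ℕ) := by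
    induction f using Polynomial.induction_on' with
    | add f g hf hg =>
      obtain ⟨a, ha⟩ := hf
      obtain ⟨b, hb⟩ := hg
      refine ⟨a + b, ?_⟩
      conv_lhs => rw [ha, hb]
      rw [← Finset.sum_add_distrib]
      exact Finset.sum_congr rfl fun i _ => by rw [Pi.add_apply, add_pow_char, add_mul]
    | monomial n c =>
      obtain ⟨c, rfl⟩ : ∃ c', c' ^ p = c := (bijective_frobenius L p).2 c
      refine ⟨Pi.single ⟨n % p, Nat.mod_lt _ hp.out.pos⟩ (C c * X ^ (n / p)), ?_⟩
      rw [Finset.sum_eq_single ⟨n % p, Nat.mod_lt _ hp.out.pos⟩]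
      · rw [Pi.single_eq_same, mul_pow, ← C_pow, ← pow_mul, mul_assoc, ← pow_add,
          Nat.div_add_mod', C_mul_X_pow_eq_monomial]
      · intro i _ hi
        rw [Pi.single_eq_of_ne hi, zero_pow hp.out.ne_zero, zero_mul]
      · simp
  obtain ⟨f, g, hg, rfl⟩ := IsFractionRing.div_surjective (A := L[X]) x
  -- The fraction `f / g` is rewritten as `f g ^ (p - 1) / g ^ p`, whose denominator is a `p`-th
  -- power.
  obtain ⟨a, ha⟩ := hpoly (f * g ^ (p - 1))
  have hg0 : algebraMap L[X] (FractionRing L[X]) g ≠ 0 :=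
    IsFractionRing.to_map_ne_zero_of_mem_nonZeroDivisors hg
  refine ⟨fun i => algebraMap _ _ (a i) / algebraMap _ _ g, ?_⟩
  have h1 := congrArg (algebraMap L[X] (FractionRing L[X])) ha
  rw [map_mul, map_pow, map_sum] at h1
  have h2 : algebraMap L[X] (FractionRing L[X]) f / algebraMap _ _ g =
      algebraMap L[X] (FractionRing L[X]) f * algebraMap _ _ g ^ (p - 1) /
        algebraMap _ _ g ^ p := by
    rw [div_eq_div_iff hg0 (pow_ne_zero _ hg0), mul_assoc, ← pow_succ,
      Nat.sub_add_cancel hp.out.one_le]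
  rw [h2, h1, Finset.sum_div]
  refine Finset.sum_congr rfl fun i _ => ?_
  rw [map_mul, map_pow, map_pow, div_pow]
  ring

/-- In a commutative square of field extensions with parallel sides of equal degree, a linearly
independent family has at most as many elements as a spanning family of the opposite side. -/
theorem exists_eq_sum_of_finrank_eq {M₁ M₂ E₁ E₂ : Type*} [Field M₁] [Field M₂] [Field E₁]
    [Field E₂] [Algebra M₁ M₂] [Algebra M₁ E₁] [Algebra M₂ E₂] [Algebra E₁ E₂] [Algebra M₁ E₂]
    [IsScalarTower M₁ M₂ E₂] [IsScalarTower M₁ E₁ E₂]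
    [FiniteDimensional M₁ E₁] [FiniteDimensional M₂ E₂]
    (hrank : Module.finrank M₁ E₁ = Module.finrank M₂ E₂) {n : ℕ} {w : Fin n → M₂}
    (hw : ∀ x, ∃ a : Fin n → M₁, x = ∑ i, algebraMap M₁ M₂ (a i) * w i)
    {v : Fin n → E₂} (hv : ∀ a : Fin n → E₁, ∑ i, algebraMap E₁ E₂ (a i) * v i = 0 → a = 0)
    (x : E₂) : ∃ a : Fin n → E₁, x = ∑ i, algebraMap E₁ E₂ (a i) * v i := by
  have hspan : Submodule.span M₁ (Set.range w) = ⊤ := by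
    rw [eq_top_iff]
    rintro y -
    obtain ⟨a, rfl⟩ := hw y
    refine sum_mem fun i _ => ?_
    rw [← Algebra.smul_def]
    exact Submodule.smul_mem _ _ (Submodule.subset_span ⟨i, rfl⟩)
  have hfinM : Module.Finite M₁ M₂ := ⟨⟨Set.finite_range w |>.toFinset, by simpa using hspan⟩⟩
  have hle : Module.finrank M₁ M₂ ≤ n := by
    have := finrank_range_le_card (R := M₁) w
    rwa [Set.finrank, hspan, finrank_top, Fintype.card_fin] at this
  have hfinE : Module.Finite M₁ E₂ := Module.Finite.trans M₂ E₂
  have hfin : Module.Finite E₁ E₂ := Module.Finite.of_restrictScalars_finite M₁ E₁ E₂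
  have h1 := Module.finrank_mul_finrank M₁ M₂ E₂
  have h2 := Module.finrank_mul_finrank M₁ E₁ E₂
  have hpos : 0 < Module.finrank M₂ E₂ := Module.finrank_pos
  -- The degree of `E₂` over `M₁`, computed along both sides of the square; the equal factors
  -- cancel.
  have heq : Module.finrank E₁ E₂ = Module.finrank M₁ M₂ := by
    rw [hrank, ← h1, mul_comm] at h2
    exact Nat.eq_of_mul_eq_mul_right hpos h2
  have hli : LinearIndependent E₁ v := by
    rw [Fintype.linearIndependent_iff]
    intro a ha i
    exact congrFun (hv a (by simpa [Algebra.smul_def] using ha)) i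
  have hcard : Fintype.card (Fin n) = Module.finrank E₁ E₂ :=
    le_antisymm hli.fintype_card_le_finrank (by rw [Fintype.card_fin, heq]; exact hle)
  have htop := hli.span_eq_top_of_card_eq_finrank' hcard
  have hx : x ∈ Submodule.span E₁ (Set.range v) := htop ▸ Submodule.mem_top
  obtain ⟨a, ha⟩ := (Submodule.mem_span_range_iff_exists_fun E₁).1 hx
  exact ⟨a, by rw [← ha]; simp [Algebra.smul_def]⟩

/-- A function field in one variable over a perfect field has degree `p` over the subfield of
`p`-th powers. -/
theorem exists_eq_sum_frobenius {E : Type*} [Field E] [CharP E p]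
    [Algebra (FractionRing L[X]) E] [FiniteDimensional (FractionRing L[X]) E]
    {v : Fin p → E} (hv : ∀ a : Fin p → E, ∑ i, a i ^ p * v i = 0 → a = 0) (x : E) :
    ∃ a : Fin p → E, x = ∑ i, a i ^ p * v i := by
  have hM : CharP (FractionRing L[X]) p :=
    charP_of_injective_algebraMap (IsFractionRing.injective L[X] _) p
  let M := FractionRing L[X]
  have hcomm : (algebraMap M E).comp (frobenius M p) = (frobenius E p).comp (algebraMap M E) := by
    ext1; simp [frobenius_def]
  -- The square has the inclusion of `M` in `E` on two parallel sides and the Frobenius of `M` and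
  -- of `E` on the other two.
  exact @exists_eq_sum_of_finrank_eq M M E E _ _ _ _ (frobenius M p).toAlgebra _ _
    (frobenius E p).toAlgebra ((algebraMap M E).comp (frobenius M p)).toAlgebra
    (@IsScalarTower.of_algebraMap_eq' M M E _ _ _ (frobenius M p).toAlgebra _
      ((algebraMap M E).comp (frobenius M p)).toAlgebra rfl)
    (@IsScalarTower.of_algebraMap_eq' M E E _ _ _ _ (frobenius E p).toAlgebra
      ((algebraMap M E).comp (frobenius M p)).toAlgebra hcomm)
    _ _ rfl p _ (exists_eq_sum_frobenius_fractionRing p) v hv x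

end FunctionField

/-! ### Normalization of a purely inseparable extension of a discrete valuation ring -/

section GeometricModel

open Polynomial IsDiscreteValuationRing

/-- `B` is a purely inseparable extension of the discrete valuation ring `O` and a localization
of its subring `D`, which is finite over `L[y]`, where `y` is a nonzero nonunit of `O`. -/
structure IsGeometricModel (p : ℕ) {L O B : Type*} [Field L] [CommRing O] [CommRing B]
    [Algebra L[X] B] [Algebra O B] (y : O) (D : Subalgebra L[X] B) : Prop where
  exists_pow_eq : ∀ b : B, ∃ (n : ℕ) (o : O), b ^ p ^ n = algebraMap O B o
  algebraMap_X : algebraMap L[X] B X = algebraMap O B y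
  ne_zero : y ≠ 0
  not_isUnit : ¬ IsUnit y
  finite : Module.Finite L[X] D
  exists_mul_mem : ∀ b : B, ∃ m : O, IsUnit m ∧ algebraMap O B m ∈ D ∧ algebraMap O B m * b ∈ D

variable {p : ℕ} [hp : Fact p.Prime] {L : Type*} [Field L]
variable {O : Type*} [CommRing O] [IsDomain O] [IsDiscreteValuationRing O]
variable {B : Type*} [CommRing B] [IsDomain B] [Algebra L[X] B] [Algebra O B] [FaithfulSMul O B]
variable (E : Type*) [Field E] [Algebra B E] [IsFractionRing B E] [Algebra L[X] E]
  [IsScalarTower L[X] B E] [Algebra O E] [IsScalarTower O B E]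
variable {y : O} {D : Subalgebra L[X] B}

namespace IsGeometricModel

theorem exists_pow_mul_eq (h : IsGeometricModel p y D) (x : E) :
    ∃ (n : ℕ) (a b : O), b ≠ 0 ∧ x ^ p ^ n * algebraMap O E b = algebraMap O E a := by
  obtain ⟨c, s, hs, rfl⟩ := IsFractionRing.div_surjective (A := B) x
  obtain ⟨n, o, ho⟩ := h.exists_pow_eq c
  obtain ⟨k, o', ho'⟩ := h.exists_pow_eq s
  have hs0 : algebraMap B E s ≠ 0 := IsFractionRing.to_map_ne_zero_of_mem_nonZeroDivisors hs
  refine ⟨n + k, o ^ p ^ k, o' ^ p ^ n, ?_, ?_⟩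
  · refine pow_ne_zero _ ?_
    rintro rfl
    rw [map_zero] at ho'
    exact nonZeroDivisors.ne_zero hs (eq_zero_of_pow_eq_zero ho')
  · rw [IsScalarTower.algebraMap_apply O B E, IsScalarTower.algebraMap_apply O B E,
      map_pow (algebraMap O B), map_pow (algebraMap O B), ← ho, ← ho', ← pow_mul, ← pow_mul,
      ← pow_add, ← pow_add, map_pow, map_pow, div_pow,
      add_comm k n, div_mul_cancel₀ _ (pow_ne_zero _ hs0)]

/-- Some `p ^ n`-th power of an element of `E` is a fraction of elements of `O`. If the element is
integral, so is that fraction, and it lies in `O` because `O` is normal. -/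
theorem mem_integralClosure_iff (h : IsGeometricModel p y D) (x : E) :
    x ∈ integralClosure B E ↔ ∃ (n : ℕ) (o : O), x ^ p ^ n = algebraMap O E o := by
  have hinj : Function.Injective (algebraMap O E) := by
    rw [IsScalarTower.algebraMap_eq O B E]
    exact (IsFractionRing.injective B E).comp (FaithfulSMul.algebraMap_injective O B)
  have : FaithfulSMul O E := (faithfulSMul_iff_algebraMap_injective O E).2 hinj
  constructor
  · intro hx
    have hBO : Algebra.IsIntegral O B := ⟨fun b => by
      obtain ⟨n, o, ho⟩ := h.exists_pow_eq b
      exact IsIntegral.of_pow (pow_pos hp.out.pos n) (ho ▸ isIntegral_algebraMap)⟩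
    have hxO : IsIntegral O x := isIntegral_trans x hx
    obtain ⟨n, a, b, hb, hab⟩ := h.exists_pow_mul_eq E x
    let F := FractionRing O
    let _ : Algebra F E := FractionRing.liftAlgebra O E
    have : IsScalarTower O F E := FractionRing.isScalarTower_liftAlgebra O E
    have hb0 : algebraMap O F b ≠ 0 := by simpa using hb
    have hval : algebraMap F E (algebraMap O F a / algebraMap O F b) = x ^ p ^ n := by
      rw [map_div₀, ← IsScalarTower.algebraMap_apply, ← IsScalarTower.algebraMap_apply, ← hab,
        mul_div_cancel_right₀]
      simpa using hb
    have hint : IsIntegral O (algebraMap O F a / algebraMap O F b) := by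
      rw [← isIntegral_algebraMap_iff (algebraMap F E).injective, hval]
      exact hxO.pow _
    obtain ⟨o, ho⟩ := IsIntegrallyClosed.isIntegral_iff.1 hint
    exact ⟨n, o, by rw [← hval, ← ho, ← IsScalarTower.algebraMap_apply]⟩
  · rintro ⟨n, o, ho⟩
    refine IsIntegral.of_pow (pow_pos hp.out.pos n) ?_
    rw [ho, IsScalarTower.algebraMap_apply O B E]
    exact isIntegral_algebraMap

/-- For `x` in `E`, some `x ^ p ^ n` is a fraction of elements of `O`, so it or its inverse is in
`O`; roots of elements of `O` are integral. -/
theorem valuationRing (h : IsGeometricModel p y D) : ValuationRing (integralClosure B E) := by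
  have hmem : ∀ x : E, x ∈ integralClosure B E ∨ x⁻¹ ∈ integralClosure B E := by
    intro x
    obtain ⟨n, a, b, hb, hab⟩ := h.exists_pow_mul_eq E x
    have hinj : Function.Injective (algebraMap O E) := by
      rw [IsScalarTower.algebraMap_eq O B E]
      exact (IsFractionRing.injective B E).comp (FaithfulSMul.algebraMap_injective O B)
    rw [h.mem_integralClosure_iff E, h.mem_integralClosure_iff E]
    rcases ValuationRing.dvd_total b a with ⟨c, rfl⟩ | ⟨c, rfl⟩
    · left
      refine ⟨n, c, mul_right_cancel₀ ((map_ne_zero_iff _ hinj).2 hb) ?_⟩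
      rw [hab, map_mul, mul_comm]
    · right
      refine ⟨n, c, ?_⟩
      have ha : algebraMap O E a ≠ 0 := (map_ne_zero_iff _ hinj).2 (left_ne_zero_of_mul hb)
      rw [map_mul, mul_left_comm] at hab
      have h1 : x ^ p ^ n * algebraMap O E c = 1 := mul_left_cancel₀ ha (by rw [hab, mul_one])
      rw [inv_pow]
      exact inv_eq_of_mul_eq_one_right h1
  refine { cond' := fun a b => ?_ }
  by_cases ha : (a : E) = 0
  · exact ⟨0, Or.inr (by rw [mul_zero]; exact (Subtype.ext ha).symm)⟩
  by_cases hb : (b : E) = 0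
  · exact ⟨0, Or.inl (by rw [mul_zero]; exact (Subtype.ext hb).symm)⟩
  rcases hmem ((b : E) / a) with hx | hx
  · exact ⟨⟨_, hx⟩, Or.inl (Subtype.ext (mul_div_cancel₀ _ ha))⟩
  · refine ⟨⟨_, hx⟩, Or.inr (Subtype.ext ?_)⟩
    change (b : E) * ((b : E) / a)⁻¹ = a
    rw [inv_div, mul_div_cancel₀ _ hb]

theorem isUnit_of_isUnit_algebraMap (h : IsGeometricModel p y D) {x : O}
    (hu : IsUnit (algebraMap B (integralClosure B E) (algebraMap O B x))) : IsUnit x := by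
  obtain ⟨u, hu⟩ := hu.exists_right_inv
  obtain ⟨n, o, ho⟩ := (h.mem_integralClosure_iff E u).1 u.2
  have h1 : algebraMap O E x * u = 1 := by
    rw [IsScalarTower.algebraMap_apply O B E]
    exact congrArg Subtype.val hu
  have hinj : Function.Injective (algebraMap O E) := by
    rw [IsScalarTower.algebraMap_eq O B E]
    exact (IsFractionRing.injective B E).comp (FaithfulSMul.algebraMap_injective O B)
  have h2 : x ^ p ^ n * o = 1 := hinj (by
    rw [map_mul, map_pow, ← ho, ← mul_pow, h1, one_pow, map_one])
  exact (isUnit_pow_iff (pow_pos hp.out.pos n).ne').1 (IsUnit.of_mul_eq_one _ h2)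

theorem not_isUnit_algebraMap (h : IsGeometricModel p y D) :
    ¬ IsUnit (algebraMap B (integralClosure B E) (algebraMap O B y)) :=
  fun hu => h.not_isUnit (h.isUnit_of_isUnit_algebraMap E hu)

/-- After a power of `y` is cancelled, a polynomial relation for `y` would have nonzero constant
term, which would make `y` a unit. -/
theorem algebraMap_polynomial_injective (h : IsGeometricModel p y D) :
    Function.Injective (algebraMap L[X] B) := by
  let E := FractionRing B
  rw [injective_iff_map_eq_zero]
  intro f hf
  by_contra hf0
  obtain ⟨g, hg, hXg⟩ := exists_eq_pow_rootMultiplicity_mul_and_not_dvd f hf0 0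
  rw [C_0, sub_zero] at hg hXg
  have hy0 : algebraMap O B y ≠ 0 :=
    (map_ne_zero_iff _ (FaithfulSMul.algebraMap_injective O B)).2 h.ne_zero
  rw [hg, map_mul, map_pow, h.algebraMap_X] at hf
  have hg0 := (mul_eq_zero.1 hf).resolve_left (pow_ne_zero _ hy0)
  rw [X_dvd_iff] at hXg
  rw [← divX_mul_X_add g, map_add, map_mul, h.algebraMap_X] at hg0
  have hunit : IsUnit (algebraMap L[X] B (C (g.coeff 0))) :=
    ((isUnit_C.2 (IsUnit.mk0 _ hXg)).map _)
  have hun : IsUnit (algebraMap O B y) := by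
    have : algebraMap L[X] B (C (g.coeff 0)) = algebraMap O B y * (- algebraMap L[X] B g.divX) := by
      linear_combination hg0
    rw [this] at hunit
    exact isUnit_of_mul_isUnit_left hunit
  exact h.not_isUnit_algebraMap E (hun.map _)

theorem finiteDimensional (h : IsGeometricModel p y D) [Algebra (FractionRing L[X]) E]
    [IsScalarTower L[X] (FractionRing L[X]) E] :
    FiniteDimensional (FractionRing L[X]) E := by
  have := h.finite
  have hfr : IsFractionRing D E := by
    have : FaithfulSMul D E := by
      rw [faithfulSMul_iff_algebraMap_injective]
      intro a b hab
      exact Subtype.ext (IsFractionRing.injective B E hab)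
    refine IsFractionRing.of_field D E fun x => ?_
    obtain ⟨a, b, hb, rfl⟩ := IsFractionRing.div_surjective (A := B) x
    obtain ⟨m, hm, hmD, hma⟩ := h.exists_mul_mem a
    obtain ⟨k, hk, hkD, hkb⟩ := h.exists_mul_mem b
    have hm0 : algebraMap B E (algebraMap O B m) ≠ 0 := ((hm.map _).map _).ne_zero
    have hk0 : algebraMap B E (algebraMap O B k) ≠ 0 := ((hk.map _).map _).ne_zero
    have hb0 : algebraMap B E b ≠ 0 := IsFractionRing.to_map_ne_zero_of_mem_nonZeroDivisors hb
    refine ⟨⟨_, mul_mem hkD hma⟩, ⟨_, mul_mem hmD hkb⟩, ?_⟩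
    change _ = algebraMap B E (algebraMap O B k * (algebraMap O B m * a)) /
      algebraMap B E (algebraMap O B m * (algebraMap O B k * b))
    simp only [map_mul]
    field_simp
  have : FaithfulSMul L[X] D := by
    rw [faithfulSMul_iff_algebraMap_injective]
    intro a b hab
    exact h.algebraMap_polynomial_injective (congrArg Subtype.val hab)
  exact Module.Finite.of_isLocalization L[X] D (nonZeroDivisors L[X])

/-- The element `(m x) ^ p ^ n = m ^ (p ^ n - 1) (m o)` lies in `D`, which is finite over `L[X]`. Up
to units from `O`, the normalization of `B` is thus the integral closure of `L[X]`. -/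
theorem exists_isIntegral_mul (h : IsGeometricModel p y D) {x : E} (hx : x ∈ integralClosure B E) :
    ∃ m : O, IsUnit m ∧ algebraMap O B m ∈ D ∧ IsIntegral L[X] (algebraMap O E m * x) := by
  have := h.finite
  obtain ⟨n, o, ho⟩ := (h.mem_integralClosure_iff E x).1 hx
  obtain ⟨m, hm, hmD, hmo⟩ := h.exists_mul_mem (algebraMap O B o)
  refine ⟨m, hm, hmD, IsIntegral.of_pow (pow_pos hp.out.pos n) ?_⟩
  obtain ⟨k, hk⟩ : ∃ k, p ^ n = k + 1 := ⟨p ^ n - 1, by have := pow_pos hp.out.pos n; omega⟩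
  have hmem : algebraMap O B m ^ k * (algebraMap O B m * algebraMap O B o) ∈ D :=
    mul_mem (pow_mem hmD k) hmo
  have hint : IsIntegral L[X] (⟨_, hmem⟩ : D) := Algebra.IsIntegral.isIntegral _
  have := (hint.map D.val).map (IsScalarTower.toAlgHom L[X] B E)
  convert this using 1
  change _ = algebraMap B E (algebraMap O B m ^ k * (algebraMap O B m * algebraMap O B o))
  rw [mul_pow, ho, hk]
  simp only [map_mul, map_pow, ← IsScalarTower.algebraMap_apply]
  ring

end IsGeometricModel

end GeometricModel

/-! ### The normalization as a discrete valuation ring with Frobenius expansions -/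

section GeometricModel

open Polynomial IsDiscreteValuationRing

variable {p : ℕ} [hp : Fact p.Prime] {L : Type*} [Field L]
variable {O : Type*} [CommRing O] [IsDomain O] [IsDiscreteValuationRing O]
variable {B : Type*} [CommRing B] [IsDomain B] [Algebra L[X] B] [Algebra O B] [FaithfulSMul O B]
variable (E : Type*) [Field E] [Algebra B E] [IsFractionRing B E] [Algebra L[X] E]
  [IsScalarTower L[X] B E] [Algebra O E] [IsScalarTower O B E]
variable {y : O} {D : Subalgebra L[X] B}

namespace IsGeometricModel

theorem faithfulSMul (h : IsGeometricModel p y D) : FaithfulSMul L[X] E := by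
  rw [faithfulSMul_iff_algebraMap_injective, IsScalarTower.algebraMap_eq L[X] B E]
  exact (IsFractionRing.injective B E).comp h.algebraMap_polynomial_injective

variable [CharP L p]

theorem finite_integralClosure [PerfectRing L p] (h : IsGeometricModel p y D) :
    Module.Finite L[X] (integralClosure L[X] E) := by
  have := h.faithfulSMul E
  let _ : Algebra (FractionRing L[X]) E := FractionRing.liftAlgebra L[X] E
  have : IsScalarTower L[X] (FractionRing L[X]) E := FractionRing.isScalarTower_liftAlgebra L[X] E
  have := h.finiteDimensional E
  exact finite_integralClosure_polynomial p

theorem charP (h : IsGeometricModel p y D) : CharP B p :=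
  charP_of_injective_ringHom (f := (algebraMap L[X] B).comp (C : L →+* L[X]))
    (h.algebraMap_polynomial_injective.comp C_injective) p

theorem charP_integralClosure (h : IsGeometricModel p y D) : CharP (integralClosure B E) p :=
  have := h.charP
  charP_of_injective_algebraMap (FaithfulSMul.algebraMap_injective B (integralClosure B E)) p

/-- A common denominator `s` of finitely many generators of the integral closure of `L[X]` works,
since all other elements of the normalization differ from that integral closure by units of `O`. -/
theorem exists_conductor [PerfectRing L p] (h : IsGeometricModel p y D) :
    ∃ s : integralClosure B E, s ≠ 0 ∧
      ∀ x : integralClosure B E, s * x ∈ (algebraMap B (integralClosure B E)).range := by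
  classical
  have := h.finite_integralClosure E
  obtain ⟨S, hS⟩ := this.fg_top
  obtain ⟨⟨s, hs⟩, hsS⟩ := IsLocalization.exist_integer_multiples_of_finset (nonZeroDivisors B)
    (S.image fun r : integralClosure L[X] E => (r : E))
  have hA (r : integralClosure L[X] E) : ∃ b, algebraMap B E b = algebraMap B E s * r := by
    have hr : r ∈ Submodule.span L[X] (S : Set (integralClosure L[X] E)) := hS ▸ Submodule.mem_top
    induction hr using Submodule.span_induction with
    | mem x hx =>
      obtain ⟨b, hb⟩ := hsS x (Finset.mem_image_of_mem _ hx)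
      exact ⟨b, by rw [hb]; exact Algebra.smul_def s (x : E)⟩
    | zero => exact ⟨0, by simp⟩
    | add x z _ _ hx hz =>
      obtain ⟨b, hb⟩ := hx
      obtain ⟨c, hc⟩ := hz
      exact ⟨b + c, by rw [map_add, hb, hc, ← mul_add]; rfl⟩
    | smul f x _ hx =>
      obtain ⟨b, hb⟩ := hx
      refine ⟨algebraMap L[X] B f * b, ?_⟩
      rw [map_mul, hb, ← IsScalarTower.algebraMap_apply, mul_left_comm]
      congr 1
      exact (Algebra.smul_def f (x : E)).symm
  refine ⟨algebraMap B _ s, ?_, fun x => ?_⟩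
  · exact (map_ne_zero_iff _ (FaithfulSMul.algebraMap_injective B _)).2 (nonZeroDivisors.ne_zero hs)
  · obtain ⟨m, hm, -, hint⟩ := h.exists_isIntegral_mul E x.2
    obtain ⟨b, hb⟩ := hA ⟨_, hint⟩
    obtain ⟨u, hu⟩ := hm.exists_right_inv
    refine ⟨algebraMap O B u * b, Subtype.ext ?_⟩
    change algebraMap B E _ = algebraMap B E s * (x : E)
    have h1 : algebraMap O E m * algebraMap O E u = 1 := by rw [← map_mul, hu, map_one]
    rw [map_mul, hb, ← IsScalarTower.algebraMap_apply]
    linear_combination (algebraMap B E s * (x : E)) * h1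

/-- Every ideal is extended from the integral closure of `L[X]`, which is Noetherian, because
multiplication by a suitable unit moves any element into it. -/
theorem isNoetherianRing [PerfectRing L p] (h : IsGeometricModel p y D) :
    IsNoetherianRing (integralClosure B E) := by
  have := h.finite_integralClosure E
  have hN : IsNoetherianRing (integralClosure L[X] E) :=
    isNoetherian_of_tower L[X] (isNoetherian_of_isNoetherianRing_of_finite _ _)
  let φ : integralClosure L[X] E →+* integralClosure B E :=
    { toFun := fun r => ⟨r, IsIntegral.tower_top r.2⟩
      map_one' := rfl
      map_zero' := rfl
      map_add' := fun _ _ => rfl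
      map_mul' := fun _ _ => rfl }
  rw [isNoetherianRing_iff_ideal_fg]
  intro I
  have hI : (I.comap φ).map φ = I := by
    refine le_antisymm Ideal.map_comap_le fun x hx => ?_
    obtain ⟨m, hm, -, hint⟩ := h.exists_isIntegral_mul E x.2
    have hu : IsUnit (algebraMap B (integralClosure B E) (algebraMap O B m)) := (hm.map _).map _
    have heq : algebraMap B (integralClosure B E) (algebraMap O B m) * x = φ ⟨_, hint⟩ := by
      refine Subtype.ext ?_
      change algebraMap B E (algebraMap O B m) * (x : E) = algebraMap O E m * x
      rw [← IsScalarTower.algebraMap_apply]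
    rw [← Ideal.unit_mul_mem_iff_mem _ hu, heq]
    refine Ideal.mem_map_of_mem φ ?_
    rw [Ideal.mem_comap, ← heq]
    exact Ideal.mul_mem_left _ _ hx
  rw [← hI]
  exact Ideal.FG.map ((isNoetherianRing_iff_ideal_fg _).1 hN _) φ

theorem isDiscreteValuationRing [PerfectRing L p] (h : IsGeometricModel p y D) :
    IsDiscreteValuationRing (integralClosure B E) := by
  have := h.valuationRing E
  have := h.isNoetherianRing E
  have hne : algebraMap B (integralClosure B E) (algebraMap O B y) ≠ 0 :=
    (map_ne_zero_iff _ (FaithfulSMul.algebraMap_injective B _)).2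
      ((map_ne_zero_iff _ (FaithfulSMul.algebraMap_injective O B)).2 h.ne_zero)
  have hnf : ¬ IsField (integralClosure B E) := fun hf => by
    obtain ⟨b, hb⟩ := hf.mul_inv_cancel hne
    exact h.not_isUnit_algebraMap E (IsUnit.of_mul_eq_one _ hb)
  exact ((IsDiscreteValuationRing.TFAE (integralClosure B E) hnf).out 0 1).2 ‹ValuationRing _›

/-- The variable `X` maps to `y`, which vanishes in the residue field. Hence the residue field is
integral over `L`, so equal to it. -/
theorem exists_sub_mem_maximalIdeal [IsAlgClosed L] (h : IsGeometricModel p y D)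
    [IsDiscreteValuationRing (integralClosure B E)] (x : integralClosure B E) :
    ∃ c : L, x - algebraMap B (integralClosure B E) (algebraMap L[X] B (C c)) ∈
      IsLocalRing.maximalIdeal (integralClosure B E) := by
  have := h.finite
  let R := integralClosure B E
  let κ := IsLocalRing.ResidueField R
  let ρ : R →+* κ := IsLocalRing.residue R
  let ψ : L[X] →+* R := (algebraMap B R).comp (algebraMap L[X] B)
  let g : L →+* κ := (ρ.comp ψ).comp C
  have hψ : ρ.comp ψ = g.comp (evalRingHom 0) := by
    refine Polynomial.ringHom_ext (fun a => by simp [g]) ?_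
    have : ρ (ψ X) = 0 := by
      change ρ (algebraMap B R (algebraMap L[X] B X)) = 0
      rw [h.algebraMap_X, IsLocalRing.residue_eq_zero_iff]
      exact h.not_isUnit_algebraMap E
    simpa using this
  have hint (w : R) (hw : IsIntegral L[X] (w : E)) : g.IsIntegralElem (ρ w) := by
    obtain ⟨q, hq, hqw⟩ := hw
    refine RingHom.IsIntegralElem.of_comp (f := evalRingHom (0 : L)) ?_
    rw [← hψ]
    refine ⟨q, hq, ?_⟩
    have h0 : eval₂ ψ w q = 0 := by
      apply Subtype.val_injective
      have := hom_eval₂ q ψ (algebraMap R E) w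
      refine this.trans ?_
      have h1 : (algebraMap R E).comp ψ = algebraMap L[X] E :=
        (IsScalarTower.algebraMap_eq L[X] B E).symm
      rw [h1]
      exact hqw
    rw [← hom_eval₂, h0, map_zero]
  have hgint : g.IsIntegral := by
    let _ : Algebra L κ := g.toAlgebra
    intro a
    obtain ⟨w, rfl⟩ := IsLocalRing.residue_surjective a
    obtain ⟨m, hm, hmD, hmw⟩ := h.exists_isIntegral_mul E w.2
    have h1 : IsIntegral L (ρ (algebraMap B R (algebraMap O B m))) := by
      refine hint _ ?_
      have hi : IsIntegral L[X] (⟨_, hmD⟩ : D) := Algebra.IsIntegral.isIntegral _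
      exact (hi.map D.val).map (IsScalarTower.toAlgHom L[X] B E)
    have h2 : IsIntegral L (ρ (algebraMap B R (algebraMap O B m) * w)) := by
      refine hint _ ?_
      rw [IsScalarTower.algebraMap_apply O B E] at hmw
      exact hmw
    have hu : ρ (algebraMap B R (algebraMap O B m)) ≠ 0 := (((hm.map _).map _).map ρ).ne_zero
    have h3 : ρ w = (ρ (algebraMap B R (algebraMap O B m)))⁻¹ *
        ρ (algebraMap B R (algebraMap O B m) * w) := by
      rw [map_mul, inv_mul_cancel_left₀ hu]
    have h4 : IsIntegral L (ρ w) := by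
      rw [h3]
      exact h1.inv.mul h2
    exact h4
  obtain ⟨c, hc⟩ := (IsAlgClosed.ringHom_bijective_of_isIntegral g hgint).2 (ρ x)
  refine ⟨c, ?_⟩
  rw [← IsLocalRing.residue_eq_zero_iff, map_sub, sub_eq_zero]
  exact hc.symm

/-- In `E` the powers `tⁱ` with `i < p` are independent over the `p`-th powers by their values,
hence span by the degree. Comparing values then shows that the coefficients of an integral element
are integral. -/
theorem hasFrobeniusExpansion [PerfectRing L p] (h : IsGeometricModel p y D)
    [IsDiscreteValuationRing (integralClosure B E)] {t : integralClosure B E}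
    (ht : Irreducible t) : HasFrobeniusExpansion p t := by
  have := h.charP
  have : CharP E p := charP_of_injective_algebraMap (IsFractionRing.injective B E) p
  have := h.faithfulSMul E
  let _ : Algebra (FractionRing L[X]) E := FractionRing.liftAlgebra L[X] E
  have : IsScalarTower L[X] (FractionRing L[X]) E := FractionRing.isScalarTower_liftAlgebra L[X] E
  have := h.finiteDimensional E
  let R := integralClosure B E
  have hv1 : addVal R t = (1 : ℕ) := by simpa using addVal_uniformizer ht
  have hp1 : ¬ p ∣ 1 := by simpa using hp.out.ne_one
  have hclear (a : Fin p → E) : ∃ (s : R) (c : ℕ → R), s ≠ 0 ∧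
      ∀ i : Fin p, (c i : E) = s * a i := by
    obtain ⟨⟨s, hs⟩, hsa⟩ := IsLocalization.exist_integer_multiples_of_finite (nonZeroDivisors B) a
    choose b hb using hsa
    refine ⟨algebraMap B R s, fun i => if hi : i < p then algebraMap B R (b ⟨i, hi⟩) else 0,
      (map_ne_zero_iff _ (FaithfulSMul.algebraMap_injective B _)).2 (nonZeroDivisors.ne_zero hs),
      fun i => ?_⟩
    simp only [i.2, dif_pos]
    exact (hb i).trans (Algebra.smul_def s (a i))
  have hv : ∀ a : Fin p → E, ∑ i, a i ^ p * (t : E) ^ (i : ℕ) = 0 → a = 0 := by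
    intro a ha
    obtain ⟨s, c, hs, hc⟩ := hclear a
    have hsum : ∑ i ∈ Finset.range p, c i ^ p * t ^ i = 0 := by
      apply Subtype.val_injective
      change algebraMap R E _ = 0
      rw [Finset.sum_range, map_sum]
      have : (s : E) ^ p * ∑ i, a i ^ p * (t : E) ^ (i : ℕ) = 0 := by rw [ha, mul_zero]
      rw [← this, Finset.mul_sum]
      refine Finset.sum_congr rfl fun i _ => ?_
      change (c i : E) ^ p * (t : E) ^ (i : ℕ) = _
      rw [hc]
      ring
    funext i
    have h0 := eq_zero_of_sum_pow_mul_pow_eq_zero p hv1 hp1 hsum i i.2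
    have h1 := hc i
    rw [h0] at h1
    exact (mul_eq_zero.1 h1.symm).resolve_left fun h => hs (Subtype.ext h)
  intro x
  obtain ⟨a, ha⟩ := exists_eq_sum_frobenius (L := L) p hv (x : E)
  obtain ⟨s, c, hs, hc⟩ := hclear a
  have hsum : s ^ p * x = ∑ i ∈ Finset.range p, c i ^ p * t ^ i := by
    apply Subtype.val_injective
    change (s : E) ^ p * (x : E) = algebraMap R E _
    rw [Finset.sum_range, map_sum, ha, Finset.mul_sum]
    refine Finset.sum_congr rfl fun i _ => ?_
    change _ = (c i : E) ^ p * (t : E) ^ (i : ℕ)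
    rw [hc]
    ring
  have hval := addVal_sum_pow_mul_pow p hv1 hp1 c (Finset.Subset.refl (Finset.range p))
  rw [← hsum, addVal_mul, addVal_pow] at hval
  -- From `p v(s) ≤ p v(cᵢ) + i` and `i < p` it follows that `v(s) ≤ v(cᵢ)`.
  have hdvd : ∀ i < p, s ∣ c i := by
    intro i hi
    rw [← addVal_le_iff_dvd]
    have hle : p • addVal R s ≤ p * addVal R (c i) + (i * 1 : ℕ) :=
      (le_self_add.trans hval.le).trans (Finset.inf_le (Finset.mem_range.2 hi))
    obtain ⟨k, hk⟩ := ENat.ne_top_iff_exists.1 (addVal_eq_top_iff.not.2 hs)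
    by_cases hci : addVal R (c i) = ⊤
    · rw [hci]; exact le_top
    obtain ⟨l, hl⟩ := ENat.ne_top_iff_exists.1 hci
    rw [← hk, ← hl, nsmul_eq_mul, mul_one] at hle
    rw [← hk, ← hl]
    have hle' : p * k ≤ p * l + i := by exact_mod_cast hle
    have : k ≤ l := by
      by_contra! hlt
      have : p * (l + 1) ≤ p * k := Nat.mul_le_mul_left p hlt
      rw [mul_add, mul_one] at this
      omega
    exact_mod_cast this
  have hex : ∀ i, ∃ d : R, i < p → c i = s * d := fun i => by
    by_cases hi : i < p
    · obtain ⟨d, hd⟩ := hdvd i hi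
      exact ⟨d, fun _ => hd⟩
    · exact ⟨0, fun h => absurd h hi⟩
  choose d hd using hex
  refine ⟨d, mul_left_cancel₀ (pow_ne_zero p hs) ?_⟩
  rw [hsum, Finset.mul_sum]
  refine Finset.sum_congr rfl fun i hi => ?_
  rw [hd i (Finset.mem_range.1 hi)]
  ring

end IsGeometricModel

end GeometricModel

/-! ### The normalization of a subring of Frobenius type -/

section FrobeniusSubring

open IsDiscreteValuationRing

variable {p : ℕ} [hp : Fact p.Prime]
variable {B₁ B : Type*} [CommRing B₁] [IsDomain B₁] [CommRing B] [IsDomain B]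
variable {E₁ E : Type*} [Field E₁] [Field E] [Algebra B₁ E₁] [IsFractionRing B₁ E₁] [Algebra B E]
  [IsFractionRing B E]

/-- If a subring `B₁` of `B` contains all `p`-th powers and lies in the field of `p`-th powers,
then the integral closure of `B₁` is the ring of `p`-th powers of the integral closure of `B`. -/
theorem exists_integralClosure_hom_of_frobenius
    (η : B₁ →+* B) (hη : Function.Injective η)
    (hpow : ∀ b : B, ∃ b₁, η b₁ = b ^ p)
    (hroot : ∀ b₁ : B₁, ∃ c d : B, d ≠ 0 ∧ η b₁ * d ^ p = c ^ p)
    (hint : ∀ x ∈ integralClosure B E, ∃ (n : ℕ) (b : B), x ^ p ^ n = algebraMap B E b) :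
    ∃ θ : integralClosure B₁ E₁ →+* integralClosure B E, Function.Injective θ ∧
      (∀ b₁, θ (algebraMap B₁ _ b₁) = algebraMap B _ (η b₁)) ∧
      (∀ x₁, ∃ x, θ x₁ = x ^ p) ∧ ∀ x, ∃ x₁, θ x₁ = x ^ p := by
  let ψ : E₁ →+* E := IsFractionRing.lift (g := (algebraMap B E).comp η)
    ((IsFractionRing.injective B E).comp hη)
  have hψ (b : B₁) : ψ (algebraMap B₁ E₁ b) = algebraMap B E (η b) :=
    IsFractionRing.lift_algebraMap _ b
  have hψint (x : E₁) (hx : IsIntegral B₁ x) : IsIntegral B (ψ x) :=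
    hx.map_of_comp_eq η ψ (RingHom.ext fun b => (hψ b).symm)
  let θ : integralClosure B₁ E₁ →+* integralClosure B E :=
    { toFun := fun x => ⟨ψ x, hψint x x.2⟩
      map_one' := Subtype.ext (map_one ψ)
      map_zero' := Subtype.ext (map_zero ψ)
      map_mul' := fun x y => Subtype.ext (map_mul ψ (x : E₁) y)
      map_add' := fun x y => Subtype.ext (map_add ψ (x : E₁) y) }
  have hroot' (b₁ : B₁) : ∃ e : E, algebraMap B E (η b₁) = e ^ p := by
    obtain ⟨c, d, hd, hcd⟩ := hroot b₁
    have hd0 : algebraMap B E d ≠ 0 := (map_ne_zero_iff _ (IsFractionRing.injective B E)).2 hd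
    refine ⟨algebraMap B E c / algebraMap B E d, ?_⟩
    rw [div_pow, eq_div_iff (pow_ne_zero _ hd0), ← map_pow, ← map_pow, ← map_mul, hcd]
  refine ⟨θ, ?_, fun b => Subtype.ext (hψ b), fun x₁ => ?_, fun x => ?_⟩
  · intro x y hxy
    exact Subtype.ext (ψ.injective (congrArg Subtype.val hxy))
  · obtain ⟨b, d, hd, hbd⟩ := IsFractionRing.div_surjective (A := B₁) (x₁ : E₁)
    obtain ⟨e, he⟩ := hroot' b
    obtain ⟨g, hg⟩ := hroot' d
    have hval : ψ x₁ = (e / g) ^ p := by rw [← hbd, map_div₀, hψ, hψ, he, hg, div_pow]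
    refine ⟨⟨e / g, IsIntegral.of_pow hp.out.pos (hval ▸ hψint x₁ x₁.2)⟩, Subtype.ext hval⟩
  · obtain ⟨b, d, hd, hbd⟩ := IsFractionRing.div_surjective (A := B) (x : E)
    obtain ⟨b₁, hb₁⟩ := hpow b
    obtain ⟨d₁, hd₁⟩ := hpow d
    have hval : ψ (algebraMap B₁ E₁ b₁ / algebraMap B₁ E₁ d₁) = (x : E) ^ p := by
      rw [map_div₀, hψ, hψ, hb₁, hd₁, map_pow, map_pow, ← div_pow, hbd]
    refine ⟨⟨algebraMap B₁ E₁ b₁ / algebraMap B₁ E₁ d₁, ?_⟩, Subtype.ext hval⟩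
    -- A `p ^ n`-th power of `x` is in `B`, so the `p ^ n`-th power of `x ^ p` comes from `B₁`;
    -- hence `x ^ p` is integral over `B₁`.
    obtain ⟨n, c, hc⟩ := hint x x.2
    obtain ⟨c₁, hc₁⟩ := hpow c
    refine IsIntegral.of_pow (pow_pos hp.out.pos n) ?_
    have : (algebraMap B₁ E₁ b₁ / algebraMap B₁ E₁ d₁) ^ p ^ n = algebraMap B₁ E₁ c₁ := by
      apply ψ.injective
      rw [map_pow, hval, hψ, hc₁, map_pow, ← hc, ← pow_mul, ← pow_mul, mul_comm]
    rw [this]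
    exact isIntegral_algebraMap

/-- The isomorphism `x ↦ x ^ p` onto the ring of `p`-th powers. -/
theorem exists_ringEquiv_of_frobenius {R₁ R : Type*} [CommRing R₁] [CommRing R] [IsDomain R]
    [CharP R p] (θ : R₁ →+* R) (hθ : Function.Injective θ) (hθ₁ : ∀ x₁, ∃ x, θ x₁ = x ^ p)
    (hθ₂ : ∀ x, ∃ x₁, θ x₁ = x ^ p) : ∃ σ : R ≃+* R₁, ∀ x, θ (σ x) = x ^ p := by
  choose σ hσ using hθ₂
  let σ' : R →+* R₁ :=
    { toFun := σ
      map_one' := hθ (by simp [hσ])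
      map_zero' := hθ (by simp [hσ, hp.out.ne_zero])
      map_mul' := fun x y => hθ (by simp [hσ, mul_pow])
      map_add' := fun x y => hθ (by simp [hσ, add_pow_char]) }
  refine ⟨RingEquiv.ofBijective σ' ⟨?_, ?_⟩, hσ⟩
  · intro x y hxy
    have h1 : x ^ p = y ^ p := by rw [← hσ, ← hσ]; exact congrArg θ hxy
    exact frobenius_inj R p h1
  · intro x₁
    obtain ⟨x, hx⟩ := hθ₁ x₁
    exact ⟨x, hθ ((hσ x).trans hx.symm)⟩

theorem HasFrobeniusExpansion.map {R₁ R : Type*} [CommRing R₁] [CommRing R] {t : R}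
    (h : HasFrobeniusExpansion p t) (σ : R ≃+* R₁) : HasFrobeniusExpansion p (σ t) := by
  intro x₁
  obtain ⟨a, ha⟩ := h (σ.symm x₁)
  refine ⟨fun i => σ (a i), ?_⟩
  have := congrArg σ ha
  simpa using this

end FrobeniusSubring

/-! ### Generating a discrete valuation ring over a subring containing all `p`-th powers -/

section DegreeP

open IsDiscreteValuationRing

variable {p : ℕ} [hp : Fact p.Prime] {O₁ O : Type*} [CommRing O₁] [CommRing O] [IsDomain O]
  [IsDiscreteValuationRing O] [CharP O p]

/-- If `z` satisfies an estimate for the order of polynomials in `z`, then it generates. -/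
theorem exists_eq_sum_of_dvd [IsDomain O₁] (j : O₁ →+* O) (hj : Function.Injective j)
    (hsat : ∀ (c d : O₁) (x : O), c ≠ 0 → j c * x = j d → ∃ e, x = j e)
    (hrank : ∀ z : Fin (p + 1) → O, ∃ c : Fin (p + 1) → O₁, c ≠ 0 ∧ ∑ i, j (c i) * z i = 0)
    (z : O) (hz : ∀ (e : O₁) (c : Fin p → O₁), j e ∣ ∑ i, j (c i) * z ^ (i : ℕ) →
      ∀ i, j e ∣ j (c i)) (o : O) :
    ∃ c : Fin p → O₁, o = ∑ i, j (c i) * z ^ (i : ℕ) := by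
  obtain ⟨c, hc0, hc⟩ := hrank (Fin.snoc (fun i : Fin p => z ^ (i : ℕ)) o)
  rw [Fin.sum_univ_castSucc] at hc
  simp only [Fin.snoc_castSucc, Fin.snoc_last] at hc
  set e := c (Fin.last p) with he
  -- The estimate `hz` for the divisor `0` says that a vanishing combination of the powers of `z`
  -- has vanishing coefficients.
  have he0 : e ≠ 0 := by
    intro h0
    apply hc0
    rw [h0, map_zero, zero_mul, add_zero] at hc
    funext i
    refine Fin.lastCases h0 (fun i => ?_) i
    have := hz 0 (fun i => c i.castSucc) (by rw [hc]; exact dvd_zero _) i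
    rw [map_zero, zero_dvd_iff] at this
    exact hj (this.trans (map_zero j).symm)
  have hdvd := hz e (fun i => c i.castSucc) ⟨-o, by linear_combination hc⟩
  have hex (i : Fin p) : ∃ d : O₁, j (c i.castSucc) = j e * j d := by
    obtain ⟨x, hx⟩ := hdvd i
    obtain ⟨d, rfl⟩ := hsat e (c i.castSucc) x he0 hx.symm
    exact ⟨d, hx⟩
  choose d hd using hex
  refine ⟨fun i => - d i, mul_left_cancel₀ ((map_ne_zero_iff j hj).2 he0) ?_⟩
  simp only [hd] at hc
  rw [Finset.mul_sum]
  simp only [map_neg, neg_mul, mul_neg, Finset.sum_neg_distrib, ← mul_assoc]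
  linear_combination hc

/-- If some value of `O₁` is prime to `p`, a quotient by a `p`-th power, which stays in `O₁` by
saturation, is a uniformizer `π` of `O`. If moreover all residues came from `O₁`, successive
approximation would give `O = O₁ + π ^ N O` for every `N`, against `happrox`. -/
theorem exists_residue_notMem_or_dvd_addVal (j : O₁ →+* O)
    (hpow : ∀ o : O, ∃ c, j c = o ^ p)
    (hsat : ∀ (c d : O₁) (x : O), c ≠ 0 → j c * x = j d → ∃ e, x = j e)
    (happrox : ∀ c : O₁, ¬ IsUnit (j c) → ∃ (N : ℕ) (o : O), ∀ d q, o ≠ j d + j c ^ N * q) :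
    (∀ (c : O₁) (n : ℕ), addVal O (j c) = n → p ∣ n) ∨
    ∃ (π : O₁) (z : O), Irreducible (j π) ∧
      ∀ c, z - j c ∉ IsLocalRing.maximalIdeal O := by
  by_cases hI : ∀ (c : O₁) (n : ℕ), addVal O (j c) = n → p ∣ n
  · exact Or.inl hI
  right
  push Not at hI
  obtain ⟨c, n, hc, hn⟩ := hI
  obtain ⟨ϖ, hϖ⟩ := exists_irreducible O
  -- As `k` inverts `n` modulo `p`, the value `n k` of `c ^ k` is one more than that of the `p`-th
  -- power of `ϖ ^ (n k / p)`.
  obtain ⟨k, -, hk⟩ := Nat.exists_mul_mod_eq_one_of_coprime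
    ((Nat.Prime.coprime_iff_not_dvd hp.out).2 hn).symm hp.out.one_lt
  obtain ⟨d, hd⟩ := hpow (ϖ ^ (n * k / p))
  have hvd : addVal O (j d) = (p * (n * k / p) : ℕ) := by
    rw [hd, ← pow_mul, hϖ.addVal_pow, mul_comm]
  have hvc : addVal O (j (c ^ k)) = (p * (n * k / p) + 1 : ℕ) := by
    rw [map_pow, addVal_pow, hc, ← hk, Nat.div_add_mod, nsmul_eq_mul, mul_comm]
    push_cast
    rfl
  obtain ⟨x, hx⟩ : j d ∣ j (c ^ k) := by
    rw [← addVal_le_iff_dvd, hvd, hvc]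
    exact_mod_cast Nat.le_succ _
  have hd0 : d ≠ 0 := by
    rintro rfl
    rw [map_zero, addVal_zero] at hvd
    exact ENat.natCast_ne_top _ hvd.symm
  obtain ⟨π, rfl⟩ := hsat d (c ^ k) x hd0 hx.symm
  have hvπ : addVal O (j π) = 1 := by
    rw [hx, addVal_mul, hvd, Nat.cast_add] at hvc
    simpa using ENat.add_right_injective_of_ne_top (ENat.natCast_ne_top _) hvc
  have hπ : Irreducible (j π) := by
    have h1 : Associated (j π) ϖ :=
      (addVal_eq_iff_associated _ _).1 (by rw [hvπ, addVal_uniformizer hϖ])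
    exact h1.irreducible_iff.2 hϖ
  refine ⟨π, ?_⟩
  by_contra! hno
  have hno' (z : O) : ∃ c q, z = j c + j π * q := by
    obtain ⟨c, hc⟩ := hno z hπ
    rw [hπ.maximalIdeal_eq, Ideal.mem_span_singleton] at hc
    obtain ⟨q, hq⟩ := hc
    exact ⟨c, q, by rw [← hq]; ring⟩
  have hN (N : ℕ) : ∀ o : O, ∃ c q, o = j c + j π ^ N * q := by
    induction N with
    | zero => exact fun o => ⟨0, o, by simp⟩
    | succ N ih =>
      intro o
      obtain ⟨c, q, hq⟩ := ih o
      obtain ⟨c', q', hq'⟩ := hno' q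
      exact ⟨c + π ^ N * c', q', by rw [hq, hq']; simp only [map_add, map_mul, map_pow]; ring⟩
  obtain ⟨N, o, ho⟩ := happrox π hπ.not_isUnit
  obtain ⟨d, q, hdq⟩ := hN N o
  exact ho d q hdq

/-- The nonzero terms have values `p kᵢ + i`, distinct modulo `p`, so the sum has their minimum as
value. The value of `e`, if finite, is a multiple of `p`, and the excess `i < p` does not affect the
comparison. -/
theorem dvd_coeff_of_dvd_addVal (j : O₁ →+* O)
    (hI : ∀ (c : O₁) (n : ℕ), addVal O (j c) = n → p ∣ n) {ϖ : O} (hϖ : Irreducible ϖ)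
    (e : O₁) (c : Fin p → O₁) (hdvd : j e ∣ ∑ i, j (c i) * ϖ ^ (i : ℕ)) (i : Fin p) :
    j e ∣ j (c i) := by
  have hval (i : Fin p) : addVal O (j (c i) * ϖ ^ (i : ℕ)) = addVal O (j (c i)) + (i : ℕ) := by
    rw [addVal_mul, hϖ.addVal_pow]
  have hinf := addVal_sum_eq_inf Finset.univ (fun i : Fin p => j (c i) * ϖ ^ (i : ℕ)) <| by
    intro a _ b _ hab he
    by_contra htop
    rw [hval] at htop
    rw [hval, hval] at he
    have ha : addVal O (j (c a)) ≠ ⊤ := fun h => htop (by rw [h, top_add])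
    have hb : addVal O (j (c b)) ≠ ⊤ := fun h => htop (by rw [he, h, top_add])
    obtain ⟨k, hk⟩ := ENat.ne_top_iff_exists.1 ha
    obtain ⟨l, hl⟩ := ENat.ne_top_iff_exists.1 hb
    obtain ⟨k', rfl⟩ := hI _ _ hk.symm
    obtain ⟨l', rfl⟩ := hI _ _ hl.symm
    rw [← hk, ← hl] at he
    have he' : p * k' + a = p * l' + b := by exact_mod_cast he
    have h1 := congrArg (· % p) he'
    simp only [Nat.mul_add_mod, Nat.mod_eq_of_lt a.2, Nat.mod_eq_of_lt b.2] at h1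
    exact hab (Fin.ext h1)
  rw [← addVal_le_iff_dvd, hinf] at hdvd
  have hle := hdvd.trans (Finset.inf_le (Finset.mem_univ i))
  rw [hval] at hle
  rw [← addVal_le_iff_dvd]
  by_cases hci : addVal O (j (c i)) = ⊤
  · rw [hci]; exact le_top
  obtain ⟨l, hl⟩ := ENat.ne_top_iff_exists.1 hci
  have he : addVal O (j e) ≠ ⊤ := by
    intro h
    rw [h, ← hl] at hle
    exact ENat.natCast_ne_top (l + i) (by exact_mod_cast top_le_iff.1 hle)
  obtain ⟨k, hk⟩ := ENat.ne_top_iff_exists.1 he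
  obtain ⟨k', rfl⟩ := hI _ _ hk.symm
  obtain ⟨l', rfl⟩ := hI _ _ hl.symm
  rw [← hk, ← hl] at hle ⊢
  have hle' : p * k' ≤ p * l' + i := by exact_mod_cast hle
  have : k' ≤ l' := by
    by_contra! hlt
    have := Nat.mul_le_mul_left p (Nat.succ_le_of_lt hlt)
    rw [Nat.succ_eq_add_one, mul_add, mul_one] at this
    have := i.2
    omega
  exact_mod_cast Nat.mul_le_mul_left p this

open Polynomial in
-- Let `k` be the residue field of `O₁`. The residue of `z` is outside `k` but its `p`-th power is
-- inside, so its minimal polynomial over `k` has degree `p`; a nonzero polynomial of smaller degree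
-- cannot vanish there.
theorem isUnit_sum_of_residue_notMem (j : O₁ →+* O)
    (hpow : ∀ o : O, ∃ c, j c = o ^ p)
    (hsat : ∀ (c d : O₁) (x : O), c ≠ 0 → j c * x = j d → ∃ e, x = j e) {z : O}
    (hz : ∀ c, z - j c ∉ IsLocalRing.maximalIdeal O) (c : Fin p → O₁)
    {i₀ : Fin p} (hi₀ : IsUnit (j (c i₀))) : IsUnit (∑ i, j (c i) * z ^ (i : ℕ)) := by
  let κ := IsLocalRing.ResidueField O
  let ρ : O →+* κ := IsLocalRing.residue O
  have hinv (a : κ) (ha : a ∈ (ρ.comp j).range) : a⁻¹ ∈ (ρ.comp j).range := by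
    obtain ⟨d, rfl⟩ := ha
    by_cases h0 : (ρ.comp j) d = 0
    · rw [h0, inv_zero]; exact zero_mem _
    have hu : IsUnit (j d) := by
      by_contra hnu
      exact h0 ((IsLocalRing.residue_eq_zero_iff _).2 hnu)
    obtain ⟨u, hu'⟩ := hu.exists_right_inv
    have hd0 : d ≠ 0 := by rintro rfl; simp at hu
    obtain ⟨e, rfl⟩ := hsat d 1 u hd0 (by rw [hu', map_one])
    refine ⟨e, (inv_eq_of_mul_eq_one_right ?_).symm⟩
    rw [← map_one (ρ.comp j)]
    simp only [RingHom.comp_apply, ← map_mul, hu', map_one]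
  let k : Subfield κ := { (ρ.comp j).range with inv_mem' := hinv }
  have : CharP κ p := by
    have h0 : (p : κ) = 0 := by
      rw [← map_natCast ρ, CharP.cast_eq_zero, map_zero]
    exact (CharP.charP_iff_prime_eq_zero hp.out).2 h0
  obtain ⟨a, ha⟩ := hpow z
  let a' : k := ⟨ρ (j a), a, rfl⟩
  have haz : (a' : κ) = ρ z ^ p := by change ρ (j a) = _; rw [ha, map_pow]
  have hirr : Irreducible (X ^ p - C a') := by
    refine X_pow_sub_C_irreducible_of_prime hp.out fun b hb => ?_
    have h1 : (b : κ) ^ p = ρ z ^ p := by rw [← haz, ← hb]; rfl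
    have h2 : (b : κ) = ρ z := frobenius_inj κ p h1
    obtain ⟨d, hd⟩ := b.2
    refine hz d ((IsLocalRing.residue_eq_zero_iff _).1 ?_)
    rw [map_sub, sub_eq_zero]
    exact h2.symm.trans hd.symm
  have hmin : X ^ p - C a' = minpoly k (ρ z) := by
    refine minpoly.eq_of_irreducible_of_monic hirr ?_ (monic_X_pow_sub_C a' hp.out.ne_zero)
    have h2 : algebraMap k κ a' = ρ z ^ p := haz
    simp [h2]
  by_contra hnu
  have h0 : ρ (∑ i, j (c i) * z ^ (i : ℕ)) = 0 := (IsLocalRing.residue_eq_zero_iff _).2 hnu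
  let q : k[X] := ∑ i : Fin p, C (⟨ρ (j (c i)), c i, rfl⟩ : k) * X ^ (i : ℕ)
  have hq0 : aeval (ρ z) q = 0 := by
    rw [← h0]
    simp only [q, map_sum, map_mul, map_pow, aeval_C, aeval_X]
    rfl
  have hcoeff : q.coeff i₀ = (⟨ρ (j (c i₀)), c i₀, rfl⟩ : k) := by
    simp only [q, finsetSum_coeff, coeff_C_mul, coeff_X_pow]
    rw [Finset.sum_eq_single i₀]
    · simp
    · intro b _ hb
      rw [if_neg (fun h => hb (Fin.ext h.symm)), mul_zero]
    · simp
  have hqne : q ≠ 0 := by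
    intro hq
    rw [hq, coeff_zero] at hcoeff
    have : ρ (j (c i₀)) = 0 := (congrArg Subtype.val hcoeff).symm
    exact (hi₀.map ρ).ne_zero this
  have hdeg := natDegree_le_natDegree (minpoly.degree_le_of_ne_zero k (ρ z) hqne hq0)
  rw [← hmin, natDegree_X_pow_sub_C] at hdeg
  have hlt : q.natDegree ≤ p - 1 := by
    refine natDegree_sum_le_of_forall_le _ _ fun i _ => ?_
    refine (natDegree_C_mul_X_pow_le _ _).trans ?_
    have := i.2
    omega
  have := hp.out.pos
  omega

/-- The largest common power of `π` is factored out of the coefficients. One remaining coefficient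
is a unit, so the remaining sum is a unit, and `e` divides that power of `π`. -/
theorem dvd_coeff_of_residue_notMem (j : O₁ →+* O)
    (hpow : ∀ o : O, ∃ c, j c = o ^ p)
    (hsat : ∀ (c d : O₁) (x : O), c ≠ 0 → j c * x = j d → ∃ e, x = j e)
    {π : O₁} (hπ : Irreducible (j π)) {z : O}
    (hz : ∀ c, z - j c ∉ IsLocalRing.maximalIdeal O)
    (e : O₁) (c : Fin p → O₁) (hdvd : j e ∣ ∑ i, j (c i) * z ^ (i : ℕ)) (i : Fin p) :
    j e ∣ j (c i) := by
  obtain ⟨i₀, -, hi₀⟩ := Finset.exists_min_image Finset.univ (fun i => addVal O (j (c i)))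
    ⟨i, Finset.mem_univ i⟩
  by_cases htop : addVal O (j (c i₀)) = ⊤
  · have := hi₀ i (Finset.mem_univ i)
    rw [htop, top_le_iff, addVal_eq_top_iff] at this
    rw [this]; exact dvd_zero _
  obtain ⟨k, hk⟩ := ENat.ne_top_iff_exists.1 htop
  have hπ0 : π ^ k ≠ 0 := by
    intro h0
    have := congrArg j h0
    rw [map_pow, map_zero] at this
    exact pow_ne_zero k hπ.ne_zero this
  have hex (i : Fin p) : ∃ d : O₁, j (c i) = j π ^ k * j d := by
    obtain ⟨x, hx⟩ : j π ^ k ∣ j (c i) := by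
      rw [← addVal_le_iff_dvd, hπ.addVal_pow, hk]
      exact hi₀ i (Finset.mem_univ i)
    obtain ⟨d, rfl⟩ := hsat (π ^ k) (c i) x hπ0 (by rw [map_pow, hx])
    exact ⟨d, hx⟩
  choose d hd using hex
  have hunit : IsUnit (j (d i₀)) := by
    have h1 := hk
    rw [hd i₀, addVal_mul, hπ.addVal_pow] at h1
    refine addVal_eq_zero_iff.1 (ENat.add_right_injective_of_ne_top (ENat.natCast_ne_top k) ?_)
    simpa using h1.symm
  have hu := isUnit_sum_of_residue_notMem j hpow hsat hz d hunit
  have hsum : ∑ i, j (c i) * z ^ (i : ℕ) = j π ^ k * ∑ i, j (d i) * z ^ (i : ℕ) := by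
    rw [Finset.mul_sum]
    exact Finset.sum_congr rfl fun i _ => by rw [hd i, mul_assoc]
  rw [hsum] at hdvd
  have := (IsUnit.dvd_mul_right hu).1 hdvd
  exact this.trans ⟨j (d i), hd i⟩

/-- A discrete valuation ring of degree `p` over a subring containing all `p`-th powers is
generated by one element. -/
theorem exists_generator [IsDomain O₁] (j : O₁ →+* O) (hj : Function.Injective j)
    (hpow : ∀ o : O, ∃ c, j c = o ^ p)
    (hsat : ∀ (c d : O₁) (x : O), c ≠ 0 → j c * x = j d → ∃ e, x = j e)
    (hrank : ∀ z : Fin (p + 1) → O, ∃ c : Fin (p + 1) → O₁, c ≠ 0 ∧ ∑ i, j (c i) * z i = 0)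
    (happrox : ∀ c : O₁, ¬ IsUnit (j c) → ∃ (N : ℕ) (o : O), ∀ d q, o ≠ j d + j c ^ N * q) :
    ∃ z : O, ∀ o : O, ∃ c : Fin p → O₁, o = ∑ i, j (c i) * z ^ (i : ℕ) := by
  rcases exists_residue_notMem_or_dvd_addVal (p := p) j hpow hsat happrox with h | ⟨π, z, hπ, hz⟩
  · obtain ⟨ϖ, hϖ⟩ := exists_irreducible O
    exact ⟨ϖ, exists_eq_sum_of_dvd j hj hsat hrank ϖ (dvd_coeff_of_dvd_addVal j h hϖ)⟩
  · exact ⟨z, exists_eq_sum_of_dvd j hj hsat hrank z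
      (dvd_coeff_of_residue_notMem j hpow hsat hπ hz)⟩

end DegreeP

/-! ### Base change to a purely inseparable extension -/

section Tensor

open Polynomial IsDiscreteValuationRing

variable {K : Type*} [Field K] (p : ℕ) [hp : Fact p.Prime] [CharP K p]
variable (L : Type*) [Field L] [Algebra K L]

theorem exists_pow_eq_one_tmul [IsPurelyInseparable K L] {O : Type*} [CommRing O] [Algebra K O]
    [CharP (L ⊗[K] O) p] (b : L ⊗[K] O) :
    ∃ (n : ℕ) (o : O), b ^ p ^ n = 1 ⊗ₜ o := by
  induction b with
  | zero => exact ⟨0, 0, by simp⟩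
  | tmul l o =>
    obtain ⟨n, c, hc⟩ := IsPurelyInseparable.pow_mem K p l
    refine ⟨n, c • o ^ p ^ n, ?_⟩
    rw [Algebra.TensorProduct.tmul_pow, ← hc, Algebra.algebraMap_eq_smul_one,
      TensorProduct.smul_tmul]
  | add x y hx hy =>
    obtain ⟨n, a, ha⟩ := hx
    obtain ⟨k, b, hb⟩ := hy
    refine ⟨n + k, a ^ p ^ k + b ^ p ^ n, ?_⟩
    rw [add_pow_char_pow, TensorProduct.tmul_add, pow_add, pow_mul, ha, mul_comm, pow_mul, hb,
      Algebra.TensorProduct.tmul_pow, Algebra.TensorProduct.tmul_pow, one_pow, one_pow]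

variable {L}

theorem exists_isUnit_mul_mem_range {O A : Type*} [CommRing O] [Algebra K O] [CommRing A]
    [Algebra K A] [Algebra A O] [IsScalarTower K A O] (M : Submonoid A) [IsLocalization M O]
    (b : L ⊗[K] O) : ∃ m ∈ M, (1 ⊗ₜ algebraMap A O m) * b ∈
      (Algebra.TensorProduct.map (AlgHom.id L L) (IsScalarTower.toAlgHom K A O)).range := by
  induction b with
  | zero => exact ⟨1, M.one_mem, by rw [mul_zero]; exact zero_mem _⟩
  | tmul l o =>
    obtain ⟨⟨a, m⟩, ham⟩ := IsLocalization.surj M o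
    refine ⟨m, m.2, l ⊗ₜ a, ?_⟩
    simp [Algebra.TensorProduct.tmul_mul_tmul, mul_comm _ o, ham]
  | add x y hx hy =>
    obtain ⟨m, hm, hmx⟩ := hx
    obtain ⟨k, hk, hky⟩ := hy
    refine ⟨k * m, M.mul_mem hk hm, ?_⟩
    have h1 (a : A) : (1 ⊗ₜ algebraMap A O a : L ⊗[K] O) ∈
        (Algebra.TensorProduct.map (AlgHom.id L L) (IsScalarTower.toAlgHom K A O)).range :=
      ⟨1 ⊗ₜ a, by simp⟩
    have h2 : (1 ⊗ₜ algebraMap A O (k * m) : L ⊗[K] O) =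
        1 ⊗ₜ algebraMap A O k * 1 ⊗ₜ algebraMap A O m := by
      rw [Algebra.TensorProduct.tmul_mul_tmul, map_mul, one_mul]
    have h3 : (1 ⊗ₜ algebraMap A O (k * m) : L ⊗[K] O) * (x + y) =
        1 ⊗ₜ algebraMap A O k * (1 ⊗ₜ algebraMap A O m * x) +
        1 ⊗ₜ algebraMap A O m * (1 ⊗ₜ algebraMap A O k * y) := by
      rw [h2]; ring
    rw [h3]
    exact add_mem (mul_mem (h1 k) hmx) (mul_mem (h1 m) hky)

variable (L) in
/-- The extension of scalars of a finite map from a polynomial ring is finite. -/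
theorem finite_aeval_one_tmul {A : Type*} [CommRing A] [Algebra K A] (φ : K[X] →ₐ[K] A)
    (hφ : φ.toRingHom.Finite) :
    (aeval (1 ⊗ₜ φ X : L ⊗[K] A) : L[X] →ₐ[L] L ⊗[K] A).toRingHom.Finite := by
  classical
  let ψ : L[X] →ₐ[L] L ⊗[K] A := aeval (1 ⊗ₜ φ X)
  let _ : Algebra K[X] A := φ.toRingHom.toAlgebra
  have : Module.Finite K[X] A := hφ
  obtain ⟨S, hS⟩ := this.fg_top
  let _ : Algebra L[X] (L ⊗[K] A) := ψ.toRingHom.toAlgebra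
  refine Module.Finite.of_fg_top ⟨S.image fun a => 1 ⊗ₜ a, ?_⟩
  have hψ (q : K[X]) : ψ (q.map (algebraMap K L)) = 1 ⊗ₜ φ q := by
    have h1 : (ψ.toRingHom.comp (mapRingHom (algebraMap K L))) =
        (Algebra.TensorProduct.includeRight.toRingHom : A →+* L ⊗[K] A).comp φ.toRingHom := by
      refine Polynomial.ringHom_ext (fun c => ?_) ?_
      · simp only [RingHom.comp_apply, coe_mapRingHom, map_C, AlgHom.toRingHom_eq_coe,
          RingHom.coe_coe]
        rw [← algebraMap_eq, AlgHom.commutes, ← algebraMap_eq, AlgHom.commutes]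
        simp [Algebra.algebraMap_eq_smul_one, Algebra.TensorProduct.one_def]
      · simp [ψ]
    exact congrArg (fun g : K[X] →+* L ⊗[K] A => g q) h1
  rw [eq_top_iff]
  rintro x -
  induction x with
  | zero => exact zero_mem _
  | add x y hx hy => exact add_mem hx hy
  | tmul l a =>
    have ha : a ∈ Submodule.span K[X] (S : Set A) := hS ▸ Submodule.mem_top
    induction ha using Submodule.span_induction with
    | mem a ha =>
      have : l ⊗ₜ a = (C l : L[X]) • (1 ⊗ₜ a : L ⊗[K] A) := by
        rw [Algebra.smul_def]
        change _ = ψ (C l) * _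
        rw [← algebraMap_eq, AlgHom.commutes, ← Algebra.smul_def, TensorProduct.smul_tmul',
          smul_eq_mul, mul_one]
      rw [this]
      exact Submodule.smul_mem _ _ (Submodule.subset_span (by
        rw [Finset.coe_image]; exact ⟨a, ha, rfl⟩))
    | zero => rw [TensorProduct.tmul_zero]; exact zero_mem _
    | add a b _ _ h1 h2 => rw [TensorProduct.tmul_add]; exact add_mem h1 h2
    | smul q a _ h =>
      have : l ⊗ₜ (q • a) = (q.map (algebraMap K L)) • (l ⊗ₜ a : L ⊗[K] A) := by
        rw [Algebra.smul_def, Algebra.smul_def]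
        change _ = ψ _ * _
        rw [hψ, Algebra.TensorProduct.tmul_mul_tmul, one_mul]
        rfl
      rw [this]
      exact Submodule.smul_mem _ _ h

/-- `D` is the image of `L ⊗ A`: it is finite over `L[X]` by base change, and clearing denominators
from `M` moves any tensor into it. -/
theorem exists_isGeometricModel [IsPurelyInseparable K L] {O A : Type*} [CommRing O]
    [Algebra K O] [CommRing A] [IsDomain (L ⊗[K] O)]
    [Algebra K A] [Algebra A O] [IsScalarTower K A O] (M : Submonoid A) [IsLocalization M O]
    (φ : K[X] →ₐ[K] A) (hφ : φ.toRingHom.Finite) (h0 : algebraMap A O (φ X) ≠ 0)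
    (hu : ¬ IsUnit (algebraMap A O (φ X))) :
    letI : Algebra O (L ⊗[K] O) := Algebra.TensorProduct.rightAlgebra
    letI : Algebra L[X] (L ⊗[K] O) :=
      (aeval (1 ⊗ₜ algebraMap A O (φ X)) : L[X] →ₐ[L] L ⊗[K] O).toRingHom.toAlgebra
    ∃ D : Subalgebra L[X] (L ⊗[K] O), IsGeometricModel p (algebraMap A O (φ X)) D := by
  let _ : Algebra O (L ⊗[K] O) := Algebra.TensorProduct.rightAlgebra
  let _ : Algebra L[X] (L ⊗[K] O) :=
    (aeval (1 ⊗ₜ algebraMap A O (φ X)) : L[X] →ₐ[L] L ⊗[K] O).toRingHom.toAlgebra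
  have : CharP L p := charP_of_injective_algebraMap (algebraMap K L).injective p
  have : CharP (L ⊗[K] O) p := charP_of_injective_algebraMap (algebraMap L (L ⊗[K] O)).injective p
  let _ : Algebra L[X] (L ⊗[K] A) :=
    (aeval (1 ⊗ₜ φ X) : L[X] →ₐ[L] L ⊗[K] A).toRingHom.toAlgebra
  have hfin : Module.Finite L[X] (L ⊗[K] A) := finite_aeval_one_tmul L φ hφ
  let g : L ⊗[K] A →ₐ[L] L ⊗[K] O :=
    Algebra.TensorProduct.map (AlgHom.id L L) (IsScalarTower.toAlgHom K A O)
  have hg : g.comp (aeval (1 ⊗ₜ φ X) : L[X] →ₐ[L] L ⊗[K] A) =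
      aeval (1 ⊗ₜ algebraMap A O (φ X)) := by
    ext
    simp [g]
  let G : L ⊗[K] A →ₐ[L[X]] L ⊗[K] O :=
    { g.toRingHom with
      commutes' := fun f => congrArg (fun k : L[X] →ₐ[L] L ⊗[K] O => k f) hg }
  refine ⟨G.range, fun b => exists_pow_eq_one_tmul p L b, ?_, h0, hu, ?_, fun b => ?_⟩
  · exact aeval_X _
  · exact Module.Finite.of_surjective G.rangeRestrict.toLinearMap G.rangeRestrict_surjective
  · obtain ⟨m, hm, hmb⟩ := exists_isUnit_mul_mem_range (L := L) M b
    exact ⟨algebraMap A O m, IsLocalization.map_units O ⟨m, hm⟩, ⟨1 ⊗ₜ m, by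
      change g _ = _
      simp only [g, Algebra.TensorProduct.map_tmul, AlgHom.id_apply, IsScalarTower.coe_toAlgHom']
      rfl⟩, hmb⟩

end Tensor

/-! ### Descent of relations and Frobenius subrings -/

section Tensor

open Polynomial IsDiscreteValuationRing

theorem isDiscreteValuationRing_of_ringEquiv {R R₁ : Type*} [CommRing R] [CommRing R₁] [IsDomain R]
    [IsDomain R₁] [IsDiscreteValuationRing R] (σ : R ≃+* R₁) : IsDiscreteValuationRing R₁ := by
  have : IsPrincipalIdealRing R₁ := IsPrincipalIdealRing.of_surjective σ.toRingHom σ.surjective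
  have : IsLocalRing R₁ := σ.isLocalRing
  obtain ⟨t, ht⟩ := exists_irreducible R
  exact
    { not_a_field' := fun hbot => by
        have hmem : σ t ∈ IsLocalRing.maximalIdeal R₁ := fun hu =>
          ht.not_isUnit ((MulEquiv.isUnit_map σ).1 hu)
        rw [hbot, Ideal.mem_bot] at hmem
        exact ht.ne_zero (σ.injective (hmem.trans (map_zero σ).symm)) }

variable {K : Type*} [Field K] {L : Type*} [Field L] [Algebra K L]

/-- If there were no relation over `O₁`, the map sending `c` to `∑ j(cᵢ) zᵢ` would be injective, and
by flatness it would stay so after tensoring with `L`. -/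
theorem exists_relation_of_tensor_relation {O₁ O : Type*} [CommRing O₁] [Algebra K O₁]
    [CommRing O] [Algebra K O] (j : O₁ →ₐ[K] O) {n : ℕ} (z : Fin n → O) (β : Fin n → L ⊗[K] O₁)
    (hβ : β ≠ 0)
    (h : ∑ i, Algebra.TensorProduct.map (AlgHom.id L L) j (β i) * (1 ⊗ₜ z i) = 0) :
    ∃ c : Fin n → O₁, c ≠ 0 ∧ ∑ i, j (c i) * z i = 0 := by
  by_contra! hno
  let g : (Fin n → O₁) →ₗ[K] O :=
    { toFun := fun c => ∑ i, j (c i) * z i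
      map_add' := fun c d => by simp [add_mul, Finset.sum_add_distrib]
      map_smul' := fun k c => by simp [Finset.smul_sum] }
  have hg : Function.Injective g := by
    rw [← LinearMap.ker_eq_bot, LinearMap.ker_eq_bot']
    intro c hc
    by_contra hc0
    exact hno c hc0 hc
  have hLg := Module.Flat.lTensor_preserves_injective_linearMap (M := L) g hg
  have hformula (w : L ⊗[K] (Fin n → O₁)) : LinearMap.lTensor L g w =
      ∑ i, Algebra.TensorProduct.map (AlgHom.id L L) j
        (TensorProduct.piRight K K L (fun _ : Fin n => O₁) w i) * (1 ⊗ₜ z i) := by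
    induction w with
    | zero => simp
    | add x y hx hy => simp only [map_add, hx, hy, Pi.add_apply, add_mul, Finset.sum_add_distrib]
    | tmul l c => simp [g, TensorProduct.tmul_sum]
  refine hβ ?_
  have h1 : LinearMap.lTensor L g ((TensorProduct.piRight K K L (fun _ : Fin n => O₁)).symm β) =
      0 := by
    rw [hformula, LinearEquiv.apply_symm_apply, h]
  rw [← map_zero (LinearMap.lTensor L g)] at h1
  have h2 := hLg h1
  simpa using h2

/-- Over the perfect field `L` the scalars of `K` become `p`-th powers too, and `p`-th powers form a
subring. -/
theorem exists_eq_pow_of_mem_adjoin {p : ℕ} [hp : Fact p.Prime] [CharP K p] [CharP L p]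
    [PerfectRing L p] {O : Type*} [CommRing O] [Algebra K O] [CharP (L ⊗[K] O) p] {a : O}
    (ha : a ∈ Algebra.adjoin K (Set.range fun o : O => o ^ p)) :
    ∃ e : L ⊗[K] O, 1 ⊗ₜ a = e ^ p := by
  induction ha using Algebra.adjoin_induction with
  | mem x hx =>
    obtain ⟨o, rfl⟩ := hx
    exact ⟨1 ⊗ₜ o, by rw [Algebra.TensorProduct.tmul_pow, one_pow]⟩
  | algebraMap k =>
    obtain ⟨l, hl⟩ : ∃ l : L, l ^ p = algebraMap K L k := (bijective_frobenius L p).2 _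
    refine ⟨l ⊗ₜ 1, ?_⟩
    rw [Algebra.TensorProduct.tmul_pow, hl, one_pow, Algebra.algebraMap_eq_smul_one,
      Algebra.algebraMap_eq_smul_one, TensorProduct.smul_tmul]
  | add x y _ _ hx hy =>
    obtain ⟨d, hd⟩ := hx
    obtain ⟨e, he⟩ := hy
    exact ⟨d + e, by rw [TensorProduct.tmul_add, hd, he, add_pow_char]⟩
  | mul x y _ _ hx hy =>
    obtain ⟨d, hd⟩ := hx
    obtain ⟨e, he⟩ := hy
    exact ⟨d * e, by rw [mul_pow, ← hd, ← he, Algebra.TensorProduct.tmul_mul_tmul, one_mul]⟩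

/-- The properties of the subring of a local ring that comes from the normalized Frobenius
pullback: it contains all `p`-th powers, is saturated and consists of fractions of elements of the
algebra generated by the `p`-th powers. -/
structure IsFrobeniusSubring (p : ℕ) {K O₁ O : Type*} [Field K] [CommRing O₁] [Algebra K O₁]
    [CommRing O] [Algebra K O] (j : O₁ →ₐ[K] O) : Prop where
  injective : Function.Injective j
  exists_eq_pow : ∀ o : O, ∃ c, j c = o ^ p
  saturated : ∀ (c d : O₁) (x : O), c ≠ 0 → j c * x = j d → ∃ e, x = j e
  exists_fraction : ∀ c : O₁, ∃ a ∈ Algebra.adjoin K (Set.range fun o : O => o ^ p),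
    ∃ b ∈ Algebra.adjoin K (Set.range fun o : O => o ^ p), b ≠ 0 ∧ b * j c = a

section

variable {p : ℕ} [hp : Fact p.Prime] [CharP K p] {O₁ O : Type*} [CommRing O₁] [Algebra K O₁]
    [CommRing O] [Algebra K O] {j : O₁ →ₐ[K] O}

theorem IsFrobeniusSubring.map_injective (h : IsFrobeniusSubring p j) :
    Function.Injective (Algebra.TensorProduct.map (AlgHom.id L L) j) :=
  Module.Flat.lTensor_preserves_injective_linearMap (M := L) j.toLinearMap h.injective

theorem IsFrobeniusSubring.exists_map_eq_pow [CharP (L ⊗[K] O) p] (h : IsFrobeniusSubring p j)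
    (b : L ⊗[K] O) : ∃ b₁, Algebra.TensorProduct.map (AlgHom.id L L) j b₁ = b ^ p := by
  induction b with
  | zero => exact ⟨0, by simp [hp.out.ne_zero]⟩
  | tmul l o =>
    obtain ⟨c, hc⟩ := h.exists_eq_pow o
    exact ⟨(l ^ p) ⊗ₜ c, by simp [hc, Algebra.TensorProduct.tmul_pow]⟩
  | add x y hx hy =>
    obtain ⟨a, ha⟩ := hx
    obtain ⟨b, hb⟩ := hy
    exact ⟨a + b, by rw [map_add, ha, hb, add_pow_char]⟩

theorem IsFrobeniusSubring.exists_mul_pow_eq_pow [CharP L p] [PerfectRing L p]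
    [IsDomain (L ⊗[K] O)] [CharP (L ⊗[K] O) p] (h : IsFrobeniusSubring p j) (b₁ : L ⊗[K] O₁) :
    ∃ c d : L ⊗[K] O, d ≠ 0 ∧
      Algebra.TensorProduct.map (AlgHom.id L L) j b₁ * d ^ p = c ^ p := by
  induction b₁ with
  | zero => exact ⟨0, 1, one_ne_zero, by simp [hp.out.ne_zero]⟩
  | tmul l o₁ =>
    obtain ⟨l, rfl⟩ : ∃ l', l' ^ p = l := (bijective_frobenius L p).2 l
    obtain ⟨a, ha, b, hb, hb0, hab⟩ := h.exists_fraction o₁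
    obtain ⟨e, he⟩ := exists_eq_pow_of_mem_adjoin (L := L) ha
    obtain ⟨d, hd⟩ := exists_eq_pow_of_mem_adjoin (L := L) hb
    refine ⟨(l ⊗ₜ 1) * e, d, ?_, ?_⟩
    · rintro rfl
      rw [zero_pow hp.out.ne_zero] at hd
      refine hb0 (Algebra.TensorProduct.includeRight_injective (R := K) (A := L) (B := O)
        (algebraMap K L).injective ?_)
      rw [map_zero]
      exact hd
    · rw [mul_pow, ← he, ← hd, Algebra.TensorProduct.tmul_pow, one_pow,
        Algebra.TensorProduct.map_tmul, AlgHom.id_apply, Algebra.TensorProduct.tmul_mul_tmul,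
        Algebra.TensorProduct.tmul_mul_tmul, ← hab, mul_one, one_mul, mul_comm b]
  | add x y hx hy =>
    obtain ⟨c, d, hd, hcd⟩ := hx
    obtain ⟨c', d', hd', hcd'⟩ := hy
    refine ⟨c * d' + c' * d, d * d', mul_ne_zero hd hd', ?_⟩
    rw [map_add, add_pow_char, mul_pow, mul_pow, mul_pow, ← hcd, ← hcd']
    ring

end

end Tensor

/-! ### Structure of the geometric normalization -/

section GeomNorm

open Polynomial IsDiscreteValuationRing

theorem exists_geomNorm_structure {K : Type u} [Field K] [IsSepClosed K] (p : ℕ)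
    [hp : Fact p.Prime] [CharP K p] (L : Type u) [Field L] [Algebra K L] [IsAlgClosure K L]
    (O : Type u) [CommRing O] [IsDomain O] [IsDiscreteValuationRing O] [Algebra K O]
    [IsDomain (L ⊗[K] O)] {A : Type*} [CommRing A] [Algebra K A] [Algebra A O]
    [IsScalarTower K A O] (M : Submonoid A) [IsLocalization M O]
    (φ : K[X] →ₐ[K] A) (hφ : φ.toRingHom.Finite) (h0 : algebraMap A O (φ X) ≠ 0)
    (hu : ¬ IsUnit (algebraMap A O (φ X))) :
    ∃ (_ : IsDomain (GeomNorm K L O)) (_ : IsDiscreteValuationRing (GeomNorm K L O)),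
      CharP (GeomNorm K L O) p ∧
      (∀ x : GeomNorm K L O, ∃ c : L, x - algebraMap L (GeomNorm K L O) c ∈
        IsLocalRing.maximalIdeal (GeomNorm K L O)) ∧
      (∀ t : GeomNorm K L O, Irreducible t → HasFrobeniusExpansion p t) ∧
      (∃ s : GeomNorm K L O, s ≠ 0 ∧
        ∀ x, s * x ∈ (algebraMap (Geom K L O) (GeomNorm K L O)).range) ∧
      (∀ x ∈ integralClosure (Geom K L O) (FractionRing (Geom K L O)), ∃ (n : ℕ) (b : Geom K L O),
        x ^ p ^ n = algebraMap (Geom K L O) (FractionRing (Geom K L O)) b) ∧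
      ∀ o : O, IsUnit (algebraMap (Geom K L O) (GeomNorm K L O)
        ((1 : L) ⊗ₜ[K] o : L ⊗[K] O)) → IsUnit o := by
  have : Algebra.IsAlgebraic K L := IsAlgClosure.isAlgebraic
  have : IsAlgClosed L := IsAlgClosure.isAlgClosed K
  have : CharP L p := charP_of_injective_algebraMap (algebraMap K L).injective p
  -- This is where `K` being separably closed enters.
  have : IsPurelyInseparable K L := inferInstance
  let _ : Algebra O (L ⊗[K] O) := Algebra.TensorProduct.rightAlgebra
  let _ : Algebra L[X] (L ⊗[K] O) :=
    (aeval (1 ⊗ₜ algebraMap A O (φ X)) : L[X] →ₐ[L] L ⊗[K] O).toRingHom.toAlgebra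
  have : FaithfulSMul O (L ⊗[K] O) := (faithfulSMul_iff_algebraMap_injective _ _).2
    (Algebra.TensorProduct.includeRight_injective (R := K) (A := L) (B := O)
      (algebraMap K L).injective)
  obtain ⟨D, h⟩ := exists_isGeometricModel p (L := L) M φ hφ h0 hu
  let E := FractionRing (L ⊗[K] O)
  have hdvr : IsDiscreteValuationRing (integralClosure (L ⊗[K] O) E) := h.isDiscreteValuationRing E
  have hresid := h.exists_sub_mem_maximalIdeal E
  refine ⟨inferInstanceAs (IsDomain (integralClosure (L ⊗[K] O) E)), hdvr,
    h.charP_integralClosure E, fun x => ?_, fun t ht => h.hasFrobeniusExpansion E ht,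
    h.exists_conductor E, fun x hx => ?_, fun o ho => h.isUnit_of_isUnit_algebraMap E ho⟩
  · obtain ⟨c, hc⟩ := hresid x
    refine ⟨c, ?_⟩
    have hC : algebraMap L[X] (L ⊗[K] O) (C c) = algebraMap L (L ⊗[K] O) c := aeval_C _ _
    rw [hC] at hc
    exact hc
  · obtain ⟨n, o, ho⟩ := (h.mem_integralClosure_iff E x).1 hx
    exact ⟨n, (1 ⊗ₜ[K] o : L ⊗[K] O), ho⟩

end GeomNorm

/-! ### The geometric local ring as `Rᵖ[z]` -/

section Main

open Polynomial IsDiscreteValuationRing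

variable {K : Type u} [Field K] {p : ℕ} [hp : Fact p.Prime] [CharP K p]
variable {L : Type u} [Field L] [Algebra K L]

/-- The map on geometric local rings induced by a map of local rings. -/
noncomputable def geomMap (L : Type u) [Field L] [Algebra K L] {O₁ O : Type u} [CommRing O₁]
    [Algebra K O₁] [CommRing O] [Algebra K O] (j : O₁ →ₐ[K] O) : Geom K L O₁ →ₐ[L] Geom K L O :=
  Algebra.TensorProduct.map (AlgHom.id L L) j

/-- The map from a local ring to its geometric local ring. -/
noncomputable def geomInr (K L : Type u) [Field K] [Field L] [Algebra K L] (O : Type u)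
    [CommRing O] [Algebra K O] : O →+* Geom K L O :=
  (Algebra.TensorProduct.includeRight : O →ₐ[K] L ⊗[K] O).toRingHom

theorem geom_induction {O : Type u} [CommRing O] [Algebra K O] {P : Geom K L O → Prop}
    (zero : P 0) (mul : ∀ l o, P (algebraMap L (Geom K L O) l * geomInr K L O o))
    (add : ∀ x y, P x → P y → P (x + y)) (x : Geom K L O) : P x := by
  refine TensorProduct.induction_on (motive := P) x zero (fun l o => ?_) add
  have h : algebraMap L (L ⊗[K] O) l * (1 ⊗ₜ o) = l ⊗ₜ o := by
    rw [Algebra.TensorProduct.algebraMap_apply, Algebra.TensorProduct.tmul_mul_tmul, mul_one,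
      one_mul, Algebra.algebraMap_self_apply]
  exact (congrArg P h).mp (mul l o)

theorem geomMap_inr {O₁ O : Type u} [CommRing O₁]
    [Algebra K O₁] [CommRing O] [Algebra K O] (j : O₁ →ₐ[K] O) (c : O₁) :
    geomMap L j (geomInr K L O₁ c) = geomInr K L O (j c) :=
  Algebra.TensorProduct.map_tmul _ _ _ _

/-- If the differential degree of the Frobenius subring is `1`, its geometric local ring is
normal; hence the geometric local ring of `O` contains all `p`-th powers of its normalization. -/
theorem exists_geomMap_eq_pow [CharP L p] [PerfectRing L p] {O₁ O : Type u} [CommRing O₁]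
    [Algebra K O₁] [CommRing O] [Algebra K O] [IsDomain (Geom K L O)] {j : O₁ →ₐ[K] O}
    (hj : IsFrobeniusSubring p j)
    [IsDomain (GeomNorm K L O)] [IsDiscreteValuationRing (GeomNorm K L O)]
    [CharP (GeomNorm K L O) p]
    (hres : ∀ x : GeomNorm K L O, ∃ c : L, x - algebraMap L (GeomNorm K L O) c ∈
        IsLocalRing.maximalIdeal (GeomNorm K L O))
    (hexp : ∀ t : GeomNorm K L O, Irreducible t → HasFrobeniusExpansion p t)
    {s : GeomNorm K L O} (hs0 : s ≠ 0)
    (hs : ∀ x, s * x ∈ (algebraMap (Geom K L O) (GeomNorm K L O)).range)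
    (hint : ∀ x ∈ integralClosure (Geom K L O) (FractionRing (Geom K L O)),
      ∃ (n : ℕ) (b : Geom K L O),
        x ^ p ^ n = algebraMap (Geom K L O) (FractionRing (Geom K L O)) b)
    (hd : differentialDegree K L O₁ = 1) :
    (∀ b₁, ∃ x, algebraMap (Geom K L O) (GeomNorm K L O) (geomMap L j b₁) = x ^ p) ∧
      ∀ x, ∃ b₁, algebraMap (Geom K L O) (GeomNorm K L O) (geomMap L j b₁) = x ^ p := by
  have hcharB : CharP (Geom K L O) p :=
    charP_of_injective_algebraMap (algebraMap L (Geom K L O)).injective p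
  have hη : Function.Injective (geomMap L j) := hj.map_injective
  have hpow : ∀ b : Geom K L O, ∃ b₁, geomMap L j b₁ = b ^ p := by
    have : CharP (L ⊗[K] O) p := hcharB
    exact hj.exists_map_eq_pow
  have hroot : ∀ b₁, ∃ c d : Geom K L O, d ≠ 0 ∧ geomMap L j b₁ * d ^ p = c ^ p := by
    have : CharP (L ⊗[K] O) p := hcharB
    have : IsDomain (L ⊗[K] O) := ‹IsDomain (Geom K L O)›
    exact hj.exists_mul_pow_eq_pow
  have hdom₁ : IsDomain (Geom K L O₁) := hη.isDomain (geomMap L j).toRingHom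
  obtain ⟨θ, hθ, hθη, hθ₁, hθ₂⟩ := exists_integralClosure_hom_of_frobenius (p := p)
    (E₁ := FractionRing (Geom K L O₁)) (E := FractionRing (Geom K L O))
    (geomMap L j).toRingHom hη hpow hroot hint
  have hdomR₁ : IsDomain (GeomNorm K L O₁) := inferInstanceAs
    (IsDomain (integralClosure (Geom K L O₁) (FractionRing (Geom K L O₁))))
  -- Frobenius identifies `R` with the normalization of `L ⊗ O₁`. Uniformizer, expansions, residues
  -- and conductor are carried over by `σ`, which is only `p`-semilinear over `L`.
  obtain ⟨σ, hσ⟩ : ∃ σ : GeomNorm K L O ≃+* GeomNorm K L O₁, ∀ x, θ (σ x) = x ^ p :=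
    exists_ringEquiv_of_frobenius (R₁ := GeomNorm K L O₁) (R := GeomNorm K L O) θ hθ hθ₁ hθ₂
  have hdvr₁ : IsDiscreteValuationRing (GeomNorm K L O₁) := isDiscreteValuationRing_of_ringEquiv σ
  have hchar₁ : CharP (GeomNorm K L O₁) p :=
    charP_of_injective_algebraMap (algebraMap L (GeomNorm K L O₁)).injective p
  obtain ⟨t, ht⟩ := exists_irreducible (GeomNorm K L O)
  have hσB (b : Geom K L O) (b₁ : Geom K L O₁) (hb : geomMap L j b₁ = b ^ p) :
      σ (algebraMap _ _ b) = algebraMap (Geom K L O₁) (GeomNorm K L O₁) b₁ := by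
    apply hθ
    refine (hσ _).trans ?_
    refine Eq.trans ?_ (hθη b₁).symm
    change _ = algebraMap (Geom K L O) (GeomNorm K L O) (geomMap L j b₁)
    rw [hb, map_pow]
  have hσL (c : L) : σ (algebraMap L _ c) = algebraMap L (GeomNorm K L O₁) (c ^ p) := by
    rw [IsScalarTower.algebraMap_apply L (Geom K L O) (GeomNorm K L O),
      IsScalarTower.algebraMap_apply L (Geom K L O₁) (GeomNorm K L O₁)]
    exact hσB _ _ (by rw [AlgHom.commutes, map_pow])
  have hres₁ : ∀ x₁ : GeomNorm K L O₁, ∃ c : L, x₁ - algebraMap L (GeomNorm K L O₁) c ∈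
      IsLocalRing.maximalIdeal (GeomNorm K L O₁) := by
    intro x₁
    obtain ⟨c, hc⟩ := hres (σ.symm x₁)
    refine ⟨c ^ p, fun hu => hc ?_⟩
    rw [← hσL] at hu
    have h1 : x₁ - σ (algebraMap L _ c) = σ (σ.symm x₁ - algebraMap L _ c) := by simp
    rw [h1] at hu
    exact (MulEquiv.isUnit_map σ).1 hu
  have hd' : Module.finrank L (DiffCoker K L O₁) = 0 := by
    rw [differentialDegree] at hd
    omega
  have hsurj : Function.Surjective (algebraMap (Geom K L O₁) (GeomNorm K L O₁)) := by
    refine algebraMap_surjective_of_finrank_kaehlerCoker_eq_zero (p := p) (L := L) hres₁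
      (t := σ t) ((MulEquiv.irreducible_iff σ).2 ht) ((hexp t ht).map σ)
      (s := σ s) ((map_ne_zero_iff σ σ.injective).2 hs0) (fun x₁ => ?_) hd'
    obtain ⟨b, hb⟩ := hs (σ.symm x₁)
    obtain ⟨b₁, hb₁⟩ := hpow b
    refine ⟨b₁, ?_⟩
    rw [← hσB b b₁ hb₁, hb, map_mul, RingEquiv.apply_symm_apply]
  refine ⟨fun b₁ => ?_, fun x => ?_⟩
  · obtain ⟨x, hx⟩ := hθ₁ (algebraMap _ _ b₁)
    exact ⟨x, (hθη b₁).symm.trans hx⟩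
  · obtain ⟨b₁, hb₁⟩ := hsurj (σ x)
    refine ⟨b₁, ?_⟩
    rw [← hσ x, ← hb₁]
    exact (hθη b₁).symm

/-- `R` is spanned over `L ⊗ O₁` by the `p` powers of `t`, so `p + 1` elements of `O` are dependent
over `L ⊗ O₁`, and the relation descends to `O₁`. -/
theorem exists_relation_of_pow {O₁ O : Type u} [CommRing O₁] [CharP L p]
    [Algebra K O₁] [CommRing O] [Algebra K O] [IsDomain (Geom K L O)] {j : O₁ →ₐ[K] O}
    (hj : IsFrobeniusSubring p j)
    {t : GeomNorm K L O} (hexp : HasFrobeniusExpansion p t)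
    (hpow : ∀ x, ∃ b₁, algebraMap (Geom K L O) (GeomNorm K L O) (geomMap L j b₁) = x ^ p)
    (z : Fin (p + 1) → O) : ∃ c : Fin (p + 1) → O₁, c ≠ 0 ∧ ∑ i, j (c i) * z i = 0 := by
  classical
  have hη : Function.Injective (geomMap L j) := hj.map_injective
  have hdom₁ : IsDomain (Geom K L O₁) := hη.isDomain (geomMap L j).toRingHom
  have hinj : Function.Injective (algebraMap (Geom K L O) (GeomNorm K L O)) :=
    FaithfulSMul.algebraMap_injective (Geom K L O)
      (integralClosure (Geom K L O) (FractionRing (Geom K L O)))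
  let _ : Algebra (Geom K L O₁) (GeomNorm K L O) :=
    ((algebraMap (Geom K L O) (GeomNorm K L O)).comp (geomMap L j).toRingHom).toAlgebra
  have hmap (b : Geom K L O₁) : algebraMap (Geom K L O₁) (GeomNorm K L O) b =
    algebraMap (Geom K L O) (GeomNorm K L O) (geomMap L j b) := rfl
  have hspan : Submodule.span (Geom K L O₁)
      (((Finset.range p).image fun i => t ^ i : Finset (GeomNorm K L O)) :
        Set (GeomNorm K L O)) = ⊤ := by
    rw [eq_top_iff]
    rintro x -
    obtain ⟨a, rfl⟩ := hexp x
    refine sum_mem fun i hi => ?_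
    obtain ⟨b₁, hb₁⟩ := hpow (a i)
    rw [← hb₁, ← hmap, ← Algebra.smul_def]
    exact Submodule.smul_mem _ _ (Submodule.subset_span (Finset.mem_image_of_mem _ hi))
  have hdep : ¬ LinearIndependent (Geom K L O₁)
      (fun i => algebraMap (Geom K L O) (GeomNorm K L O) (geomInr K L O (z i))) := by
    intro hli
    have h1 := linearIndependent_le_span_finset _ hli _ hspan
    rw [Cardinal.mk_fin] at h1
    have h2 : p + 1 ≤ ((Finset.range p).image fun i => t ^ i).card := by exact_mod_cast h1
    have h3 := (Finset.card_image_le (s := Finset.range p) (f := fun i => t ^ i))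
    rw [Finset.card_range] at h3
    omega
  rw [Fintype.linearIndependent_iff] at hdep
  push Not at hdep
  obtain ⟨β, hβ, i, hi⟩ := hdep
  have hsum : ∑ i, geomMap L j (β i) * geomInr K L O (z i) = 0 := by
    apply hinj
    rw [map_zero, ← hβ, map_sum]
    refine Finset.sum_congr rfl fun i _ => ?_
    rw [Algebra.smul_def, hmap, ← map_mul]
  exact exists_relation_of_tensor_relation (L := L) j z β (fun h0 => hi (congrFun h0 i)) hsum

/-- Otherwise every element of `L ⊗ O` would be a `p`-th power of `R` modulo any power of `π`, and
all its finite values would be divisible by `p`. But `s` and `s t` lie in it and have consecutive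
values. -/
theorem exists_ne_add_pow_mul {O₁ O : Type u} [CommRing O₁] [CharP L p] [PerfectRing L p]
    [Algebra K O₁] [CommRing O] [Algebra K O] {j : O₁ →ₐ[K] O}
    [IsDomain (GeomNorm K L O)] [IsDiscreteValuationRing (GeomNorm K L O)]
    [CharP (GeomNorm K L O) p]
    {s : GeomNorm K L O} (hs0 : s ≠ 0)
    (hs : ∀ x, s * x ∈ (algebraMap (Geom K L O) (GeomNorm K L O)).range)
    (hunit : ∀ o : O, IsUnit (algebraMap (Geom K L O) (GeomNorm K L O) (geomInr K L O o)) →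
      IsUnit o)
    (hroot : ∀ b₁, ∃ x, algebraMap (Geom K L O) (GeomNorm K L O) (geomMap L j b₁) = x ^ p)
    (c : O₁) (hc : ¬ IsUnit (j c)) : ∃ (N : ℕ) (o : O), ∀ d q, o ≠ j d + j c ^ N * q := by
  by_contra! hno
  set π : (GeomNorm K L O) := algebraMap (Geom K L O) (GeomNorm K L O) (geomInr K L O (j c))
  have hπ : 1 ≤ addVal (GeomNorm K L O) π := one_le_addVal_iff.2 fun hu => hc (hunit _ hu)
  have hdecomp (N : ℕ) (b : Geom K L O) : ∃ x r : GeomNorm K L O,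
      algebraMap (Geom K L O) (GeomNorm K L O) b = x ^ p + π ^ N * r := by
    induction b using geom_induction with
    | zero => exact ⟨0, 0, by simp [hp.out.ne_zero]⟩
    | mul l o =>
      obtain ⟨l, rfl⟩ : ∃ l', l' ^ p = l := (bijective_frobenius L p).2 l
      obtain ⟨d, q, rfl⟩ := hno N o
      obtain ⟨x, hx⟩ := hroot (geomInr K L O₁ d)
      rw [geomMap_inr] at hx
      refine ⟨algebraMap (Geom K L O) (GeomNorm K L O) (algebraMap L (Geom K L O) l) * x,
        algebraMap (Geom K L O) (GeomNorm K L O) (algebraMap L (Geom K L O) l) ^ p *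
          algebraMap (Geom K L O) (GeomNorm K L O) (geomInr K L O q), ?_⟩
      simp only [map_mul, map_add, map_pow, hx, mul_pow, π]
      ring
    | add x y hx hy =>
      obtain ⟨x, r, hx⟩ := hx
      obtain ⟨y, q, hy⟩ := hy
      exact ⟨x + y, r + q, by rw [map_add, hx, hy, add_pow_char]; ring⟩
  obtain ⟨t, ht⟩ := exists_irreducible (GeomNorm K L O)
  have hdiv (b : Geom K L O) (n : ℕ)
      (hn : addVal (GeomNorm K L O) (algebraMap (Geom K L O) (GeomNorm K L O) b) = n) : p ∣ n := by
    -- Since `π` has positive value, `π ^ (n + 1) r` has value greater than `n`, so `b` and `x ^ p`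
    -- have the same value.
    obtain ⟨x, r, hx⟩ := hdecomp (n + 1) b
    have hlt : addVal (GeomNorm K L O) (algebraMap (Geom K L O) (GeomNorm K L O) b) <
        addVal (GeomNorm K L O) (π ^ (n + 1) * r) := by
      rw [hn, natCast_lt_addVal_iff, addVal_mul, addVal_pow]
      refine le_trans ?_ le_self_add
      calc ((n + 1 : ℕ) : ℕ∞) = (n + 1) • (1 : ℕ∞) := by simp
        _ ≤ (n + 1) • addVal (GeomNorm K L O) π := by gcongr
    have hxp : addVal (GeomNorm K L O) (x ^ p) = n := by
      rw [← hn, ← AddValuation.map_sub_eq_of_lt_left _ hlt, hx, add_sub_cancel_right]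
    rw [addVal_pow] at hxp
    have hx0 : addVal (GeomNorm K L O) x ≠ ⊤ := by
      intro h
      rw [h, nsmul_eq_mul, ENat.mul_top (by exact_mod_cast hp.out.ne_zero)] at hxp
      exact ENat.natCast_ne_top n hxp.symm
    obtain ⟨k, hk⟩ := ENat.ne_top_iff_exists.1 hx0
    rw [← hk, nsmul_eq_mul] at hxp
    exact ⟨k, by exact_mod_cast hxp.symm⟩
  obtain ⟨n, hn⟩ := ENat.ne_top_iff_exists.1 (addVal_eq_top_iff.not.2 hs0)
  obtain ⟨b₁, hb₁⟩ := hs 1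
  obtain ⟨b₂, hb₂⟩ := hs t
  have h1 := hdiv b₁ n (by rw [hb₁, mul_one, hn])
  have h2 := hdiv b₂ (n + 1) (by rw [hb₂, addVal_mul, addVal_uniformizer ht, ← hn]; norm_cast)
  exact hp.out.one_lt.ne' (Nat.dvd_one.1 ((Nat.dvd_add_right h1).1 h2))

/-- Scalars of `L` and elements of `O₁` are `p`-th powers in `R`, and `z` generates `O` over `O₁`;
conversely all `p`-th powers of `R` come from `L ⊗ O₁`. -/
theorem range_algebraMap_eq_frobEval_range {O₁ O : Type u} [CommRing O₁] [CharP L p]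
    [PerfectRing L p] [Algebra K O₁] [CommRing O] [Algebra K O] {j : O₁ →ₐ[K] O}
    [CharP (GeomNorm K L O) p]
    (hpow : ∀ x, ∃ b₁, algebraMap (Geom K L O) (GeomNorm K L O) (geomMap L j b₁) = x ^ p)
    (hroot : ∀ b₁, ∃ x, algebraMap (Geom K L O) (GeomNorm K L O) (geomMap L j b₁) = x ^ p)
    {z : O} (hz : ∀ o : O, ∃ c : Fin p → O₁, o = ∑ i, j (c i) * z ^ (i : ℕ)) :
    (algebraMap (Geom K L O) (GeomNorm K L O)).range =
      (frobEval p (algebraMap (Geom K L O) (GeomNorm K L O) (geomInr K L O z))).range := by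
  set ζ := algebraMap (Geom K L O) (GeomNorm K L O) (geomInr K L O z)
  have hC (x : GeomNorm K L O) : x ^ p ∈ (frobEval p ζ).range := ⟨C x, frobEval_C _ _ _⟩
  have hX : ζ ∈ (frobEval p ζ).range := ⟨X, frobEval_X _ _⟩
  have hζ : ζ ∈ (algebraMap (Geom K L O) (GeomNorm K L O)).range := ⟨_, rfl⟩
  apply le_antisymm
  · rintro _ ⟨b, rfl⟩
    induction b using geom_induction with
    | zero => rw [map_zero]; exact zero_mem _
    | add x y hx hy => rw [map_add]; exact add_mem hx hy
    | mul l o =>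
      obtain ⟨l, rfl⟩ : ∃ l', l' ^ p = l := (bijective_frobenius L p).2 l
      obtain ⟨c, rfl⟩ := hz o
      simp only [map_mul, map_sum, map_pow]
      refine mul_mem (hC _) (sum_mem fun i _ => mul_mem ?_ (pow_mem hX _))
      obtain ⟨x, hx⟩ := hroot (geomInr K L O₁ (c i))
      rw [geomMap_inr] at hx
      rw [hx]
      exact hC x
  · rintro _ ⟨f, rfl⟩
    induction f using Polynomial.induction_on' with
    | add f g hf hg => rw [map_add]; exact add_mem hf hg
    | monomial n a =>
      rw [← C_mul_X_pow_eq_monomial, map_mul, map_pow, frobEval_C, frobEval_X]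
      obtain ⟨b₁, hb₁⟩ := hpow a
      have ha : a ^ p ∈ (algebraMap (Geom K L O) (GeomNorm K L O)).range := ⟨_, hb₁⟩
      exact mul_mem ha (pow_mem hζ n)

/-- The main theorem for an abstract local ring together with its Frobenius subring. -/
theorem invariants_of_isFrobeniusSubring [IsSepClosed K] [IsAlgClosure K L]
    {O₁ O : Type u} [CommRing O₁] [Algebra K O₁]
    [CommRing O] [IsDomain O] [IsDiscreteValuationRing O] [Algebra K O]
    [IsDomain (L ⊗[K] O)] {A : Type*} [CommRing A] [Algebra K A] [Algebra A O]
    [IsScalarTower K A O] (M : Submonoid A) [IsLocalization M O]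
    (φ : K[X] →ₐ[K] A) (hφ : φ.toRingHom.Finite) (h0 : algebraMap A O (φ X) ≠ 0)
    (hu : ¬ IsUnit (algebraMap A O (φ X))) {j : O₁ →ₐ[K] O} (hj : IsFrobeniusSubring p j)
    (hd : differentialDegree K L O₁ = 1) :
    ∃ (_ : IsDomain (GeomNorm K L O)) (_ : IsDiscreteValuationRing (GeomNorm K L O)),
      Module.Finite L (DiffCoker K L O) ∧
      semigroup K L O = {l : ℤ | ∃ a b : ℕ, l = differentialDegree K L O * a + p * b} ∧
      Module.Finite L (DeltaQuotient K L O) ∧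
      (deltaInvariant K L O : ℚ) =
        ((differentialDegree K L O : ℚ) - 1) * ((p : ℚ) - 1) / 2 := by
  have : Algebra.IsAlgebraic K L := IsAlgClosure.isAlgebraic
  have : IsAlgClosed L := IsAlgClosure.isAlgClosed K
  have : CharP L p := charP_of_injective_algebraMap (algebraMap K L).injective p
  have : CharP O p := charP_of_injective_algebraMap (algebraMap K O).injective p
  have : IsDomain (Geom K L O) := ‹IsDomain (L ⊗[K] O)›
  have : IsDomain O₁ := hj.injective.isDomain j.toRingHom
  obtain ⟨hdom, hdvr, hchar, hres, hexp, ⟨s, hs0, hs⟩, hint, hunit⟩ :=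
    exists_geomNorm_structure p L O M φ hφ h0 hu
  obtain ⟨hroot, hpow⟩ := exists_geomMap_eq_pow hj hres hexp hs0 hs hint hd
  obtain ⟨t, ht⟩ := exists_irreducible (GeomNorm K L O)
  obtain ⟨z, hz⟩ := exists_generator (p := p) j.toRingHom hj.injective hj.exists_eq_pow hj.saturated
    (exists_relation_of_pow hj (hexp t ht) hpow) (exists_ne_add_pow_mul hs0 hs hunit hroot)
  obtain ⟨m, hm0, ⟨hfin, hm⟩, hsemi, hfin', hδ⟩ :=
    exists_invariants_of_range_eq_frobEval_range (p := p) hres ht (hexp t ht) hs0 hs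
      (range_algebraMap_eq_frobEval_range (j := j) hpow hroot hz)
  have hdm : differentialDegree K L O = m := hm
  refine ⟨hdom, hdvr, hfin, ?_, hfin', ?_⟩
  · rw [hdm]
    ext l
    constructor
    · rintro ⟨x, n, hx, rfl⟩
      obtain ⟨a, b, hab⟩ := (hsemi n).1 ⟨x, hx⟩
      exact ⟨a, b, by rw [hab]; push_cast; ring⟩
    · rintro ⟨a, b, rfl⟩
      obtain ⟨x, hx⟩ := (hsemi (m * a + p * b)).2 ⟨a, b, rfl⟩
      exact ⟨x, m * a + p * b, hx, by push_cast; ring⟩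
  · rw [hdm]
    have h2 : 2 * deltaInvariant K L O = (m - 1) * (p - 1) := hδ
    have h3 : (2 : ℚ) * deltaInvariant K L O = ((m : ℚ) - 1) * ((p : ℚ) - 1) := by
      have := congrArg (Nat.cast : ℕ → ℚ) h2
      push_cast [Nat.cast_sub hm0, Nat.cast_sub hp.out.one_le] at this
      exact_mod_cast this
    linarith

end Main

/-! ### Noether normalization with the variable in a given prime -/

section NoetherNormalization

open Polynomial

theorem finite_aeval_of_natDegree_ne_zero {K : Type*} [Field K] {q : K[X]} (hq : q.natDegree ≠ 0) :
    (aeval q : K[X] →ₐ[K] K[X]).toRingHom.Finite := by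
  set g : K[X] →+* K[X] := (aeval q : K[X] →ₐ[K] K[X]).toRingHom
  have hgC (k : K) : g (C k) = C k := aeval_C _ _
  have hgX : g X = q := aeval_X _
  have hq0 : q ≠ 0 := by
    rintro rfl
    exact hq natDegree_zero
  have hX : g.IsIntegralElem X := by
    -- In a new variable `T` this is `q(T) - q(X)` divided by the leading coefficient of `q`, a
    -- monic equation for `X` over `K[q]`.
    refine ⟨(q * C q.leadingCoeff⁻¹).map C - C (C q.leadingCoeff⁻¹ * X), ?_, ?_⟩
    · refine (monic_mul_leadingCoeff_inv hq0).map C |>.sub_of_left ?_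
      refine degree_C_le.trans_lt ?_
      rw [degree_map, degree_mul_leadingCoeff_inv _ hq0]
      exact natDegree_pos_iff_degree_pos.1 (Nat.pos_of_ne_zero hq)
    · rw [eval₂_sub, eval₂_C, eval₂_map]
      have h1 : g.comp C = C := RingHom.ext hgC
      rw [h1, map_mul, hgC, hgX, eval₂_mul, eval₂_C, eval₂_C_X, mul_comm, sub_self]
  have hint : g.IsIntegral := by
    intro f
    induction f using Polynomial.induction_on' with
    | add f₁ f₂ h₁ h₂ => exact h₁.add g h₂
    | monomial n k =>
      rw [← C_mul_X_pow_eq_monomial, ← hgC]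
      refine RingHom.IsIntegralElem.mul g (g.isIntegralElem_map) ?_
      induction n with
      | zero => rw [pow_zero]; exact g.isIntegralElem_one
      | succ n ih => rw [pow_succ]; exact ih.mul g hX
  refine hint.to_finite ?_
  have h1 : (g.comp C).FiniteType := by
    rw [show g.comp C = C from RingHom.ext hgC]
    exact (RingHom.finiteType_algebraMap (A := K) (B := K[X])).2 inferInstance
  exact h1.of_comp_finiteType

/-- A nonzero prime contracts to a nonzero prime of `K[X]` by integrality. Any nonzero `q` in it is
nonconstant, and `X ↦ q` is a finite endomorphism of `K[X]`. -/
theorem exists_finite_polynomial_algHom_of_finite {K A : Type*} [Field K] [CommRing A] [IsDomain A]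
    [Algebra K A] (g : K[X] →ₐ[K] A) (hg : Function.Injective g) (hfin : g.toRingHom.Finite)
    (P : Ideal A) [hP : P.IsPrime] (hP0 : P ≠ ⊥) :
    ∃ φ : K[X] →ₐ[K] A, φ.toRingHom.Finite ∧ φ X ≠ 0 ∧ φ X ∈ P := by
  let _ : Algebra K[X] A := g.toRingHom.toAlgebra
  have hint : Algebra.IsIntegral K[X] A := ⟨hfin.to_isIntegral⟩
  have hne : P.comap (algebraMap K[X] A) ≠ ⊥ := fun h => hP0 (Ideal.eq_bot_of_comap_eq_bot h)
  obtain ⟨q, hq, hq0⟩ := Submodule.exists_mem_ne_zero_of_ne_bot hne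
  have hdeg : q.natDegree ≠ 0 := by
    intro h
    obtain ⟨k, rfl⟩ := natDegree_eq_zero.1 h
    have hk : k ≠ 0 := by
      rintro rfl
      exact hq0 (map_zero _)
    exact (hP.comap (algebraMap K[X] A)).ne_top
      (Ideal.eq_top_of_isUnit_mem _ hq ((isUnit_iff_ne_zero.2 hk).map C))
  have hX : g.comp (aeval q) X = g q := by rw [AlgHom.comp_apply, aeval_X]
  refine ⟨g.comp (aeval q), ?_, ?_, ?_⟩
  · exact RingHom.Finite.comp hfin (finite_aeval_of_natDegree_ne_zero hdeg)
  · rw [hX]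
    exact (map_ne_zero_iff g hg).2 hq0
  · rw [hX]
    exact hq

/-- A one-dimensional finitely generated domain is finite over a polynomial ring whose variable
lies in a given nonzero prime. -/
theorem exists_finite_polynomial_algHom {K A : Type*} [Field K] [CommRing A] [IsDomain A]
    [Algebra K A] [Algebra.FiniteType K A] [Ring.DimensionLEOne A] (P : Ideal A) [hP : P.IsPrime]
    (hP0 : P ≠ ⊥) :
    ∃ φ : K[X] →ₐ[K] A, φ.toRingHom.Finite ∧ φ X ≠ 0 ∧ φ X ∈ P := by
  obtain ⟨s, g, hg, hfin⟩ := exists_finite_inj_algHom_of_fg K A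
  let _ : Algebra (MvPolynomial (Fin s) K) A := g.toRingHom.toAlgebra
  have hint : Algebra.IsIntegral (MvPolynomial (Fin s) K) A := ⟨hfin.to_isIntegral⟩
  have : FaithfulSMul (MvPolynomial (Fin s) K) A :=
    (faithfulSMul_iff_algebraMap_injective _ _).2 hg
  have hne : P.comap (algebraMap (MvPolynomial (Fin s) K) A) ≠ ⊥ :=
    fun h => hP0 (Ideal.eq_bot_of_comap_eq_bot h)
  -- A nonzero prime of the polynomial ring lies under a nonzero, hence maximal, prime of `A`, so it
  -- is maximal by integrality. This bounds the number of variables by one.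
  have hdim : Ring.KrullDimLE 1 (MvPolynomial (Fin s) K) := by
    refine Ring.krullDimLE_one_iff_of_isPrime_bot.2 fun Q hQ hQ' => ?_
    obtain ⟨I, hI, rfl⟩ := Ideal.exists_ideal_over_prime_of_isIntegral_of_isDomain (S := A) Q
      (((RingHom.injective_iff_ker_eq_bot (algebraMap (MvPolynomial (Fin s) K) A)).1 hg).trans_le
        bot_le)
    have hI0 : I ≠ ⊥ := by
      rintro rfl
      exact hQ (Ideal.comap_bot_of_injective _ (FaithfulSMul.algebraMap_injective _ A))
    have := Ring.DimensionLEOne.maximalOfPrime hI0 hI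
    exact Ideal.isMaximal_comap_of_isIntegral_of_isMaximal I
  have hs : s ≤ 1 := by
    rw [Ring.krullDimLE_iff, MvPolynomial.ringKrullDim_of_isNoetherianRing,
      ringKrullDim_eq_zero_of_field, zero_add, Nat.card_fin] at hdim
    exact_mod_cast hdim
  obtain rfl | rfl : s = 0 ∨ s = 1 := by omega
  · exfalso
    obtain ⟨x, hx, hx0⟩ := Submodule.exists_mem_ne_zero_of_ne_bot hne
    obtain ⟨k, rfl⟩ := MvPolynomial.C_surjective (Fin 0) x
    have hk : k ≠ 0 := by
      rintro rfl
      exact hx0 (map_zero _)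
    exact (hP.comap (algebraMap (MvPolynomial (Fin 0) K) A)).ne_top
      (Ideal.eq_top_of_isUnit_mem _ hx ((isUnit_iff_ne_zero.2 hk).map _))
  · let e : K[X] ≃ₐ[K] MvPolynomial (Fin 1) K := (MvPolynomial.uniqueAlgEquiv K (Fin 1)).symm
    have he : e.toRingEquiv.toRingHom.Finite := RingHom.Finite.of_surjective _ e.surjective
    exact exists_finite_polynomial_algHom_of_finite (g.comp e.toAlgHom) (hg.comp e.injective)
      (RingHom.Finite.comp hfin he) P hP0

theorem isDomain_tensorProduct_of_isLocalization {K L A O : Type*} [Field K] [Field L] [Algebra K L]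
    [CommRing A] [Algebra K A] [CommRing O] [Algebra K O] [Algebra A O] [IsScalarTower K A O]
    (M : Submonoid A) [IsLocalization M O] [Nontrivial O] (hM : M ≤ nonZeroDivisors A)
    [IsDomain (L ⊗[K] A)] : IsDomain (L ⊗[K] O) := by
  set g := Algebra.TensorProduct.map (AlgHom.id L L) (IsScalarTower.toAlgHom K A O)
  have hg : Function.Injective g :=
    Module.Flat.lTensor_preserves_injective_linearMap (M := L)
      (IsScalarTower.toAlgHom K A O).toLinearMap (IsLocalization.injective O hM)
  have hunit (m : A) (hm : m ∈ M) : IsUnit ((1 : L) ⊗ₜ[K] algebraMap A O m) :=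
    (IsLocalization.map_units O ⟨m, hm⟩).map
      (Algebra.TensorProduct.includeRight : O →ₐ[K] L ⊗[K] O)
  have : Nontrivial (L ⊗[K] O) := hg.nontrivial
  have : NoZeroDivisors (L ⊗[K] O) := by
    constructor
    intro x y hxy
    obtain ⟨m, hm, a, ha⟩ := exists_isUnit_mul_mem_range (L := L) M x
    obtain ⟨n, hn, b, hb⟩ := exists_isUnit_mul_mem_range (L := L) M y
    have hab : a * b = 0 := by
      apply hg
      rw [map_mul, map_zero]
      refine (congrArg₂ (· * ·) ha hb).trans ?_
      rw [mul_mul_mul_comm, hxy, mul_zero]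
    rcases mul_eq_zero.1 hab with rfl | rfl
    · left
      refine (hunit m hm).mul_left_cancel ?_
      rw [mul_zero, ← ha]
      exact map_zero g
    · right
      refine (hunit n hn).mul_left_cancel ?_
      rw [mul_zero, ← hb]
      exact map_zero g
  exact NoZeroDivisors.to_isDomain _

end NoetherNormalization

/-! ### The Frobenius subring, algebraically -/

section FrobeniusPair

variable {K A G : Type*} [Field K] {p : ℕ} [hp : Fact p.Prime] [CharP K p] [CommRing A]
    [Algebra K A] [CommRing G] [Algebra K G] {α : A →+* G} {β : G →ₐ[K] A}

/-- Both sides are ring homomorphisms in `g`, so it suffices to compare them on `K` and on the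
generators `α a`. -/
theorem map_map_eq_pow [Nontrivial G] (hα : ∀ k, α (algebraMap K A k) = algebraMap K G (k ^ p))
    (hβα : ∀ a, β (α a) = a ^ p) (hG : Algebra.adjoin K (Set.range α) = ⊤) (g : G) :
    α (β g) = g ^ p := by
  have : CharP G p := charP_of_injective_algebraMap (algebraMap K G).injective p
  have hg : g ∈ Algebra.adjoin K (Set.range α) := hG ▸ Algebra.mem_top
  induction hg using Algebra.adjoin_induction with
  | mem x hx =>
    obtain ⟨a, rfl⟩ := hx
    rw [hβα, map_pow]
  | algebraMap k => rw [β.commutes, hα, map_pow]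
  | add x y _ _ hx hy => rw [map_add, map_add, hx, hy, add_pow_char]
  | mul x y _ _ hx hy => rw [map_mul, map_mul, hx, hy, mul_pow]

/-- The Frobenius subring of a normal local ring, obtained from the normalization of the Frobenius
twist. -/
theorem exists_isFrobeniusSubring [IsDomain A] [IsDomain G]
    (hα : ∀ k, α (algebraMap K A k) = algebraMap K G (k ^ p))
    (hβα : ∀ a, β (α a) = a ^ p) (hG : Algebra.adjoin K (Set.range α) = ⊤)
    {O : Type*} [CommRing O] [IsDomain O] [IsIntegrallyClosed O] [Algebra K O] [Algebra A O]
    [IsScalarTower K A O] (P : Ideal A) [P.IsPrime] [IsLocalization.AtPrime O P]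
    {κ : Type*} [CommRing κ] [Algebra G κ] [IsFractionRing G κ]
    {N : Type*} [CommRing N] [Algebra G N] [Algebra N κ] [IsScalarTower G N κ]
    [IsIntegralClosure N G κ] (Q : Ideal N) [hQ : Q.IsPrime]
    (hPQ : ∀ g, algebraMap G N g ∈ Q ↔ β g ∈ P)
    {O₁ : Type*} [CommRing O₁] [Algebra K O₁] [Algebra N O₁] [IsLocalization.AtPrime O₁ Q]
    (hK : ∀ k, algebraMap K O₁ k = algebraMap N O₁ (algebraMap G N (algebraMap K G k))) :
    ∃ j : O₁ →ₐ[K] O, IsFrobeniusSubring p j := by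
  let _ : Field κ := IsFractionRing.toField G
  have hαβ := map_map_eq_pow hα hβα hG
  have hβ : Function.Injective β := by
    rw [injective_iff_map_eq_zero]
    intro g hg
    have := hαβ g
    rw [hg, map_zero] at this
    exact pow_eq_zero_iff hp.out.ne_zero |>.1 this.symm
  have hAO : Function.Injective (algebraMap A O) :=
    IsLocalization.injective O P.primeCompl_le_nonZeroDivisors
  let E := FractionRing O
  have hOE : Function.Injective (algebraMap O E) := IsFractionRing.injective O E
  have hNκ : Function.Injective (algebraMap N κ) := IsIntegralClosure.algebraMap_injective N G κ
  have : IsDomain N := hNκ.isDomain _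
  let γ : G →+* O := (algebraMap A O).comp β.toRingHom
  have hγ : Function.Injective γ := hAO.comp hβ
  let ψ : κ →+* E := IsFractionRing.lift (g := (algebraMap O E).comp γ) (hOE.comp hγ)
  have hψ (g : G) : ψ (algebraMap G κ g) = algebraMap O E (γ g) :=
    IsFractionRing.lift_algebraMap _ _
  -- The image of `n` is integral over `O` inside its fraction field, and `O` is integrally closed.
  have hex (n : N) : ∃ o : O, algebraMap O E o = ψ (algebraMap N κ n) := by
    obtain ⟨f, hf, hfn⟩ := IsIntegralClosure.isIntegral G κ n
    apply IsIntegrallyClosed.isIntegral_iff.1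
    refine ⟨f.map γ, hf.map γ, ?_⟩
    have h1 : (algebraMap O E).comp γ = (ψ.comp (algebraMap N κ)).comp (algebraMap G N) := by
      ext g
      change _ = ψ (algebraMap N κ (algebraMap G N g))
      rw [← IsScalarTower.algebraMap_apply, hψ]
      rfl
    rw [Polynomial.eval₂_map, h1]
    change Polynomial.eval₂ _ ((ψ.comp (algebraMap N κ)) n) f = 0
    rw [← Polynomial.hom_eval₂, hfn, map_zero]
  choose τ₀ hτ₀ using hex
  let τ : N →+* O :=
    { toFun := τ₀
      map_one' := hOE (by rw [hτ₀, map_one, map_one, map_one])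
      map_zero' := hOE (by rw [hτ₀, map_zero, map_zero, map_zero])
      map_add' := fun x y => hOE (by rw [hτ₀, map_add, map_add, map_add, hτ₀, hτ₀])
      map_mul' := fun x y => hOE (by rw [hτ₀, map_mul, map_mul, map_mul, hτ₀, hτ₀]) }
  have hτψ (n : N) : algebraMap O E (τ n) = ψ (algebraMap N κ n) := hτ₀ n
  have hτ : Function.Injective τ := fun x y hxy => hNκ (ψ.injective (by rw [← hτψ, ← hτψ, hxy]))
  have hτγ (g : G) : τ (algebraMap G N g) = algebraMap A O (β g) :=
    hOE (by rw [hτψ, ← IsScalarTower.algebraMap_apply, hψ]; rfl)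
  have hτα (a : A) : τ (algebraMap G N (α a)) = algebraMap A O a ^ p := by
    rw [hτγ, hβα, map_pow]
  have hαQ (s : A) (hs : s ∉ P) : algebraMap G N (α s) ∉ Q := by
    rw [hPQ, hβα]
    exact fun h => hs (Ideal.IsPrime.mem_of_pow_mem ‹_› _ h)
  -- If `τ n = a / s` were a nonunit, then `a ∈ P`, and `n ^ p α(s) = α(a)` would lie in `Q`,
  -- although neither `n` nor `α(s)` does.
  have hunit (n : Q.primeCompl) : IsUnit (τ n) := by
    by_contra hn
    obtain ⟨⟨a, s⟩, has⟩ := IsLocalization.surj P.primeCompl (τ n)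
    simp only at has
    have hloc : IsLocalRing O := IsLocalization.AtPrime.isLocalRing O P
    have ha : a ∈ P := by
      by_contra ha
      have : IsUnit (algebraMap A O a) := IsLocalization.map_units O (⟨a, ha⟩ : P.primeCompl)
      rw [← has] at this
      exact hn (isUnit_of_mul_isUnit_left this)
    have h1 : (n : N) ^ p * algebraMap G N (α s) = algebraMap G N (α a) := by
      apply hτ
      rw [map_mul, map_pow, hτα, hτα, ← mul_pow, has]
    have h2 : algebraMap G N (α a) ∈ Q := by
      rw [hPQ, hβα]
      exact P.pow_mem_of_mem ha p hp.out.pos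
    rw [← h1] at h2
    rcases hQ.mem_or_mem h2 with h3 | h3
    · exact n.2 (hQ.mem_of_pow_mem _ h3)
    · exact hαQ s s.2 h3
  let j₀ : O₁ →+* O := IsLocalization.lift (M := Q.primeCompl) hunit
  have hj₀ (n : N) : j₀ (algebraMap N O₁ n) = τ n := IsLocalization.lift_eq _ _
  have hNO₁ : Function.Injective (algebraMap N O₁) :=
    IsLocalization.injective O₁ Q.primeCompl_le_nonZeroDivisors
  let j : O₁ →ₐ[K] O :=
    { j₀ with
      commutes' := fun k => by
        change j₀ _ = _
        rw [hK, hj₀, hτγ, β.commutes, ← IsScalarTower.algebraMap_apply] }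
  have hj (n : N) : j (algebraMap N O₁ n) = τ n := hj₀ n
  have hinj : Function.Injective j := by
    rw [injective_iff_map_eq_zero]
    intro c hc
    obtain ⟨⟨n, s⟩, hns⟩ := IsLocalization.surj Q.primeCompl c
    simp only at hns
    have h1 : τ n = 0 := by rw [← hj, ← hns, map_mul, hc, zero_mul]
    have h2 : n = 0 := hτ (h1.trans (map_zero τ).symm)
    rw [h2, map_zero] at hns
    exact (IsLocalization.map_units O₁ s).mul_left_eq_zero.1 hns
  have hdiv (n : N) (s : A) (hs : s ∉ P) (x : O) (hx : x * algebraMap A O s ^ p = τ n) :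
      ∃ c, j c = x := by
    obtain ⟨u, hu⟩ := IsLocalization.map_units O₁ (⟨_, hαQ s hs⟩ : Q.primeCompl)
    simp only at hu
    refine ⟨algebraMap N O₁ n * ↑u⁻¹, ?_⟩
    have h1 : IsUnit (algebraMap A O s ^ p) :=
      (IsLocalization.map_units O (⟨s, hs⟩ : P.primeCompl)).pow p
    refine h1.mul_right_cancel ?_
    rw [hx, ← hj n, ← hτα, ← hj, ← map_mul, mul_assoc, ← hu, Units.inv_mul, mul_one]
  have hsurj (x : O) : ∃ a s, s ∉ P ∧ x * algebraMap A O s = algebraMap A O a := by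
    obtain ⟨⟨a, s⟩, has⟩ := IsLocalization.surj P.primeCompl x
    exact ⟨a, s, s.2, has⟩
  have hγadj (g : G) : γ g ∈ Algebra.adjoin K (Set.range fun o : O => o ^ p) := by
    have hg : g ∈ Algebra.adjoin K (Set.range α) := hG ▸ Algebra.mem_top
    induction hg using Algebra.adjoin_induction with
    | mem x hx =>
      obtain ⟨a, rfl⟩ := hx
      refine Algebra.subset_adjoin ⟨algebraMap A O a, ?_⟩
      change _ = algebraMap A O (β (α a))
      rw [hβα, map_pow]
    | algebraMap k =>
      have : γ (algebraMap K G k) = algebraMap K O k := by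
        change algebraMap A O (β _) = _
        rw [β.commutes, ← IsScalarTower.algebraMap_apply]
      rw [this]
      exact Subalgebra.algebraMap_mem _ _
    | add x y _ _ hx hy => rw [map_add]; exact add_mem hx hy
    | mul x y _ _ hx hy => rw [map_mul]; exact mul_mem hx hy
  have hfrac (n : N) : ∃ g h : G, h ≠ 0 ∧ γ h * τ n = γ g := by
    obtain ⟨g, h, hh, hgh⟩ := IsFractionRing.div_surjective (A := G) (algebraMap N κ n)
    have hh0 : h ≠ 0 := nonZeroDivisors.ne_zero hh
    refine ⟨g, h, hh0, hOE ?_⟩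
    rw [map_mul, hτψ, ← hgh, ← hψ, ← hψ, ← map_mul, mul_div_cancel₀]
    exact (map_ne_zero_iff _ (IsFractionRing.injective G κ)).2 hh0
  refine ⟨j, hinj, fun o => ?_, fun c d x hc hcx => ?_, fun c => ?_⟩
  · obtain ⟨a, s, hs, has⟩ := hsurj o
    exact hdiv (algebraMap G N (α a)) s hs _ (by rw [hτα, ← mul_pow, has])
  · obtain ⟨⟨n, s₁⟩, hn⟩ := IsLocalization.surj Q.primeCompl c
    obtain ⟨⟨m, s₂⟩, hm⟩ := IsLocalization.surj Q.primeCompl d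
    simp only at hn hm
    obtain ⟨a, s, hs, has⟩ := hsurj x
    have hn0 : n ≠ 0 := by
      rintro rfl
      rw [map_zero] at hn
      exact hc ((IsLocalization.map_units O₁ s₁).mul_left_eq_zero.1 hn)
    obtain ⟨n', m', hn', hx⟩ : ∃ n' m' : N, n' ≠ 0 ∧ τ n' * x = τ m' := by
      refine ⟨n * s₂, m * s₁, mul_ne_zero hn0 fun h => s₂.2 (h ▸ Q.zero_mem), ?_⟩
      rw [map_mul, map_mul, ← hj n, ← hj m, ← hn, ← hm, map_mul, map_mul, hj, hj, ← hcx]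
      ring
    have h1 : (algebraMap G N (α s)) * m' ^ p = algebraMap G N (α a) * n' ^ p := by
      apply hτ
      rw [map_mul, map_mul, map_pow, map_pow, hτα, hτα, ← hx, ← has]
      ring
    have hn'κ : algebraMap N κ n' ≠ 0 := (map_ne_zero_iff _ hNκ).2 hn'
    -- Here `m' / n'` represents `x = a / s`, and `α(s)` represents `s ^ p`. Thus `ξ` represents `s
    -- ^ p x`, and its `p`-th power `α(s) ^ (p - 1) α(a)` comes from `G`; so `ξ` is in `N`, and
    -- dividing by `s ^ p` recovers `x`.
    set ξ : κ := algebraMap G κ (α s) * (algebraMap N κ m' / algebraMap N κ n')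
    have hξ : IsIntegral G ξ := by
      refine IsIntegral.of_pow hp.out.pos ?_
      have h2 := congrArg (algebraMap N κ) h1
      rw [map_mul, map_mul, map_pow, map_pow, ← IsScalarTower.algebraMap_apply,
        ← IsScalarTower.algebraMap_apply] at h2
      have h3 : ξ ^ p = algebraMap G κ (α s ^ (p - 1) * α a) := by
        rw [map_mul, map_pow, mul_pow, div_pow]
        have h4 : algebraMap G κ (α s) ^ p =
            algebraMap G κ (α s) ^ (p - 1) * algebraMap G κ (α s) := by
          rw [← pow_succ, Nat.sub_add_cancel hp.out.one_le]
        rw [h4, mul_assoc, ← mul_div_assoc, h2, mul_div_assoc, div_self (pow_ne_zero _ hn'κ),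
          mul_one]
      rw [h3]
      exact isIntegral_algebraMap
    obtain ⟨e, he⟩ := IsIntegralClosure.isIntegral_iff (A := N).1 hξ
    have h5 : e * n' = algebraMap G N (α s) * m' := by
      apply hNκ
      rw [map_mul, map_mul, he, ← IsScalarTower.algebraMap_apply, mul_assoc,
        div_mul_cancel₀ _ hn'κ]
    obtain ⟨c, hc⟩ := hdiv e s hs x (by
      have h6 := congrArg τ h5
      rw [map_mul, map_mul, hτα, ← hx] at h6
      refine mul_right_cancel₀ ((map_ne_zero_iff τ hτ).2 hn') ?_
      rw [h6]
      ring)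
    exact ⟨c, hc.symm⟩
  · obtain ⟨⟨n, s⟩, hn⟩ := IsLocalization.surj Q.primeCompl c
    simp only at hn
    have hs0 : (s : N) ≠ 0 := fun h => s.2 (h ▸ Q.zero_mem)
    obtain ⟨g, h, hh, hgh⟩ := hfrac n
    obtain ⟨g', h', hh', hgh'⟩ := hfrac s
    have hcn : j c * τ s = τ n := by rw [← hj, ← hj, ← map_mul, hn]
    have hg' : γ g' ≠ 0 := by
      rw [← hgh']
      exact mul_ne_zero ((map_ne_zero_iff γ hγ).2 hh') ((map_ne_zero_iff τ hτ).2 hs0)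
    refine ⟨γ g * γ h', mul_mem (hγadj _) (hγadj _), γ h * γ g', mul_mem (hγadj _) (hγadj _),
      mul_ne_zero ((map_ne_zero_iff γ hγ).2 hh) hg', ?_⟩
    rw [← hgh, ← hgh', ← hcn]
    ring

end FrobeniusPair

/-! ### Sections over affine opens as `K`-algebras -/

section Sections

theorem le_preimage_top {X Y : Scheme.{u}} (f : X ⟶ Y) (U : X.Opens) : U ≤ f ⁻¹ᵁ ⊤ := le_top

variable {K : Type u} [Field K] {X : Scheme.{u}} (f : X ⟶ Spec (.of K))

/-- The structure map from `K` to the sections of a `K`-scheme over an open subset. -/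
noncomputable def toSections (U : X.Opens) : K →+* Γ(X, U) :=
  ((Scheme.ΓSpecIso (.of K)).inv ≫ f.appLE ⊤ U (le_preimage_top f U)).hom

theorem germ_toSections (U : X.Opens) (x : X) (hx : x ∈ U) (k : K) :
    (X.presheaf.germ U x hx).hom (toSections f U k) = algebraMap K (LocalRing f x) k := by
  have h : f.appLE ⊤ U (le_preimage_top f U) ≫ X.presheaf.germ U x hx =
      f.appTop ≫ X.presheaf.germ ⊤ x trivial := by
    rw [Scheme.Hom.appLE, Category.assoc]
    exact congrArg (f.appTop ≫ ·) (X.presheaf.germ_res (homOfLE le_top) x hx)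
  change ((Scheme.ΓSpecIso (.of K)).inv ≫ f.appLE ⊤ U (le_preimage_top f U) ≫
    X.presheaf.germ U x hx).hom k = _
  rw [h]
  rfl

theorem appLE_toSections {Y : Scheme.{u}} (g : Y ⟶ X) (U : X.Opens) (V : Y.Opens)
    (e : V ≤ g ⁻¹ᵁ U) (k : K) :
    (g.appLE U V e).hom (toSections f U k) = toSections (g ≫ f) V k := by
  change ((Scheme.ΓSpecIso (.of K)).inv ≫ f.appLE ⊤ U (le_preimage_top f U) ≫
    g.appLE U V e).hom k = _
  rw [Scheme.Hom.appLE_comp_appLE]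
  rfl

theorem ΓSpecIso_inv_appLE_top {K L : Type u} [CommRing K] [CommRing L] (φ : K →+* L) :
    (Scheme.ΓSpecIso (.of K)).inv ≫
        (Spec.map (CommRingCat.ofHom φ)).appLE ⊤ ⊤ (le_preimage_top _ _) =
      CommRingCat.ofHom φ ≫ (Scheme.ΓSpecIso (.of L)).inv := by
  rw [Scheme.ΓSpecIso_inv_naturality, Scheme.Hom.appTop, Scheme.Hom.app_eq_appLE]
  rfl

theorem toSections_comp_specMap {K' : Type u} [Field K'] (φ : K' →+* K) (U : X.Opens) (k : K') :
    toSections (f ≫ Spec.map (CommRingCat.ofHom φ)) U k = toSections f U (φ k) := by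
  have h := ΓSpecIso_inv_appLE_top φ
  have h2 := Scheme.Hom.appLE_comp_appLE f (Spec.map (CommRingCat.ofHom φ)) ⊤ ⊤ U
    (le_preimage_top _ _) (le_preimage_top _ _)
  change ((Scheme.ΓSpecIso (.of K')).inv ≫ _).hom k = _
  rw [← h2, reassoc_of% h]
  rfl

theorem isPushout_toSections {Y : Scheme.{u}} {L : Type u} [Field L] (φ : K →+* L) {g : Y ⟶ X}
    {h : Y ⟶ Spec (.of L)} {f : X ⟶ Spec (.of K)}
    (H : IsPullback g h f (Spec.map (CommRingCat.ofHom φ))) {U : X.Opens} (hU : IsAffineOpen U)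
    {V : Y.Opens} (hV : V = g ⁻¹ᵁ U) :
    IsPushout (CommRingCat.ofHom (toSections f U)) (CommRingCat.ofHom φ)
      (g.appLE U V hV.le) (CommRingCat.ofHom (toSections h V)) := by
  have h1 := (isIso_pushoutSection_iff H (US := ⊤) (UT := ⊤) (UX := U) (UY := V)
    (le_preimage_top _ _) (le_preimage_top _ _) (by simp [hV])).1
      (isIso_pushoutSection_of_isAffineOpen H _ _ _ (isAffineOpen_top _) (isAffineOpen_top _) hU)
  have h2 := ΓSpecIso_inv_appLE_top φ
  refine IsPushout.of_iso h1 (Scheme.ΓSpecIso (.of K)) (Iso.refl _) (Scheme.ΓSpecIso (.of L))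
    (Iso.refl _) ?_ ?_ ?_ ?_
  · rw [← Iso.inv_comp_eq]
    simp only [Iso.refl_hom, Category.comp_id]
    rfl
  · rw [← Iso.inv_comp_eq, ← Category.assoc, h2, Category.assoc, Iso.inv_hom_id, Category.comp_id]
  · simp
  · rw [← Iso.inv_comp_eq]
    simp only [Iso.refl_hom, Category.comp_id]
    rfl

theorem finiteType_toSections [LocallyOfFiniteType f] {U : X.Opens} (hU : IsAffineOpen U) :
    (toSections f U).FiniteType := by
  have h1 := f.finiteType_appLE (isAffineOpen_top _) hU (by simp)
  exact RingHom.FiniteType.comp h1 (RingHom.FiniteType.of_surjective _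
    (Scheme.ΓSpecIso (.of K)).symm.commRingCatIsoToRingEquiv.surjective)

end Sections

/-- A pushout of commutative rings is generated by the images of the two factors. -/
theorem adjoin_range_eq_top_of_isPushout {R S T : Type u} [CommRing R] [CommRing S] [CommRing T]
    {G : Type u} [CommRing G] [Algebra T G] {a : R →+* S} {b : R →+* T} {c : S →+* G}
    (h : IsPushout (CommRingCat.ofHom a) (CommRingCat.ofHom b) (CommRingCat.ofHom c)
      (CommRingCat.ofHom (algebraMap T G))) :
    Algebra.adjoin T (Set.range c) = ⊤ := by
  let D := Algebra.adjoin T (Set.range c)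
  let c' : S →+* D := c.codRestrict D.toSubring fun x => Algebra.subset_adjoin ⟨x, rfl⟩
  have hw : CommRingCat.ofHom a ≫ CommRingCat.ofHom c' =
      CommRingCat.ofHom b ≫ CommRingCat.ofHom (algebraMap T D) := by
    ext x
    exact congrArg (fun φ => φ.hom x) h.w
  let d := h.desc _ _ hw
  have hd : d ≫ CommRingCat.ofHom D.val.toRingHom = 𝟙 _ := by
    apply h.hom_ext
    · rw [← Category.assoc, h.inl_desc]
      rfl
    · rw [← Category.assoc, h.inr_desc]
      rfl
  rw [eq_top_iff]
  rintro x -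
  have hx : D.val (d.hom x) = x := congrArg (fun φ => φ.hom x) hd
  rw [← hx]
  exact (d.hom x).2

theorem isDomain_tensorProduct_of_isPushout {K L A G : Type u} [CommRing K] [CommRing L]
    [Algebra K L] [CommRing A] [Algebra K A] [CommRing G] [IsDomain G] {c : A →+* G} {l : L →+* G}
    (h : IsPushout (CommRingCat.ofHom (algebraMap K A)) (CommRingCat.ofHom (algebraMap K L))
      (CommRingCat.ofHom c) (CommRingCat.ofHom l)) : IsDomain (L ⊗[K] A) :=
  ((CommRingCat.isPushout_tensorProduct K L A).flip.isoIsPushout _ _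
    h).commRingCatIsoToRingEquiv.toMulEquiv.isDomain _

/-! ### Closed regular points of a curve -/

section Curve

theorem ringKrullDim_le_topologicalKrullDim {X : Scheme.{u}} {U : X.Opens} (hU : IsAffineOpen U) :
    ringKrullDim Γ(X, U) ≤ topologicalKrullDim X := by
  rw [← PrimeSpectrum.topologicalKrullDim_eq_ringKrullDim Γ(X, U)]
  change topologicalKrullDim (Spec Γ(X, U)) ≤ _
  rw [← IsHomeomorph.topologicalKrullDim_eq _ hU.isoSpec.hom.homeomorph.isHomeomorph]
  exact topologicalKrullDim_subspace_le X U

/-- A point with zero prime ideal is generic; being closed as well, it would be the whole space,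
which would then have dimension at most zero. -/
theorem primeIdealOf_ne_bot {X : Scheme.{u}} [IsIntegral X] (hdim : ¬ topologicalKrullDim X ≤ 0)
    {x : X} (hx : IsClosed ({x} : Set X)) {U : X.Opens} (hU : IsAffineOpen U) (hxU : x ∈ U) :
    (hU.primeIdealOf ⟨x, hxU⟩).asIdeal ≠ ⊥ := by
  intro h
  have : Nonempty U := ⟨⟨x, hxU⟩⟩
  have hgen : genericPoint X ∈ U :=
    (genericPoint_spec X).mem_open_set_iff U.isOpen |>.2 ⟨x, trivial, hxU⟩
  have h1 : (hU.primeIdealOf ⟨genericPoint X, hgen⟩).asIdeal = ⊥ := by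
    rw [hU.primeIdealOf_genericPoint, genericPoint_eq_bot_of_affine]
    rfl
  have h2 : x = genericPoint X := by
    have h3 : hU.primeIdealOf ⟨x, hxU⟩ = hU.primeIdealOf ⟨genericPoint X, hgen⟩ :=
      PrimeSpectrum.ext (h.trans h1.symm)
    have h4 := congrArg hU.fromSpec h3
    rwa [hU.fromSpec_primeIdealOf, hU.fromSpec_primeIdealOf] at h4
  have h5 : ({x} : Set X) = Set.univ := by
    have h6 := genericPoint_closure (α := X)
    rwa [← h2, hx.closure_eq] at h6
  have : Subsingleton X := ⟨fun y z => by
    have hy : y ∈ ({x} : Set X) := h5 ▸ trivial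
    have hz : z ∈ ({x} : Set X) := h5 ▸ trivial
    rw [Set.mem_singleton_iff] at hy hz
    rw [hy, hz]⟩
  have : Nonempty X := ⟨x⟩
  have : DiscreteTopology X := Subsingleton.discreteTopology
  exact hdim (topologicalKrullDim_zero_of_discreteTopology X)

/-- Regularity makes the number of generators of the maximal ideal equal to the dimension, so that
ideal is principal. -/
theorem isDiscreteValuationRing_of_isRegularLocalRing {O : Type*} [CommRing O] [IsDomain O]
    (h : IsRegularLocalRing O) (hdim : ringKrullDim O ≤ 1) (hO : ¬ IsField O) :
    IsDiscreteValuationRing O := by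
  have h1 := h.spanFinrank_maximalIdeal
  rw [← h1] at hdim
  have h2 : (IsLocalRing.maximalIdeal O).spanFinrank ≤ 1 := by exact_mod_cast hdim
  refine ((IsDiscreteValuationRing.TFAE O hO).out 0 4).2 ?_
  have hfg : (IsLocalRing.maximalIdeal O).FG := IsNoetherian.noetherian _
  have h3 := Submodule.FG.generators_ncard hfg
  have h4 := (Submodule.FG.finite_generators hfg)
  have h5 := Submodule.span_generators (IsLocalRing.maximalIdeal O)
  rw [← h3] at h2
  rcases Set.ncard_le_one_iff_eq h4 |>.1 h2 with h6 | ⟨a, ha⟩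
  · rw [h6, Submodule.span_empty] at h5
    exact ⟨0, by rw [← h5]; simp⟩
  · rw [ha] at h5
    exact ⟨a, h5.symm⟩

end Curve

/-! ### Normalization over affine opens -/

section Normalization

variable {X : Scheme.{u}} [IsIntegral X]

/-- The spectrum of the function field maps entirely into `V`, so its sections over the preimage of
`V` are the function field itself. -/
theorem isFractionRing_fromSpecStalk_app {V : X.Opens} (hV : IsAffineOpen V)
    (hgen : genericPoint X ∈ V) :
    @IsFractionRing Γ(X, V) _
      Γ(Spec (X.presheaf.stalk (genericPoint X)), X.fromSpecStalk (genericPoint X) ⁻¹ᵁ V) _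
      ((X.fromSpecStalk (genericPoint X)).app V).hom.toAlgebra := by
  have : Nonempty V := ⟨⟨_, hgen⟩⟩
  have hfrac := functionField_isFractionRing_of_isAffineOpen X V hV
  have htop : ⊤ = X.fromSpecStalk (genericPoint X) ⁻¹ᵁ V := by
    refine (eq_top_iff.2 fun y _ => ?_).symm
    have h1 : X.fromSpecStalk (genericPoint X) y ∈ Set.range (X.fromSpecStalk (genericPoint X)) :=
      ⟨y, rfl⟩
    rw [Scheme.range_fromSpecStalk] at h1
    have h2 : X.fromSpecStalk (genericPoint X) y ⤳ genericPoint X := h1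
    exact h2.mem_open V.isOpen hgen
  let _ : Algebra Γ(X, V) Γ(Spec (X.presheaf.stalk (genericPoint X)),
      X.fromSpecStalk (genericPoint X) ⁻¹ᵁ V) :=
    ((X.fromSpecStalk (genericPoint X)).app V).hom.toAlgebra
  let e : X.presheaf.stalk (genericPoint X) ≅ Γ(Spec (X.presheaf.stalk (genericPoint X)),
      X.fromSpecStalk (genericPoint X) ⁻¹ᵁ V) :=
    (Scheme.ΓSpecIso _).symm ≪≫
      (Spec (X.presheaf.stalk (genericPoint X))).presheaf.mapIso (eqToIso htop).symm.op
  have he : X.presheaf.germ V (genericPoint X) hgen ≫ e.hom =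
      (X.fromSpecStalk (genericPoint X)).app V := by
    rw [Scheme.fromSpecStalk_app hgen]
    rfl
  let e' : X.functionField ≃ₐ[Γ(X, V)] Γ(Spec (X.presheaf.stalk (genericPoint X)),
      X.fromSpecStalk (genericPoint X) ⁻¹ᵁ V) :=
    AlgEquiv.ofRingEquiv (f := e.commRingCatIsoToRingEquiv)
      fun x => congrArg (fun φ => φ.hom x) he
  exact IsLocalization.isLocalization_of_algEquiv _ e'

/-- The sections of the normalization over an affine open are the integral closure of its ring of
functions in the function field. -/
theorem isIntegralClosure_toNormalization_appLE {X Y : Scheme.{u}} (f : X ⟶ Y) [QuasiCompact f]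
    [QuasiSeparated f] {V : Y.Opens} (hV : IsAffineOpen V)
    (e : f ⁻¹ᵁ V ≤ f.toNormalization ⁻¹ᵁ f.fromNormalization ⁻¹ᵁ V) :
    letI := (f.app V).hom.toAlgebra
    letI := (f.toNormalization.appLE (f.fromNormalization ⁻¹ᵁ V) (f ⁻¹ᵁ V) e).hom.toAlgebra
    IsIntegralClosure Γ(f.normalization, f.fromNormalization ⁻¹ᵁ V) Γ(Y, V) Γ(X, f ⁻¹ᵁ V) := by
  let _ := (f.app V).hom.toAlgebra
  let _ := (f.toNormalization.appLE (f.fromNormalization ⁻¹ᵁ V) (f ⁻¹ᵁ V) e).hom.toAlgebra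
  have h := f.normalizationObjIso_hom_val hV
  have h' (n) : algebraMap Γ(f.normalization, f.fromNormalization ⁻¹ᵁ V) Γ(X, f ⁻¹ᵁ V) n =
      ((f.normalizationObjIso hV).hom.hom n).1 :=
    (congrArg (fun φ => φ.hom n) h).symm
  refine ⟨fun x y hxy => ?_, fun {x} => ⟨fun hx => ?_, fun ⟨y, hy⟩ => ?_⟩⟩
  · rw [h', h'] at hxy
    exact (f.normalizationObjIso hV).commRingCatIsoToRingEquiv.injective (Subtype.ext hxy)
  · obtain ⟨y, hy⟩ := (f.normalizationObjIso hV).commRingCatIsoToRingEquiv.surjective ⟨x, hx⟩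
    exact ⟨y, (h' y).trans (congrArg Subtype.val hy)⟩
  · rw [← hy, h']
    exact ((f.normalizationObjIso hV).hom.hom y).2

end Normalization

theorem mem_primeIdealOf_iff {X : Scheme.{u}} {U : X.Opens} (hU : IsAffineOpen U) (x : U)
    (s : Γ(X, U)) : s ∈ (hU.primeIdealOf x).asIdeal ↔ (x : X) ∉ X.basicOpen s := by
  have := hU.isLocalization_stalk x
  rw [X.mem_basicOpen _ _ x.2]
  have h := IsLocalization.AtPrime.isUnit_to_map_iff (X.presheaf.stalk (x : X))
    (hU.primeIdealOf x).asIdeal s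
  rw [← not_iff_not, not_not]
  exact h.symm

theorem absoluteFrobenius_appLE (X : Scheme.{u}) (p : ℕ) [Fact p.Prime] (h : (p : Γ(X, ⊤)) = 0)
    (U : X.Opens) (e : U ≤ absoluteFrobenius X p h ⁻¹ᵁ U) (a : Γ(X, U)) :
    ((absoluteFrobenius X p h).appLE U U e).hom a = a ^ p := by
  have h1 : (absoluteFrobenius X p h).appLE U U e = (absoluteFrobenius X p h).app U :=
    ((absoluteFrobenius X p h).app_eq_appLE).symm
  rw [h1]
  rfl

/-! ### From the curve to its local rings -/

section Main

variable {K : Type u} [Field K] {p : ℕ} [hp : Fact p.Prime] [CharP K p]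

theorem exists_isFrobeniusSubring_of_normalization {C Y Z : Scheme.{u}} [IsIntegral C]
    [IsIntegral Y] {f : C ⟶ Spec (.of K)} {pr : Y ⟶ C} {str : Y ⟶ Spec (.of K)} {F : C ⟶ Y}
    (hpb : IsPullback pr str f (specFrobenius p K))
    (hFpr : F ≫ pr = absoluteFrobenius C p (natCast_globalSections_eq_zero p f))
    (hFstr : F ≫ str = f) (ι : Z ⟶ Y) [QuasiCompact ι] [QuasiSeparated ι]
    (hfrac : ∀ V : Y.Opens, IsAffineOpen V → Nonempty V →
      @IsFractionRing Γ(Y, V) _ Γ(Z, ι ⁻¹ᵁ V) _ (ι.app V).hom.toAlgebra)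
    (P : C) [IsDomain (LocalRing f P)] [IsIntegrallyClosed (LocalRing f P)]
    (P₁ : ι.normalization) (hP₁ : ι.fromNormalization P₁ = F P) :
    ∃ j : LocalRing (ι.fromNormalization ≫ str) P₁ →ₐ[K] LocalRing f P,
      IsFrobeniusSubring p j := by
  obtain ⟨U, hU, hPU, -⟩ := exists_isAffineOpen_mem_and_subset (Opens.mem_top P)
  have : IsAffineHom (specFrobenius p K) := by
    unfold specFrobenius
    infer_instance
  have : IsAffineHom pr := MorphismProperty.of_isPullback hpb.flip inferInstance
  obtain ⟨V, hVU⟩ : ∃ V, V = pr ⁻¹ᵁ U := ⟨_, rfl⟩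
  have hV : IsAffineOpen V := hVU ▸ hU.preimage pr
  -- The composite of `F` and `pr` is the absolute Frobenius, which is the identity on points.
  have hUV : U ≤ F ⁻¹ᵁ V := by
    rw [hVU, ← Scheme.Hom.comp_preimage, hFpr]
    exact le_rfl
  have hW : IsAffineOpen (ι.fromNormalization ⁻¹ᵁ V) := hV.preimage _
  have hFP : F P ∈ V := hUV hPU
  have hP₁W : P₁ ∈ ι.fromNormalization ⁻¹ᵁ V := by
    rw [← hP₁] at hFP
    exact hFP
  have e : ι ⁻¹ᵁ V ≤ ι.toNormalization ⁻¹ᵁ ι.fromNormalization ⁻¹ᵁ V := by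
    rw [← Scheme.Hom.comp_preimage, ι.toNormalization_fromNormalization]
  have : Nonempty U := ⟨⟨P, hPU⟩⟩
  have : Nonempty V := ⟨⟨_, hFP⟩⟩
  let _ : Algebra K Γ(C, U) := (toSections f U).toAlgebra
  let _ : Algebra K Γ(Y, V) := (toSections str V).toAlgebra
  let _ : Algebra Γ(Y, V) Γ(Z, ι ⁻¹ᵁ V) := (ι.app V).hom.toAlgebra
  let _ : Algebra Γ(Y, V) Γ(ι.normalization, ι.fromNormalization ⁻¹ᵁ V) :=
    (ι.fromNormalization.app V).hom.toAlgebra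
  let _ : Algebra Γ(ι.normalization, ι.fromNormalization ⁻¹ᵁ V) Γ(Z, ι ⁻¹ᵁ V) :=
    (ι.toNormalization.appLE _ (ι ⁻¹ᵁ V) e).hom.toAlgebra
  let _ : Algebra Γ(C, U) (LocalRing f P) := (C.presheaf.germ U P hPU).hom.toAlgebra
  let _ : Algebra Γ(ι.normalization, ι.fromNormalization ⁻¹ᵁ V)
      (LocalRing (ι.fromNormalization ≫ str) P₁) :=
    (ι.normalization.presheaf.germ _ P₁ hP₁W).hom.toAlgebra
  have : IsScalarTower Γ(Y, V) Γ(ι.normalization, ι.fromNormalization ⁻¹ᵁ V) Γ(Z, ι ⁻¹ᵁ V) := by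
    refine .of_algebraMap_eq' ?_
    have h : ι.fromNormalization.app V ≫ ι.toNormalization.appLE _ (ι ⁻¹ᵁ V) e = ι.app V := by
      rw [Scheme.Hom.app_eq_appLE, Scheme.Hom.appLE_comp_appLE, Scheme.Hom.app_eq_appLE]
      congr 1
      exact ι.toNormalization_fromNormalization
    exact congrArg CommRingCat.Hom.hom h.symm
  have : IsFractionRing Γ(Y, V) Γ(Z, ι ⁻¹ᵁ V) := hfrac V hV inferInstance
  have : IsIntegralClosure Γ(ι.normalization, ι.fromNormalization ⁻¹ᵁ V) Γ(Y, V) Γ(Z, ι ⁻¹ᵁ V) :=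
    isIntegralClosure_toNormalization_appLE ι hV e
  have : IsLocalization.AtPrime (LocalRing f P) (hU.primeIdealOf ⟨P, hPU⟩).asIdeal :=
    hU.isLocalization_stalk ⟨P, hPU⟩
  have : IsLocalization.AtPrime (LocalRing (ι.fromNormalization ≫ str) P₁)
      (hW.primeIdealOf ⟨P₁, hP₁W⟩).asIdeal := hW.isLocalization_stalk ⟨P₁, hP₁W⟩
  have : IsScalarTower K Γ(C, U) (LocalRing f P) :=
    .of_algebraMap_eq fun k => (germ_toSections f U P hPU k).symm
  let β : Γ(Y, V) →ₐ[K] Γ(C, U) :=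
    { (F.appLE V U hUV).hom with
      commutes' := fun k => by
        refine (appLE_toSections str F V U hUV k).trans ?_
        rw [hFstr]
        rfl }
  -- `α` is pullback along the projection of the twist, semilinear over the Frobenius of `K`, and
  -- `β` is pullback along the relative Frobenius; `β ∘ α` is the absolute Frobenius.
  refine exists_isFrobeniusSubring (p := p) (α := (pr.appLE U V hVU.le).hom) (β := β) ?_ ?_ ?_
    (κ := Γ(Z, ι ⁻¹ᵁ V))
    (hU.primeIdealOf ⟨P, hPU⟩).asIdeal (hW.primeIdealOf ⟨P₁, hP₁W⟩).asIdeal ?_ ?_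
  · intro k
    refine (appLE_toSections f pr U V hVU.le k).trans ?_
    rw [hpb.w]
    exact toSections_comp_specMap str (frobenius K p) V k
  · intro a
    have h : pr.appLE U V hVU.le ≫ F.appLE V U hUV =
        (absoluteFrobenius C p (natCast_globalSections_eq_zero p f)).appLE U U le_rfl := by
      rw [Scheme.Hom.appLE_comp_appLE]
      congr 1
    exact (congrArg (fun φ => φ.hom a) h).trans (absoluteFrobenius_appLE _ _ _ _ _ _)
  · exact adjoin_range_eq_top_of_isPushout (isPushout_toSections (frobenius K p) hpb hU hVU)
  · intro g
    rw [mem_primeIdealOf_iff, mem_primeIdealOf_iff, not_iff_not]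
    have h1 : P₁ ∈ ι.normalization.basicOpen (ι.fromNormalization.app V g) ↔
        F P ∈ Y.basicOpen g := by
      rw [← Scheme.Hom.preimage_basicOpen, ← hP₁]
      rfl
    refine h1.trans ?_
    have h2 : C.basicOpen (F.appLE V U hUV g) = U ⊓ F ⁻¹ᵁ Y.basicOpen g := by
      rw [Scheme.Hom.appLE, CommRingCat.comp_apply, Scheme.basicOpen_res,
        Scheme.Hom.preimage_basicOpen]
    have h3 : P ∈ C.basicOpen (F.appLE V U hUV g) ↔ F P ∈ Y.basicOpen g := by
      rw [h2]
      exact ⟨fun h => h.2, fun h => ⟨hPU, h⟩⟩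
    exact h3.symm
  · intro k
    rw [← germ_toSections (ι.fromNormalization ≫ str) _ P₁ hP₁W,
      ← appLE_toSections str ι.fromNormalization V _ le_rfl, ← Scheme.Hom.app_eq_appLE]
    rfl

theorem exists_isFrobeniusSubring_of_isPullback {C Y : Scheme.{u}} [IsIntegral C]
    [IsIntegral Y] [QuasiSeparatedSpace Y] {f : C ⟶ Spec (.of K)} {pr : Y ⟶ C}
    {str : Y ⟶ Spec (.of K)} {F : C ⟶ Y} (hpb : IsPullback pr str f (specFrobenius p K))
    (hFpr : F ≫ pr = absoluteFrobenius C p (natCast_globalSections_eq_zero p f))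
    (hFstr : F ≫ str = f) (P : C) [IsDomain (LocalRing f P)] [IsIntegrallyClosed (LocalRing f P)]
    (P₁ : normalization Y) (hP₁ : normalizationMap Y P₁ = F P) :
    ∃ j : LocalRing (normalizationMap Y ≫ str) P₁ →ₐ[K] LocalRing f P, IsFrobeniusSubring p j :=
  exists_isFrobeniusSubring_of_normalization hpb hFpr hFstr (Y.fromSpecStalk (genericPoint Y))
    (fun V hV hne => isFractionRing_fromSpecStalk_app hV
      ((genericPoint_spec Y).mem_open_set_iff V.isOpen |>.2 ⟨_, trivial, hne.some.2⟩)) P P₁ hP₁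

/-- A regular closed point of a geometrically integral curve has a discrete valuation ring as local
ring, which is a localization of a finite algebra over a polynomial ring whose variable vanishes at
the point, and which stays a domain after extension of scalars. -/
theorem exists_localRing_structure (L : Type u) [Field L] [Algebra K L] {C : Scheme.{u}}
    [IsIntegral C] (f : C ⟶ Spec (.of K)) [GeometricallyIntegral f] [LocallyOfFiniteType f]
    (hdim : topologicalKrullDim C = 1) (P : C) (hP : IsClosed ({P} : Set C))
    (hreg : IsRegularLocalRing (C.presheaf.stalk P)) [IsDomain (LocalRing f P)] :
    IsDiscreteValuationRing (LocalRing f P) ∧ IsDomain (L ⊗[K] LocalRing f P) ∧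
    ∃ (A : Type u) (_ : CommRing A) (_ : Algebra K A) (_ : Algebra A (LocalRing f P))
      (_ : IsScalarTower K A (LocalRing f P)) (M : Submonoid A)
      (_ : IsLocalization M (LocalRing f P))
      (φ : Polynomial K →ₐ[K] A), φ.toRingHom.Finite ∧
        algebraMap A (LocalRing f P) (φ Polynomial.X) ≠ 0 ∧
        ¬ IsUnit (algebraMap A (LocalRing f P) (φ Polynomial.X)) := by
  obtain ⟨U, hU, hPU, -⟩ := exists_isAffineOpen_mem_and_subset (Opens.mem_top P)
  have : Nonempty U := ⟨⟨P, hPU⟩⟩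
  let _ : Algebra K Γ(C, U) := (toSections f U).toAlgebra
  let _ : Algebra Γ(C, U) (LocalRing f P) := (C.presheaf.germ U P hPU).hom.toAlgebra
  have htower : IsScalarTower K Γ(C, U) (LocalRing f P) :=
    .of_algebraMap_eq fun k => (germ_toSections f U P hPU k).symm
  set I := (hU.primeIdealOf ⟨P, hPU⟩).asIdeal
  have hloc : IsLocalization.AtPrime (LocalRing f P) I := hU.isLocalization_stalk ⟨P, hPU⟩
  have hI0 : I ≠ ⊥ := primeIdealOf_ne_bot (by rw [hdim]; norm_num) hP hU hPU
  have hdimA : ringKrullDim Γ(C, U) ≤ 1 := hdim ▸ ringKrullDim_le_topologicalKrullDim hU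
  have hinj : Function.Injective (algebraMap Γ(C, U) (LocalRing f P)) :=
    IsLocalization.injective _ I.primeCompl_le_nonZeroDivisors
  have hnonunit (a : Γ(C, U)) (ha : a ∈ I) : ¬ IsUnit (algebraMap _ (LocalRing f P) a) := by
    rw [IsLocalization.AtPrime.isUnit_to_map_iff (LocalRing f P) I]
    exact fun h => h ha
  refine ⟨?_, ?_, Γ(C, U), inferInstance, inferInstance, inferInstance, htower, I.primeCompl, hloc,
    ?_⟩
  · have hdimO : ringKrullDim (LocalRing f P) ≤ 1 := by
      rw [IsLocalization.AtPrime.ringKrullDim_eq_height I (LocalRing f P)]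
      exact (Ideal.height_le_ringKrullDim_of_ne_top (Ideal.IsPrime.ne_top inferInstance)).trans
        hdimA
    refine isDiscreteValuationRing_of_isRegularLocalRing hreg hdimO fun hfield => ?_
    obtain ⟨a, ha, ha0⟩ := Submodule.exists_mem_ne_zero_of_ne_bot hI0
    let _ := hfield.toField
    exact hnonunit a ha (isUnit_iff_ne_zero.2 ((map_ne_zero_iff _ hinj).2 ha0))
  · have hdom : IsDomain (L ⊗[K] Γ(C, U)) := by
      let s : Spec (.of L) ⟶ Spec (.of K) := Spec.map (CommRingCat.ofHom (algebraMap K L))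
      -- Geometric integrality is used here: the base change to `L` is integral, so its sections
      -- over the nonempty preimage of `U` form a domain.
      have : IsIntegral (pullback f s) :=
        pullback_of_geometrically (GeometricallyIntegral.geometrically_isIntegral (f := f)) L s
      have hs : Surjective s := ⟨fun x => ⟨(⊥ : PrimeSpectrum L), Subsingleton.elim _ _⟩⟩
      obtain ⟨x, hx⟩ := (pullback.fst f s).surjective P
      have : Nonempty (pullback.fst f s ⁻¹ᵁ U) := ⟨⟨x, by
        change pullback.fst f s x ∈ U
        rw [hx]
        exact hPU⟩⟩
      exact isDomain_tensorProduct_of_isPushout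
        (isPushout_toSections (algebraMap K L) (IsPullback.of_hasPullback f s) hU rfl)
    exact isDomain_tensorProduct_of_isLocalization I.primeCompl I.primeCompl_le_nonZeroDivisors
  · have : Algebra.FiniteType K Γ(C, U) := finiteType_toSections f hU
    have : Ring.DimensionLEOne Γ(C, U) := by
      refine ⟨fun {Q} hQ0 hQ => ?_⟩
      exact Ring.krullDimLE_one_iff_of_isPrime_bot.1 ((Ring.krullDimLE_iff).2 hdimA) Q hQ0 hQ
    obtain ⟨φ, hφ, h0, hm⟩ := exists_finite_polynomial_algHom (K := K) I hI0
    exact ⟨φ, hφ, (map_ne_zero_iff _ hinj).2 h0, hnonunit _ hm⟩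

end Main

end FrobCurve

theorem mainTheorem7 {K : Type u} [Field K] [IsSepClosed K] (p : ℕ) [Fact p.Prime] [CharP K p]
    (L : Type u) [Field L] [Algebra K L] [IsAlgClosure K L]
    (C : Scheme.{u}) (f : C ⟶ Spec (.of K)) [GeometricallyIntegral f] [IsSeparated f]
    [LocallyOfFiniteType f] [QuasiCompact f] (hdim : topologicalKrullDim C = 1)
    (P : C) (hP : IsClosed ({P} : Set C)) (hreg : IsRegularLocalRing (C.presheaf.stalk P))
    (P₁ : FrobCurve.normalizedFrobenius p f)
    (hP₁ : FrobCurve.normalizedFrobeniusMap p f P₁ = FrobCurve.relativeFrobenius p f P)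
    (hd : FrobCurve.differentialDegree K L
      (FrobCurve.LocalRing (FrobCurve.normalizedFrobeniusStr p f) P₁) = 1) :
    ∃ (_ : IsDomain (FrobCurve.GeomNorm K L (FrobCurve.LocalRing f P)))
      (_ : IsDiscreteValuationRing (FrobCurve.GeomNorm K L (FrobCurve.LocalRing f P))),
      Module.Finite L (FrobCurve.DiffCoker K L (FrobCurve.LocalRing f P)) ∧
      FrobCurve.semigroup K L (FrobCurve.LocalRing f P) =
        {l : ℤ | ∃ a b : ℕ,
          l = FrobCurve.differentialDegree K L (FrobCurve.LocalRing f P) * a + p * b} ∧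
      Module.Finite L (FrobCurve.DeltaQuotient K L (FrobCurve.LocalRing f P)) ∧
      (FrobCurve.deltaInvariant K L (FrobCurve.LocalRing f P) : ℚ) =
        ((FrobCurve.differentialDegree K L (FrobCurve.LocalRing f P) : ℚ) - 1) * ((p : ℚ) - 1) / 2 := by
  have : IsIntegral C := GeometricallyIntegral.isIntegral_of_subsingleton f
  have : IsDomain (FrobCurve.LocalRing f P) := inferInstanceAs (IsDomain (C.presheaf.stalk P))
  obtain ⟨hdvr, hdom, A, _, _, _, _, M, _, φ, hφ, h0, hu⟩ :=
    FrobCurve.exists_localRing_structure L f hdim P hP hreg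
  obtain ⟨j, hj⟩ : ∃ j : FrobCurve.LocalRing (FrobCurve.normalizedFrobeniusStr p f) P₁ →ₐ[K]
      FrobCurve.LocalRing f P, FrobCurve.IsFrobeniusSubring p j :=
    FrobCurve.exists_isFrobeniusSubring_of_isPullback (Y := FrobCurve.frobeniusTwist p f)
      (F := FrobCurve.relativeFrobenius p f) (FrobCurve.isPullback_frobeniusTwist p f)
      (pullback.lift_fst _ _ _) (pullback.lift_snd _ _ _) P P₁ hP₁
  exact FrobCurve.invariants_of_isFrobeniusSubring M φ hφ h0 hu hj hd
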